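/- A flat clustered graph $G=(V,E,\mathcal C)$ is a finite simple graph $(V,E)$ with a partition $\mathcal C=\{V_1,\dots,V_k\}$ of $V$ into nonempty clusters; an edge is inter-cluster if its end-vertices lie in different clusters, and two clusters are adjacent if an edge joins them. An instance $\langle G,\gamma,\sigma\rangle$ of MNTLP with Fixed Order consists of such a graph, a closed axis-aligned square $Q_i=\gamma(V_i)\subset\mathbb R^2$ of positive side length for each cluster, and a bijection $\sigma_i:V_i\to\{1,\dots,|V_i|\}$ for each cluster. Each $Q_i$ is divided into $|V_i|$ columns of equal width, ordered from left to right by $\sigma_i$, and $|V_i|$ rows of equal height, ordered from top to bottom by $\sigma_i$. The question is whether one can choose, for each inter-cluster edge $e=uv$ with $u\in V_i$ and $v\in V_j$, a side (top, bottom, left or right) of $Q_i$ and a side of $Q_j$, and draw $e$ as a simple curve from the mid-point of the part of the chosen side of $Q_i$ that belongs to the column (for top and bottom) or row (for left and right) of $u$ to the analogous point of $Q_j$ for $v$, so that: 1. the squares are pairwise disjoint; 2. every curve is a horizontal segment, a vertical segment, or both $x$-monotone and $y$-monotone (no two of its points have the same $x$-coordinate, and no two have the same $y$-coordinate); 3.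 for any two adjacent clusters $V_i,V_j$, the convex hull of $Q_i\cup Q_j$ is disjoint from every other square and contains the curves of all edges between $V_i$ and $V_j$; 4. no two curves of inter-cluster edges incident to a common cluster meet, except at a common end-point; and 5. no curve meets a square, except at the end-points of the curve. **Theorem.** There is an algorithm for the real RAM (unit-cost random access machine with exact arithmetic and comparison of real numbers, whose natural-number registers allow addition, subtraction, comparison and indirect addressing) that decides MNTLP with Fixed Order in time $|E|^{O(|\mathcal C|^2)}$. That is, there is a constant $c$ such that its running time on every instance is at most $\max(|E|,2)^{c\cdot\max(|\mathcal C|,1)^2}$. In particular, for every fixed number of clusters its running time is bounded by a polynomial in $|E|$. The input is given by arrays that hold the numbers $|V|$, $|\mathcal C|$, $|E|$, the size and the square of each cluster, the cluster and the position $\sigma_i(v)$ of each vertex, and the end-vertices of each edge. -/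

import Mathlib

/-! # NodeTrix representations of flat clustered graphs, and a real random access machine -/

namespace NodeTrix

/-! ## Instances -/

/-- A (closed, non-degenerate) axis-aligned square, given by its lower left corner and its side. -/
structure Square where
  x : ℝ
  y : ℝ
  side : ℝ
  side_pos : 0 < side

/-- The points of a square (interior and boundary). -/
def Square.toSet (Q : Square) : Set (ℝ × ℝ) :=
  Set.Icc Q.x (Q.x + Q.side) ×ˢ Set.Icc Q.y (Q.y + Q.side)

/-- An instance `⟨G = (V, E, 𝒞), γ, σ⟩`: a finite simple graph with vertex set `Fin numV` whose edges
are listed as `s(fst e, snd e)`, `e : Fin numE`; a partition of the vertices into the nonempty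
clusters `{v | cluster v = i}`, `i : Fin numC`; a square for every cluster; and a row-column order of
every cluster, that is, a bijection from the cluster to `{1, …, size of the cluster}`.
Nothing is required of the mutual position of the squares. -/
structure Instance where
  numV : ℕ
  numC : ℕ
  numE : ℕ
  cluster : Fin numV → Fin numC
  cluster_surjective : Function.Surjective cluster
  fst : Fin numE → Fin numV
  snd : Fin numE → Fin numV
  fst_ne_snd : ∀ e, fst e ≠ snd e
  edge_injective : Function.Injective fun e => s(fst e, snd e)
  square : Fin numC → Square
  order : Fin numV → ℕ
  order_bijOn : ∀ i, Set.BijOn order {v | cluster v = i} (Set.Icc 1 (Nat.card {v // cluster v = i}))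

namespace Instance

variable (I : Instance)

/-- The number of vertices of a cluster. -/
noncomputable def size (i : Fin I.numC) : ℕ := Nat.card {v // I.cluster v = i}

/-- The end-vertices of `e` lie in different clusters. -/
def IsInter (e : Fin I.numE) : Prop := I.cluster (I.fst e) ≠ I.cluster (I.snd e)

/-- The edge `e` has an end-vertex in the cluster `i`. -/
def Incident (e : Fin I.numE) (i : Fin I.numC) : Prop :=
  I.cluster (I.fst e) = i ∨ I.cluster (I.snd e) = i

/-- Two distinct clusters joined by an edge. -/
def Adjacent (i j : Fin I.numC) : Prop := i ≠ j ∧ ∃ e, I.Incident e i ∧ I.Incident e j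

/-- The pipe of two squares: the convex hull of their union. -/
def pipe (i j : Fin I.numC) : Set (ℝ × ℝ) :=
  convexHull ℝ ((I.square i).toSet ∪ (I.square j).toSet)

end Instance

/-! ## Representations -/

/-- The four sides of a square. -/
inductive Side where
  | top
  | bottom
  | left
  | right

namespace Instance

variable (I : Instance)

/-- The mid-point of the part of the given side of the matrix of the cluster of `v` that belongs to
the column of `v` (top and bottom side) or to the row of `v` (left and right side). Columns are
ordered from left to right and rows from top to bottom; all have the same width. -/
noncomputable def anchor (v : Fin I.numV) : Side → ℝ × ℝ :=
  let Q := I.square (I.cluster v)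
  let d : ℝ := ((I.order v : ℝ) - 1 / 2) * (Q.side / (I.size (I.cluster v) : ℝ))
  fun
    | Side.top => (Q.x + d, Q.y + Q.side)
    | Side.bottom => (Q.x + d, Q.y)
    | Side.left => (Q.x, Q.y + Q.side - d)
    | Side.right => (Q.x + Q.side, Q.y + Q.side - d)

/-- A curve is monotone in both directions: it is a horizontal segment, or a vertical segment, or no
two of its points have the same `x`-coordinate and no two have the same `y`-coordinate. It is applied
to (the point sets of) simple arcs. -/
def _root_.NodeTrix.IsXYMonotone (γ : Set (ℝ × ℝ)) : Prop :=
  (∃ y, ∀ p ∈ γ, p.2 = y) ∨ (∃ x, ∀ p ∈ γ, p.1 = x) ∨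
    (Set.InjOn Prod.fst γ ∧ Set.InjOn Prod.snd γ)

/-- A side assignment: `side i e` is the side of the matrix of the cluster `i` to which the
inter-cluster edge `e` incident to `i` is attached (other values are irrelevant). -/
abbrev SideAssignment : Type := Fin I.numC → Fin I.numE → Side

/-- A drawing of the inter-cluster edges by parametrised curves (the curves of other edges are
irrelevant). -/
abbrev Drawing : Type := Fin I.numE → unitInterval → ℝ × ℝ

/-- The side assignment and the drawing form, with the given squares and row-column orders, a
monotone NodeTrix representation. -/
structure IsMonotoneRep (side : I.SideAssignment) (curve : I.Drawing) : Prop where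
  /-- distinct matrices are disjoint -/
  disjoint : ∀ i j, i ≠ j → Disjoint (I.square i).toSet (I.square j).toSet
  /-- inter-cluster edges are simple arcs -/
  continuous : ∀ e, I.IsInter e → Continuous (curve e)
  injective : ∀ e, I.IsInter e → Function.Injective (curve e)
  /-- between the points prescribed by the side assignment and the row-column orders -/
  source : ∀ e, I.IsInter e →
    curve e 0 = I.anchor (I.fst e) (side (I.cluster (I.fst e)) e)
  target : ∀ e, I.IsInter e →
    curve e 1 = I.anchor (I.snd e) (side (I.cluster (I.snd e)) e)
  xyMonotone : ∀ e, I.IsInter e → IsXYMonotone (Set.range (curve e))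
  /-- the pipe of two adjacent clusters meets no third square -/
  pipe_disjoint : ∀ i j, I.Adjacent i j → ∀ k, k ≠ i → k ≠ j →
    Disjoint (I.pipe i j) (I.square k).toSet
  /-- every inter-cluster edge lies in its pipe -/
  inside_pipe : ∀ e, I.IsInter e →
    Set.range (curve e) ⊆ I.pipe (I.cluster (I.fst e)) (I.cluster (I.snd e))

/-- `p` is one of the two end-points (incidence points) of the drawing of `e`. -/
def IsEnd (curve : I.Drawing) (e : Fin I.numE) (p : ℝ × ℝ) : Prop :=
  p = curve e 0 ∨ p = curve e 1

/-- The crossings between two inter-cluster edges incident to the cluster `i`: the common points of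
the two curves that are not end-points of both. -/
def crossings (curve : I.Drawing) (i : Fin I.numC) : Set (Fin I.numE × Fin I.numE × (ℝ × ℝ)) :=
  {c | c.1 < c.2.1 ∧ I.IsInter c.1 ∧ I.IsInter c.2.1 ∧ I.Incident c.1 i ∧ I.Incident c.2.1 i ∧
    c.2.2 ∈ Set.range (curve c.1) ∧ c.2.2 ∈ Set.range (curve c.2.1) ∧
    ¬ (I.IsEnd curve c.1 c.2.2 ∧ I.IsEnd curve c.2.1 c.2.2)}

/-- The total number of local crossings. -/
noncomputable def numCrossings (curve : I.Drawing) : ℕ∞ := ∑ i, (I.crossings curve i).encard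

/-- There is no local crossing, and inter-cluster edges meet matrices only in their incidence
points. -/
def IsLocallyPlanar (curve : I.Drawing) : Prop :=
  I.numCrossings curve = 0 ∧
    ∀ e, I.IsInter e → ∀ i, ∀ p ∈ Set.range (curve e), p ∈ (I.square i).toSet → I.IsEnd curve e p

/-- Monotone NodeTrix Local Planarity with fixed order (and free sides): there is a monotone locally
planar NodeTrix representation with the given squares and the given row-column orders. -/
def MNTLP : Prop :=
  ∃ (side : I.SideAssignment) (curve : I.Drawing),
    I.IsMonotoneRep side curve ∧ I.IsLocallyPlanar curve

end Instance

/-! ## A real random access machine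

Programs work on finitely many named arrays of natural numbers and finitely many named arrays of real
numbers, both unbounded; a scalar variable is the cell `0` of an array. Natural numbers can be added,
subtracted (truncated at `0`), compared and used as indices; real numbers can be added, subtracted,
multiplied, divided and compared. There is neither a multiplication of natural numbers nor any
rounding of real numbers, and the only constants are natural numbers. Every elementary operation
takes one step. -/

/-- A memory content: `nat a j` and `real a j` are the cells with index `j` of the arrays named `a`. -/
structure Store where
  nat : ℕ → ℕ → ℕ
  real : ℕ → ℕ → ℝ

/-- Expressions for natural numbers. -/
inductive NExpr where
  | const (n : ℕ)
  | get (a : ℕ) (index : NExpr)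
  | plus (e₁ e₂ : NExpr)
  | minus (e₁ e₂ : NExpr)

/-- Expressions for real numbers. -/
inductive RExpr where
  | ofNat (e : NExpr)
  | get (a : ℕ) (index : NExpr)
  | plus (e₁ e₂ : RExpr)
  | minus (e₁ e₂ : RExpr)
  | times (e₁ e₂ : RExpr)
  | quot (e₁ e₂ : RExpr)

/-- Tests. -/
inductive Test where
  | natLt (e₁ e₂ : NExpr)
  | realLt (e₁ e₂ : RExpr)
  | neg (b : Test)
  | conj (b₁ b₂ : Test)

/-- Programs. -/
inductive Prog where
  | skip
  | setNat (a : ℕ) (index value : NExpr)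
  | setReal (a : ℕ) (index : NExpr) (value : RExpr)
  | seq (p q : Prog)
  | branch (b : Test) (p q : Prog)
  | loop (b : Test) (p : Prog)

/-- The value of an expression. -/
def NExpr.eval (s : Store) : NExpr → ℕ
  | const n => n
  | get a i => s.nat a (i.eval s)
  | plus e₁ e₂ => e₁.eval s + e₂.eval s
  | minus e₁ e₂ => e₁.eval s - e₂.eval s

/-- The number of steps needed to evaluate an expression. -/
def NExpr.cost : NExpr → ℕ
  | const _ => 1
  | get _ i => i.cost + 1
  | plus e₁ e₂ => e₁.cost + e₂.cost + 1
  | minus e₁ e₂ => e₁.cost + e₂.cost + 1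

/-- The value of an expression (division by zero gives zero). -/
noncomputable def RExpr.eval (s : Store) : RExpr → ℝ
  | ofNat e => (e.eval s : ℝ)
  | get a i => s.real a (i.eval s)
  | plus e₁ e₂ => e₁.eval s + e₂.eval s
  | minus e₁ e₂ => e₁.eval s - e₂.eval s
  | times e₁ e₂ => e₁.eval s * e₂.eval s
  | quot e₁ e₂ => e₁.eval s / e₂.eval s

/-- The number of steps needed to evaluate an expression. -/
def RExpr.cost : RExpr → ℕ
  | ofNat e => e.cost + 1
  | get _ i => i.cost + 1
  | plus e₁ e₂ => e₁.cost + e₂.cost + 1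
  | minus e₁ e₂ => e₁.cost + e₂.cost + 1
  | times e₁ e₂ => e₁.cost + e₂.cost + 1
  | quot e₁ e₂ => e₁.cost + e₂.cost + 1

/-- The test succeeds. -/
def Test.Holds (s : Store) : Test → Prop
  | natLt e₁ e₂ => e₁.eval s < e₂.eval s
  | realLt e₁ e₂ => e₁.eval s < e₂.eval s
  | neg b => ¬ b.Holds s
  | conj b₁ b₂ => b₁.Holds s ∧ b₂.Holds s

/-- The number of steps needed to evaluate a test. -/
def Test.cost : Test → ℕ
  | natLt e₁ e₂ => e₁.cost + e₂.cost + 1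
  | realLt e₁ e₂ => e₁.cost + e₂.cost + 1
  | neg b => b.cost + 1
  | conj b₁ b₂ => b₁.cost + b₂.cost + 1

/-- Overwrite one cell of an array of natural numbers. -/
def Store.setNat (s : Store) (a j n : ℕ) : Store :=
  { s with nat := Function.update s.nat a (Function.update (s.nat a) j n) }

/-- Overwrite one cell of an array of real numbers. -/
noncomputable def Store.setReal (s : Store) (a j : ℕ) (r : ℝ) : Store :=
  { s with real := Function.update s.real a (Function.update (s.real a) j r) }

/-- `Exec p s t s'`: started on the memory content `s`, the program `p` halts after exactly `t` steps
with the memory content `s'`. -/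
inductive Exec : Prog → Store → ℕ → Store → Prop where
  | skip (s : Store) : Exec Prog.skip s 1 s
  | setNat (s : Store) (a : ℕ) (i v : NExpr) :
      Exec (Prog.setNat a i v) s (i.cost + v.cost + 1) (s.setNat a (i.eval s) (v.eval s))
  | setReal (s : Store) (a : ℕ) (i : NExpr) (v : RExpr) :
      Exec (Prog.setReal a i v) s (i.cost + v.cost + 1) (s.setReal a (i.eval s) (v.eval s))
  | seq {p q : Prog} {s s₁ s₂ : Store} {t₁ t₂ : ℕ} :
      Exec p s t₁ s₁ → Exec q s₁ t₂ s₂ → Exec (Prog.seq p q) s (t₁ + t₂) s₂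
  | branchTrue {b : Test} {p q : Prog} {s s₁ : Store} {t : ℕ} :
      b.Holds s → Exec p s t s₁ → Exec (Prog.branch b p q) s (b.cost + 1 + t) s₁
  | branchFalse {b : Test} {p q : Prog} {s s₁ : Store} {t : ℕ} :
      ¬ b.Holds s → Exec q s t s₁ → Exec (Prog.branch b p q) s (b.cost + 1 + t) s₁
  | loopStop {b : Test} {p : Prog} {s : Store} :
      ¬ b.Holds s → Exec (Prog.loop b p) s (b.cost + 1) s
  | loopStep {b : Test} {p : Prog} {s s₁ s₂ : Store} {t₁ t₂ : ℕ} :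
      b.Holds s → Exec p s t₁ s₁ → Exec (Prog.loop b p) s₁ t₂ s₂ →
      Exec (Prog.loop b p) s (b.cost + 1 + t₁ + t₂) s₂

/-- The machine is deterministic: the running time and the result of a run are determined. -/
theorem Exec.deterministic {p : Prog} {s s₁ s₂ : Store} {t₁ t₂ : ℕ}
    (h₁ : Exec p s t₁ s₁) (h₂ : Exec p s t₂ s₂) : t₁ = t₂ ∧ s₁ = s₂ := by
  induction h₁ generalizing t₂ s₂ with
  | skip s => cases h₂; exact ⟨rfl, rfl⟩
  | setNat s a i v => cases h₂; exact ⟨rfl, rfl⟩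
  | setReal s a i v => cases h₂; exact ⟨rfl, rfl⟩
  | seq _ _ ih₁ ih₂ =>
    cases h₂ with
    | seq g₁ g₂ =>
      obtain ⟨rfl, rfl⟩ := ih₁ g₁
      obtain ⟨rfl, rfl⟩ := ih₂ g₂
      exact ⟨rfl, rfl⟩
  | branchTrue hb _ ih =>
    cases h₂ with
    | branchTrue _ g => obtain ⟨rfl, rfl⟩ := ih g; exact ⟨rfl, rfl⟩
    | branchFalse hb' _ => exact absurd hb hb'
  | branchFalse hb _ ih =>
    cases h₂ with
    | branchTrue hb' _ => exact absurd hb' hb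
    | branchFalse _ g => obtain ⟨rfl, rfl⟩ := ih g; exact ⟨rfl, rfl⟩
  | loopStop hb =>
    cases h₂ with
    | loopStop _ => exact ⟨rfl, rfl⟩
    | loopStep hb' _ _ => exact absurd hb' hb
  | loopStep hb _ _ ih₁ ih₂ =>
    cases h₂ with
    | loopStop hb' => exact absurd hb hb'
    | loopStep _ g₁ g₂ =>
      obtain ⟨rfl, rfl⟩ := ih₁ g₁
      obtain ⟨rfl, rfl⟩ := ih₂ g₂
      exact ⟨rfl, rfl⟩

/-! ## Decision procedures -/

/-- The input of a program. Arrays of natural numbers: `0` holds the numbers of vertices, clusters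
and edges; `1` the sizes of the clusters; `2` and `3` the cluster and the position in the row-column
order of every vertex; `4` and `5` the end-vertices of every edge. Arrays of real numbers: `0`, `1`
and `2` hold the coordinates of the lower left corners and the side lengths of the squares. All other
cells are zero. -/
noncomputable def Instance.input (I : Instance) : Store where
  nat := fun
    | 0, 0 => I.numV
    | 0, 1 => I.numC
    | 0, 2 => I.numE
    | 1, j => if h : j < I.numC then I.size ⟨j, h⟩ else 0
    | 2, j => if h : j < I.numV then (I.cluster ⟨j, h⟩ : ℕ) else 0
    | 3, j => if h : j < I.numV then I.order ⟨j, h⟩ else 0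
    | 4, j => if h : j < I.numE then (I.fst ⟨j, h⟩ : ℕ) else 0
    | 5, j => if h : j < I.numE then (I.snd ⟨j, h⟩ : ℕ) else 0
    | _, _ => 0
  real := fun
    | 0, j => if h : j < I.numC then (I.square ⟨j, h⟩).x else 0
    | 1, j => if h : j < I.numC then (I.square ⟨j, h⟩).y else 0
    | 2, j => if h : j < I.numC then (I.square ⟨j, h⟩).side else 0
    | _, _ => 0

/-- On the input `I`, the program halts and its answer, the cell `0` of the array `6` of natural
numbers, is `1` if `I` has a monotone locally planar representation and `0` otherwise. -/
def Prog.DecidesMNTLP (P : Prog) (I : Instance) : Prop :=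
  ∃ t s, Exec P I.input t s ∧
    (I.MNTLP → s.nat 6 0 = 1) ∧ (¬ I.MNTLP → s.nat 6 0 = 0)

/-- On the input `I`, the program halts after at most `T` steps. -/
def Prog.RunsWithin (P : Prog) (I : Instance) (T : ℕ) : Prop :=
  ∃ t s, Exec P I.input t s ∧ t ≤ T

end NodeTrix

namespace NodeTrix

/-! ## Sides, outward coordinates and straight segments -/

/-! Three reductions carry the proof: curves become straight segments, a bounded guess leaves a
constraint problem with two values per edge, and the resulting search is compiled to the machine.

Straightening (`mntlp_iff`). If the squares are disjoint and no pipe meets a third square (`Valid`),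
only the choice of sides matters. A segment between two anchors stays in the pipe by convexity, and
its interior avoids all squares as soon as it heads outwards at both ends (`Legal`); a monotone
curve that avoids its end squares forces exactly this (`nrm_lt_of_arc`). If the segments of two
edges cross, so do the curves: an anchor cannot lie strictly between a curve and its segment, since
that region is in the pipe and beyond the two sides (`noSqueeze_of_valid`). So curves and segments
have the same relative order at the two extreme common levels, and the order must change in between
(`Arc.meet`). Crossing segments of different edges are never parallel (`Valid.det_ne_zero`), so
signs of determinants detect crossings.

Guessing. Each edge now has sixteen options, the pairs of sides, and at most two legal options do
not use opposite sides (`exists_opp_of_three`). For every ordered pair of clusters and every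
direction `a`, consider the edges that a solution attaches to `a` and `a.opp`. Pin the edges among
them that are first or last in the order of either cluster, and all edges at the corners of the box
spanned by these extreme positions: at most eight edges, hence at most `32 k²` pins for `k` clusters
(`exists_pins`). Given the pins, discard every option that is illegal or in conflict with a pin, and
every option with opposite sides outside its box.

The central fact is `compat_of_three`: if an option `(a, a.opp)` survives together with two more
options of the same edge, it is compatible with all surviving options of all other edges. The two
others turn round a corner of a square without crossing the pins of this type, which makes an end of
the edge extreme among the ends of the pins. Either both ends are extreme, and the edge sits at a
corner and is itself pinned, which leaves it one option only; or one end is extreme in both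
directions, and all these pins share it. Then the edge lies inside a fan of pins, and whatever
crosses it crosses a rib of the fan (`not_cross_of_sandwich`).

Hence a solution can be changed so that every edge uses its first or its last surviving option,
where opposite sides are numbered first (`guess_of_solution`). Binary constraints with at most two
values are decided by unit propagation (`solution_of_good`), as for 2-SAT. Conversely an accepted
guess, sensible or not, gives a solution (`solution_of_guess`).

Running time. With `m` edges there are `(16 m + 1) ^ (32 k²)` guesses. Programs made of loops over
fixed bounds compile to the machine in time polynomial in the largest bound (`Stmt.exec`,
`Stmt.polyBdd_time`), and the number of guesses dominates the bounds up to lower-order factors. This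
gives an exponent of order `k²`. -/

instance : DecidableEq Side := fun a b => by
  cases a <;> cases b <;> first | exact isTrue rfl | exact isFalse nofun

/-- The opposite side. -/
def Side.opp : Side → Side
  | .top => .bottom
  | .bottom => .top
  | .left => .right
  | .right => .left

/-- The coordinate that increases in the outward direction of a side. -/
def Side.nrm : Side → ℝ × ℝ → ℝ
  | .top, z => z.2
  | .bottom, z => -z.2
  | .left, z => -z.1
  | .right, z => z.1

/-- The maximum of the outward coordinate of a side on a square. -/
def Square.sup (Q : Square) : Side → ℝ
  | .top => Q.y + Q.side
  | .bottom => -Q.y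
  | .left => -Q.x
  | .right => Q.x + Q.side

@[simp] theorem Side.opp_opp (s : Side) : s.opp.opp = s := by cases s <;> rfl

theorem Side.nrm_opp (s : Side) (z : ℝ × ℝ) : s.opp.nrm z = -s.nrm z := by
  cases s <;> simp [Side.opp, Side.nrm]

theorem Square.mem_toSet_iff (Q : Square) (z : ℝ × ℝ) :
    z ∈ Q.toSet ↔ ∀ s : Side, s.nrm z ≤ Q.sup s := by
  constructor
  · rintro ⟨⟨h1, h2⟩, h3, h4⟩ s
    cases s <;> simp [Side.nrm, Square.sup] <;> assumption
  · intro h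
    have h1 := h .left
    have h2 := h .right
    have h3 := h .bottom
    have h4 := h .top
    simp only [Side.nrm, Square.sup, neg_le_neg_iff] at h1 h2 h3 h4
    exact ⟨⟨h1, h2⟩, h3, h4⟩

/-- The point of the line through `p` and `q` with affine parameter `t`. -/
def pt (p q : ℝ × ℝ) (t : ℝ) : ℝ × ℝ := ((1 - t) * p.1 + t * q.1, (1 - t) * p.2 + t * q.2)

@[simp] theorem pt_zero (p q : ℝ × ℝ) : pt p q 0 = p := by simp [pt]

@[simp] theorem pt_one (p q : ℝ × ℝ) : pt p q 1 = q := by simp [pt]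

theorem pt_symm (p q : ℝ × ℝ) (t : ℝ) : pt q p (1 - t) = pt p q t := by
  ext <;> simp [pt] <;> ring

theorem Side.nrm_pt (s : Side) (p q : ℝ × ℝ) (t : ℝ) :
    s.nrm (pt p q t) = (1 - t) * s.nrm p + t * s.nrm q := by
  cases s <;> simp only [Side.nrm, pt] <;> ring

theorem continuous_nrm (s : Side) : Continuous s.nrm := by
  cases s <;> unfold Side.nrm <;> fun_prop

theorem continuous_pt (p q : ℝ × ℝ) : Continuous (pt p q) := by
  unfold pt; fun_prop

theorem pt_mem_of_convex {K : Set (ℝ × ℝ)} (hK : Convex ℝ K) {p q : ℝ × ℝ} (hp : p ∈ K)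
    (hq : q ∈ K) {t : ℝ} (h0 : 0 ≤ t) (h1 : t ≤ 1) : pt p q t ∈ K := by
  have := hK hp hq (sub_nonneg.2 h1) h0 (by ring)
  convert this using 1
  ext <;> simp [pt]

/-- Points with the same coordinates in two perpendicular directions are equal. -/
theorem eq_of_nrm_eq {a c : Side} (h1 : c ≠ a) (h2 : c ≠ a.opp) {z w : ℝ × ℝ}
    (ha : a.nrm z = a.nrm w) (hc : c.nrm z = c.nrm w) : z = w := by
  cases a <;> cases c <;> simp_all [Side.opp, Side.nrm, Prod.ext_iff]

/-- The open segments `pq` and `p'q'` have a common point. -/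
def Cross (p q p' q' : ℝ × ℝ) : Prop :=
  ∃ t u : ℝ, 0 < t ∧ t < 1 ∧ 0 < u ∧ u < 1 ∧ pt p q t = pt p' q' u

theorem Cross.symm {p q p' q' : ℝ × ℝ} (h : Cross p q p' q') : Cross p' q' p q := by
  obtain ⟨t, u, h1, h2, h3, h4, h⟩ := h
  exact ⟨u, t, h3, h4, h1, h2, h.symm⟩

theorem Cross.swap_left {p q p' q' : ℝ × ℝ} (h : Cross p q p' q') : Cross q p p' q' := by
  obtain ⟨t, u, h1, h2, h3, h4, h⟩ := h
  exact ⟨1 - t, u, by linarith, by linarith, h3, h4, by rw [pt_symm, h]⟩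

theorem Cross.swap_right {p q p' q' : ℝ × ℝ} (h : Cross p q p' q') : Cross p q q' p' :=
  h.symm.swap_left.symm

/-- Two segments that swap their order between two levels cross. -/
theorem cross_of_strip {a c : Side} (h1 : c ≠ a) (h2 : c ≠ a.opp) {p q p' q' : ℝ × ℝ} {t₀ t₁ : ℝ}
    (ht₀ : 0 ≤ t₀) (ht₀' : t₀ ≤ 1) (ht₁ : 0 ≤ t₁) (ht₁' : t₁ ≤ 1) (hpq : a.nrm p < a.nrm q)
    (hN₀ : a.nrm (pt p' q' t₀) = a.nrm p) (hN₁ : a.nrm (pt p' q' t₁) = a.nrm q)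
    (hM₀ : c.nrm p < c.nrm (pt p' q' t₀)) (hM₁ : c.nrm (pt p' q' t₁) < c.nrm q) :
    Cross p q p' q' := by
  set δ₀ := c.nrm (pt p' q' t₀) - c.nrm p with hδ₀
  set δ₁ := c.nrm q - c.nrm (pt p' q' t₁) with hδ₁
  have d0 : 0 < δ₀ := by linarith
  have d1 : 0 < δ₁ := by linarith
  have hd : 0 < δ₀ + δ₁ := by linarith
  -- The gap between the segments is affine in the level and runs from `δ₀` to `-δ₁`; it vanishes at
  -- this fraction of the way.
  set l := δ₀ / (δ₀ + δ₁) with hl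
  have l0 : 0 < l := by positivity
  have l1 : l < 1 := by rw [hl, div_lt_one hd]; linarith
  have hle : l * (δ₀ + δ₁) = δ₀ := by rw [hl]; field_simp
  -- Distinctness puts the parameter on the second segment strictly between `t₀` and `t₁`, hence in
  -- the open unit interval.
  have hne : t₀ ≠ t₁ := by
    rintro rfl
    linarith
  refine ⟨l, t₀ + l * (t₁ - t₀), l0, l1, ?_, ?_, ?_⟩
  · rcases lt_or_gt_of_ne hne with h | h
    · nlinarith
    · nlinarith
  · rcases lt_or_gt_of_ne hne with h | h
    · nlinarith
    · nlinarith
  · clear_value l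
    rw [Side.nrm_pt] at hδ₀ hδ₁
    clear_value δ₀ δ₁
    apply eq_of_nrm_eq h1 h2
    · simp only [Side.nrm_pt] at *
      linear_combination (-(1 - l)) * hN₀ - l * hN₁
    · simp only [Side.nrm_pt] at *
      linear_combination hle + (1 - l) * hδ₀ - l * hδ₁

/-- A point of the segment at a given level. -/
theorem exists_level {a : Side} {p q : ℝ × ℝ} {y : ℝ} (hpq : a.nrm p < a.nrm q)
    (hp : a.nrm p ≤ y) (hq : y ≤ a.nrm q) :
    ∃ t, 0 ≤ t ∧ t ≤ 1 ∧ a.nrm (pt p q t) = y ∧ (a.nrm p < y → 0 < t) ∧ (y < a.nrm q → t < 1) := by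
  have hd : 0 < a.nrm q - a.nrm p := by linarith
  refine ⟨(y - a.nrm p) / (a.nrm q - a.nrm p), ?_, ?_, ?_, ?_, ?_⟩
  · apply div_nonneg <;> linarith
  · rw [div_le_one hd]; linarith
  · rw [Side.nrm_pt]; field_simp; ring
  · intro h
    exact div_pos (by linarith) hd
  · intro h
    rw [div_lt_one hd]; linarith

/-! ## Anchors -/

namespace Instance

variable (I : Instance)

theorem size_pos (i : Fin I.numC) : 0 < I.size i := by
  obtain ⟨v, hv⟩ := I.cluster_surjective i
  have : Nonempty {v // I.cluster v = i} := ⟨⟨v, hv⟩⟩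
  exact Nat.card_pos

theorem order_mem (v : Fin I.numV) : 1 ≤ I.order v ∧ I.order v ≤ I.size (I.cluster v) :=
  (I.order_bijOn (I.cluster v)).mapsTo rfl

theorem order_inj {v w : Fin I.numV} (h : I.cluster v = I.cluster w)
    (ho : I.order v = I.order w) : v = w :=
  (I.order_bijOn (I.cluster w)).injOn h rfl ho

/-- The distance of the middle of the column (row) of `v` from the left (top) side. -/
noncomputable def offset (v : Fin I.numV) : ℝ :=
  ((I.order v : ℝ) - 1 / 2) * ((I.square (I.cluster v)).side / (I.size (I.cluster v) : ℝ))

theorem offset_pos (v : Fin I.numV) : 0 < I.offset v := by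
  have h1 : (1 : ℝ) ≤ I.order v := by exact_mod_cast (I.order_mem v).1
  have h2 : (0 : ℝ) < I.size (I.cluster v) := by exact_mod_cast I.size_pos _
  have := (I.square (I.cluster v)).side_pos
  unfold offset
  apply mul_pos (by linarith) (by positivity)

theorem offset_lt (v : Fin I.numV) : I.offset v < (I.square (I.cluster v)).side := by
  have h1 : (I.order v : ℝ) ≤ I.size (I.cluster v) := by exact_mod_cast (I.order_mem v).2
  have h2 : (0 : ℝ) < I.size (I.cluster v) := by exact_mod_cast I.size_pos _
  have h3 := (I.square (I.cluster v)).side_pos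
  unfold offset
  rw [← mul_div_assoc, div_lt_iff₀ h2]
  nlinarith

theorem offset_lt_iff {v w : Fin I.numV} (h : I.cluster v = I.cluster w) :
    I.offset v < I.offset w ↔ I.order v < I.order w := by
  have h2 : (0 : ℝ) < I.size (I.cluster w) := by exact_mod_cast I.size_pos _
  have h3 := (I.square (I.cluster w)).side_pos
  unfold offset
  rw [h, mul_lt_mul_iff_left₀ (by positivity)]
  simp

theorem anchor_nrm_self (v : Fin I.numV) (s : Side) :
    s.nrm (I.anchor v s) = (I.square (I.cluster v)).sup s := by
  cases s <;> simp [anchor, Side.nrm, Square.sup]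

theorem anchor_nrm_lt (v : Fin I.numV) {s t : Side} (h : t ≠ s) :
    t.nrm (I.anchor v s) < (I.square (I.cluster v)).sup t := by
  have h1 := I.offset_pos v
  have h2 := I.offset_lt v
  have h3 := (I.square (I.cluster v)).side_pos
  unfold offset at h1 h2
  cases s <;> cases t <;> simp [anchor, Side.nrm, Square.sup] at * <;> linarith

theorem anchor_mem (v : Fin I.numV) (s : Side) :
    I.anchor v s ∈ (I.square (I.cluster v)).toSet := by
  rw [Square.mem_toSet_iff]
  intro t
  by_cases h : t = s
  · subst h; exact (I.anchor_nrm_self v t).le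
  · exact (I.anchor_nrm_lt v h).le

/-- On a side, the order of the anchors agrees with or reverses the row-column order. -/
theorem anchor_mono (s c : Side) (h1 : c ≠ s) (h2 : c ≠ s.opp) :
    (∀ v w, I.cluster v = I.cluster w →
      (c.nrm (I.anchor v s) < c.nrm (I.anchor w s) ↔ I.order v < I.order w)) ∨
    (∀ v w, I.cluster v = I.cluster w →
      (c.nrm (I.anchor v s) < c.nrm (I.anchor w s) ↔ I.order w < I.order v)) := by
  have key := fun v w (h : I.cluster v = I.cluster w) => I.offset_lt_iff h
  unfold offset at key
  cases s <;> cases c <;> simp [Side.opp] at h1 h2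
  · right; intro v w h; rw [← key w v h.symm]; simp [anchor, Side.nrm, h]
  · left; intro v w h; rw [← key v w h]; simp [anchor, Side.nrm, h]
  · right; intro v w h; rw [← key w v h.symm]; simp [anchor, Side.nrm, h]
  · left; intro v w h; rw [← key v w h]; simp [anchor, Side.nrm, h]
  · right; intro v w h; rw [← key w v h.symm]; simp [anchor, Side.nrm, h]
  · left; intro v w h; rw [← key v w h]; simp [anchor, Side.nrm, h]
  · right; intro v w h; rw [← key w v h.symm]; simp [anchor, Side.nrm, h]
  · left; intro v w h; rw [← key v w h]; simp [anchor, Side.nrm, h]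

theorem exists_perp (s : Side) : ∃ c : Side, c ≠ s ∧ c ≠ s.opp := by
  cases s
  · exact ⟨.left, by decide⟩
  · exact ⟨.left, by decide⟩
  · exact ⟨.top, by decide⟩
  · exact ⟨.top, by decide⟩

/-- Disjointness separates clusters; within one square an anchor attains the extent of its own side
only, and along a side the row-column order separates vertices. -/
theorem anchor_inj (hd : ∀ i j, i ≠ j → Disjoint (I.square i).toSet (I.square j).toSet)
    {v w : Fin I.numV} {s t : Side} (h : I.anchor v s = I.anchor w t) : v = w ∧ s = t := by
  have hc : I.cluster v = I.cluster w := by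
    by_contra hne
    exact Set.disjoint_left.1 (hd _ _ hne) (I.anchor_mem v s) (h ▸ I.anchor_mem w t)
  have hs : s = t := by
    by_contra hne
    have h1 := I.anchor_nrm_self v s
    have h2 := I.anchor_nrm_lt w hne
    rw [h, hc] at h1
    linarith
  subst hs
  obtain ⟨c, h1, h2⟩ := exists_perp s
  refine ⟨I.order_inj hc ?_, rfl⟩
  rcases I.anchor_mono s c h1 h2 with hm | hm
  · have e1 := (hm v w hc).not.1 (by rw [h]; exact lt_irrefl _)
    have e2 := (hm w v hc.symm).not.1 (by rw [h]; exact lt_irrefl _)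
    omega
  · have e1 := (hm v w hc).not.1 (by rw [h]; exact lt_irrefl _)
    have e2 := (hm w v hc.symm).not.1 (by rw [h]; exact lt_irrefl _)
    omega

end Instance
end NodeTrix
namespace NodeTrix

/-! ## Straight-line representations -/

/-- The determinant of two vectors. -/
def det (d d' : ℝ × ℝ) : ℝ := d.1 * d'.2 - d.2 * d'.1

/-- The arithmetic test for a proper crossing of two segments. -/
def CrossDet (p q p' q' : ℝ × ℝ) : Prop :=
  det (q - p) (p' - p) * det (q - p) (q' - p) < 0 ∧
    det (q' - p') (p - p') * det (q' - p') (q - p') < 0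

/-- The crossing point divides each segment in the ratio of the two determinants on it; opposite
signs place the quotients strictly between 0 and 1. -/
theorem CrossDet.cross {p q p' q' : ℝ × ℝ} (h : CrossDet p q p' q') : Cross p q p' q' := by
  obtain ⟨h1, h2⟩ := h
  set o₁ := det (q - p) (p' - p) with ho₁
  set o₂ := det (q - p) (q' - p) with ho₂
  set o₃ := det (q' - p') (p - p') with ho₃
  set o₄ := det (q' - p') (q - p') with ho₄
  have key : ∀ a b : ℝ, a * b < 0 → a - b ≠ 0 ∧ 0 < a / (a - b) ∧ a / (a - b) < 1 := by
    intro a b hab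
    have hne : a - b ≠ 0 := by
      intro h
      have : a = b := by linarith
      subst this
      nlinarith [mul_self_nonneg a]
    rcases mul_neg_iff.1 hab with ⟨ha, hb⟩ | ⟨ha, hb⟩
    · exact ⟨hne, div_pos ha (by linarith), by rw [div_lt_one (by linarith)]; linarith⟩
    · refine ⟨hne, div_pos_of_neg_of_neg ha (by linarith), ?_⟩
      rw [div_lt_one_of_neg (by linarith)]; linarith
  obtain ⟨n1, u0, u1⟩ := key _ _ h1
  obtain ⟨n2, t0, t1⟩ := key _ _ h2
  refine ⟨o₃ / (o₃ - o₄), o₁ / (o₁ - o₂), t0, t1, u0, u1, ?_⟩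
  -- Both differences are, up to sign, the determinant of the two directions. This makes the two
  -- candidate points coincide.
  have e12 : o₁ - o₂ = o₄ - o₃ := by
    simp only [ho₁, ho₂, ho₃, ho₄, det, Prod.fst_sub, Prod.snd_sub]; ring
  have n3 : o₁ - o₂ = -(o₃ - o₄) := by linarith
  rw [n3]
  clear_value o₁ o₂ o₃ o₄
  ext
  · simp only [pt]
    field_simp
    simp only [ho₁, ho₃, ho₄, det, Prod.fst_sub, Prod.snd_sub]; ring
  · simp only [pt]
    field_simp
    simp only [ho₁, ho₃, ho₄, det, Prod.fst_sub, Prod.snd_sub]; ring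

/-- With `D` the determinant of the directions, the four orientation determinants are `-u D`, `(1 -
u) D`, `t D` and `-(1 - t) D`. They all vanish for parallel segments, which is why `hd` is needed.
-/
theorem Cross.crossDet {p q p' q' : ℝ × ℝ} (h : Cross p q p' q')
    (hd : det (q - p) (q' - p') ≠ 0) : CrossDet p q p' q' := by
  obtain ⟨t, u, t0, t1, u0, u1, h⟩ := h
  have hx : p'.1 - p.1 = t * (q.1 - p.1) - u * (q'.1 - p'.1) := by
    have := congrArg Prod.fst h; simp only [pt] at this; linarith
  have hy : p'.2 - p.2 = t * (q.2 - p.2) - u * (q'.2 - p'.2) := by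
    have := congrArg Prod.snd h; simp only [pt] at this; linarith
  set D := det (q - p) (q' - p') with hD
  have hD2 : 0 < D * D := mul_self_pos.2 hd
  simp only [det, Prod.fst_sub, Prod.snd_sub] at hD
  have e1 : det (q - p) (p' - p) = -u * D := by
    simp only [det, Prod.fst_sub, Prod.snd_sub, hD]; rw [hx, hy]; ring
  have e2 : det (q - p) (q' - p) = (1 - u) * D := by
    have hx' : q'.1 - p.1 = (q'.1 - p'.1) + (p'.1 - p.1) := by ring
    have hy' : q'.2 - p.2 = (q'.2 - p'.2) + (p'.2 - p.2) := by ring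
    simp only [det, Prod.fst_sub, Prod.snd_sub, hD]; rw [hx', hy', hx, hy]; ring
  have e3 : det (q' - p') (p - p') = t * D := by
    have hx' : p.1 - p'.1 = -(p'.1 - p.1) := by ring
    have hy' : p.2 - p'.2 = -(p'.2 - p.2) := by ring
    simp only [det, Prod.fst_sub, Prod.snd_sub, hD]; rw [hx', hy', hx, hy]; ring
  have e4 : det (q' - p') (q - p') = -(1 - t) * D := by
    have hx' : q.1 - p'.1 = (q.1 - p.1) -(p'.1 - p.1) := by ring
    have hy' : q.2 - p'.2 = (q.2 - p.2) -(p'.2 - p.2) := by ring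
    simp only [det, Prod.fst_sub, Prod.snd_sub, hD]; rw [hx', hy', hx, hy]; ring
  constructor
  · rw [e1, e2]; nlinarith [mul_pos u0 (sub_pos.2 u1), mul_pos (mul_pos u0 (sub_pos.2 u1)) hD2]
  · rw [e3, e4]; nlinarith [mul_pos (mul_pos t0 (sub_pos.2 t1)) hD2]

namespace Instance

variable (I : Instance)

/-- The end-vertex in the cluster with the smaller index (for inter-cluster edges). -/
def endA (e : Fin I.numE) : Fin I.numV :=
  if I.cluster (I.fst e) < I.cluster (I.snd e) then I.fst e else I.snd e

/-- The end-vertex in the cluster with the larger index (for inter-cluster edges). -/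
def endB (e : Fin I.numE) : Fin I.numV :=
  if I.cluster (I.fst e) < I.cluster (I.snd e) then I.snd e else I.fst e

/-- The cluster of `endA`. -/
def clA (e : Fin I.numE) : Fin I.numC := I.cluster (I.endA e)

/-- The cluster of `endB`. -/
def clB (e : Fin I.numE) : Fin I.numC := I.cluster (I.endB e)

variable {I}

theorem ends_cases (e : Fin I.numE) :
    (I.endA e = I.fst e ∧ I.endB e = I.snd e) ∨ (I.endA e = I.snd e ∧ I.endB e = I.fst e) := by
  unfold endA endB; split <;> simp

theorem isInter_iff (e : Fin I.numE) : I.IsInter e ↔ I.clA e < I.clB e := by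
  unfold IsInter clA clB endA endB
  split
  · rename_i h; exact ⟨fun _ => h, fun _ => h.ne⟩
  · rename_i h
    exact ⟨fun h' => lt_of_le_of_ne (not_lt.1 h) h'.symm, fun h' => h'.ne'⟩

theorem IsInter.ne {e : Fin I.numE} (h : I.IsInter e) : I.clA e ≠ I.clB e :=
  ((isInter_iff e).1 h).ne

theorem incident_iff (e : Fin I.numE) (i : Fin I.numC) :
    I.Incident e i ↔ I.clA e = i ∨ I.clB e = i := by
  unfold Incident clA clB
  rcases ends_cases e with ⟨h1, h2⟩ | ⟨h1, h2⟩ <;> rw [h1, h2]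
  exact or_comm

theorem edge_eq {e f : Fin I.numE}
    (h : s(I.endA e, I.endB e) = s(I.endA f, I.endB f)) : e = f := by
  apply I.edge_injective
  have key : ∀ e, s(I.fst e, I.snd e) = s(I.endA e, I.endB e) := by
    intro e
    rcases ends_cases e with ⟨h1, h2⟩ | ⟨h1, h2⟩ <;> rw [h1, h2]
    exact Sym2.eq_swap
  simpa only [key] using h

theorem pipe_comm (i j : Fin I.numC) : I.pipe i j = I.pipe j i := by
  unfold pipe; rw [Set.union_comm]

theorem pipe_cluster (e : Fin I.numE) :
    I.pipe (I.cluster (I.fst e)) (I.cluster (I.snd e)) = I.pipe (I.clA e) (I.clB e) := by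
  unfold clA clB
  rcases ends_cases e with ⟨h1, h2⟩ | ⟨h1, h2⟩ <;> rw [h1, h2]
  exact pipe_comm _ _

theorem IsInter.adjacent {e : Fin I.numE} (h : I.IsInter e) : I.Adjacent (I.clA e) (I.clB e) :=
  ⟨h.ne, e, (incident_iff _ _).2 (.inl rfl), (incident_iff _ _).2 (.inr rfl)⟩

/-- Two edges are incident to a common cluster. -/
def Share (e f : Fin I.numE) : Prop := ∃ i, I.Incident e i ∧ I.Incident f i

theorem Share.symm {e f : Fin I.numE} (h : Share e f) : Share f e := by
  obtain ⟨i, h1, h2⟩ := h; exact ⟨i, h2, h1⟩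

theorem share_of_clA {e f : Fin I.numE} (h : I.clA e = I.clA f) : Share e f :=
  ⟨I.clA e, (incident_iff _ _).2 (.inl rfl), (incident_iff _ _).2 (.inl h.symm)⟩

variable (I)

/-- The squares are disjoint and no pipe meets a third square. -/
structure Valid : Prop where
  disjoint : ∀ i j, i ≠ j → Disjoint (I.square i).toSet (I.square j).toSet
  pipe_disjoint : ∀ i j, I.Adjacent i j → ∀ k, k ≠ i → k ≠ j →
    Disjoint (I.pipe i j) (I.square k).toSet

/-- The straight segment between the anchors of `e` leaves both squares outwards. -/
def Legal (e : Fin I.numE) (τ : Side × Side) : Prop :=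
  τ.1.nrm (I.anchor (I.endA e) τ.1) < τ.1.nrm (I.anchor (I.endB e) τ.2) ∧
    τ.2.nrm (I.anchor (I.endB e) τ.2) < τ.2.nrm (I.anchor (I.endA e) τ.1)

/-- The straight segments of `e` and `f` cross. -/
def ECross (e : Fin I.numE) (τ : Side × Side) (f : Fin I.numE) (τ' : Side × Side) : Prop :=
  Cross (I.anchor (I.endA e) τ.1) (I.anchor (I.endB e) τ.2)
    (I.anchor (I.endA f) τ'.1) (I.anchor (I.endB f) τ'.2)

/-- The sides admit a straight-line drawing. -/
def Solution (S : Fin I.numE → Side × Side) : Prop :=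
  (∀ e, I.IsInter e → I.Legal e (S e)) ∧
    ∀ e f, e ≠ f → I.IsInter e → I.IsInter f → Share e f → ¬ I.ECross e (S e) f (S f)

variable {I}

theorem Legal.ne {e : Fin I.numE} {τ : Side × Side} (h : I.Legal e τ) :
    I.anchor (I.endA e) τ.1 ≠ I.anchor (I.endB e) τ.2 := by
  intro h'
  have := h.1
  rw [h'] at this
  exact lt_irrefl _ this

theorem anchorA_mem_pipe (e : Fin I.numE) (s : Side) :
    I.anchor (I.endA e) s ∈ I.pipe (I.clA e) (I.clB e) :=
  subset_convexHull ℝ _ (.inl (I.anchor_mem _ _))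

theorem anchorB_mem_pipe (e : Fin I.numE) (s : Side) :
    I.anchor (I.endB e) s ∈ I.pipe (I.clA e) (I.clB e) :=
  subset_convexHull ℝ _ (.inr (I.anchor_mem _ _))

theorem seg_mem_pipe (e : Fin I.numE) (τ : Side × Side) {t : ℝ} (h0 : 0 ≤ t) (h1 : t ≤ 1) :
    pt (I.anchor (I.endA e) τ.1) (I.anchor (I.endB e) τ.2) t ∈ I.pipe (I.clA e) (I.clB e) :=
  pt_mem_of_convex (convex_convexHull ℝ _) (anchorA_mem_pipe e _) (anchorB_mem_pipe e _) h0 h1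

/-- The open segment of a legal edge avoids all squares. -/
theorem Valid.open_seg_avoids (hv : I.Valid) {e : Fin I.numE} (he : I.IsInter e)
    {τ : Side × Side} (hl : I.Legal e τ) {t : ℝ} (h0 : 0 < t) (h1 : t < 1) (k : Fin I.numC) :
    pt (I.anchor (I.endA e) τ.1) (I.anchor (I.endB e) τ.2) t ∉ (I.square k).toSet := by
  intro hk
  by_cases hA : k = I.clA e
  · have h := (Square.mem_toSet_iff _ _).1 hk τ.1
    rw [Side.nrm_pt, hA, clA, ← I.anchor_nrm_self] at h
    have := hl.1
    nlinarith
  by_cases hB : k = I.clB e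
  · have h := (Square.mem_toSet_iff _ _).1 hk τ.2
    rw [Side.nrm_pt, hB, clB, ← I.anchor_nrm_self] at h
    have := hl.2
    nlinarith
  · exact Set.disjoint_left.1 (hv.pipe_disjoint _ _ he.adjacent k hA hB)
      (seg_mem_pipe e τ h0.le h1.le) hk

/-- Anchors lie in squares and open legal segments avoid squares. The form with an affine parameter
is what the collinear case of crossings needs. -/
theorem seg_anchor_not_mem_Ioo (hv : I.Valid) {e : Fin I.numE} (he : I.IsInter e)
    {τ : Side × Side} (hl : I.Legal e τ) (v : Fin I.numV) (s : Side) {t : ℝ}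
    (h : I.anchor v s = pt (I.anchor (I.endA e) τ.1) (I.anchor (I.endB e) τ.2) t) :
    t ≤ 0 ∨ 1 ≤ t := by
  by_contra hcon
  push Not at hcon
  exact hv.open_seg_avoids he hl hcon.1 hcon.2 _ (h ▸ I.anchor_mem v s)

/-- Crossing segments of different edges are not parallel. -/
theorem Valid.det_ne_zero (hv : I.Valid) {e f : Fin I.numE} (he : I.IsInter e) (hf : I.IsInter f)
    (hef : e ≠ f) {τ τ' : Side × Side} (hl : I.Legal e τ) (hl' : I.Legal f τ')
    (hc : I.ECross e τ f τ') :
    det (I.anchor (I.endB e) τ.2 - I.anchor (I.endA e) τ.1)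
      (I.anchor (I.endB f) τ'.2 - I.anchor (I.endA f) τ'.1) ≠ 0 := by
  intro hdet
  -- On a common line with the segment of `e` as unit interval, that of `f` runs from `α` to `α +
  -- g`. The two overlap at `t`, yet no end of either is interior to the other, so they coincide;
  -- here with opposite directions, below with equal ones.
  have key_neg : ∀ α g w t : ℝ, 0 < t → t < 1 → α + w = t → w < 0 → g < w → (α ≤ 0 ∨ 1 ≤ α) →
      (α + g ≤ 0 ∨ 1 ≤ α + g) → (α ≤ 0 ∨ -α ≤ g) → (α ≤ 1 ∨ 1 - α ≤ g) → α = 1 ∧ g = -1 := by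
    intro α g w t t0 t1 hw w0 w1 b1 b2 b3 b4
    have b1 : 1 ≤ α := b1.resolve_left (by linarith)
    have b2 : α + g ≤ 0 := b2.resolve_right (by linarith)
    have b3 : -α ≤ g := b3.resolve_left (by linarith)
    have b4 : α ≤ 1 := b4.resolve_right (by linarith)
    constructor <;> linarith
  have key_pos : ∀ α g w t : ℝ, 0 < t → t < 1 → α + w = t → 0 < w → w < g → (α ≤ 0 ∨ 1 ≤ α) →
      (α + g ≤ 0 ∨ 1 ≤ α + g) → (0 ≤ α ∨ g ≤ -α) → (1 ≤ α ∨ g ≤ 1 - α) → α = 0 ∧ g = 1 := by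
    intro α g w t t0 t1 hw w0 w1 b1 b2 b3 b4
    have b1 : α ≤ 0 := b1.resolve_right (by linarith)
    have b2 : 1 ≤ α + g := b2.resolve_left (by linarith)
    have b3 : 0 ≤ α := b3.resolve_right (by linarith)
    have b4 : g ≤ 1 - α := b4.resolve_left (by linarith)
    constructor <;> linarith
  obtain ⟨t, u, t0, t1, u0, u1, h⟩ := hc
  have a1 := fun α => seg_anchor_not_mem_Ioo (t := α) hv he hl (I.endA f) τ'.1
  have a2 := fun α => seg_anchor_not_mem_Ioo (t := α) hv he hl (I.endB f) τ'.2
  have a3 := fun α => seg_anchor_not_mem_Ioo (t := α) hv hf hl' (I.endA e) τ.1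
  have a4 := fun α => seg_anchor_not_mem_Ioo (t := α) hv hf hl' (I.endB e) τ.2
  -- Coinciding segments have the same end-vertices, and the graph is simple.
  have same : I.anchor (I.endA f) τ'.1 = I.anchor (I.endA e) τ.1 →
      I.anchor (I.endB f) τ'.2 = I.anchor (I.endB e) τ.2 → False := by
    intro h1 h2
    apply hef
    apply edge_eq
    rw [(I.anchor_inj hv.disjoint h1).1, (I.anchor_inj hv.disjoint h2).1]
  have swap : I.anchor (I.endA f) τ'.1 = I.anchor (I.endB e) τ.2 →
      I.anchor (I.endB f) τ'.2 = I.anchor (I.endA e) τ.1 → False := by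
    intro h1 h2
    apply hef
    apply edge_eq
    rw [(I.anchor_inj hv.disjoint h1).1, (I.anchor_inj hv.disjoint h2).1]
    exact Sym2.eq_swap
  have hne := hl.ne
  have hne' := hl'.ne
  clear hl hl'
  generalize I.anchor (I.endA e) τ.1 = p at *
  generalize I.anchor (I.endB e) τ.2 = q at *
  generalize I.anchor (I.endA f) τ'.1 = p' at *
  generalize I.anchor (I.endB f) τ'.2 = q' at *
  obtain ⟨px, py⟩ := p
  obtain ⟨qx, qy⟩ := q
  obtain ⟨rx, ry⟩ := p'
  obtain ⟨sx, sy⟩ := q'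
  simp only [pt, Prod.mk.injEq, det, Prod.mk_sub_mk, ne_eq] at *
  have hn : 0 < (qx - px) ^ 2 + (qy - py) ^ 2 := by
    by_contra hcon
    apply hne
    constructor <;> nlinarith [sq_nonneg (qx - px), sq_nonneg (qy - py)]
  -- The signed ratio of the two parallel direction vectors.
  set g := ((qx - px) * (sx - rx) + (qy - py) * (sy - ry)) / ((qx - px) ^ 2 + (qy - py) ^ 2) with hg
  have gx : sx - rx = g * (qx - px) := by
    rw [hg]; field_simp
    linear_combination (-(qy - py)) * hdet
  have gy : sy - ry = g * (qy - py) := by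
    rw [hg]; field_simp
    linear_combination (qx - px) * hdet
  clear_value g
  have g0 : g ≠ 0 := by
    rintro rfl
    apply hne'
    constructor <;> linarith
  obtain ⟨hx, hy⟩ := h
  set α := t - u * g with hα
  have b1 := a1 α ⟨by rw [hα]; linear_combination -hx - u * gx, by rw [hα]; linear_combination -hy - u * gy⟩
  have b2 := a2 (α + g) ⟨by rw [hα]; linear_combination -hx + (1 - u) * gx,
    by rw [hα]; linear_combination -hy + (1 - u) * gy⟩
  have px' : rx = px + α * (qx - px) := by rw [hα]; linear_combination -hx - u * gx
  have py' : ry = py + α * (qy - py) := by rw [hα]; linear_combination -hy - u * gy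
  have b3 := a3 (-α / g) ⟨by
      field_simp; linear_combination α * gx - g * px', by
      field_simp; linear_combination α * gy - g * py'⟩
  have b4 := a4 ((1 - α) / g) ⟨by
      field_simp; linear_combination (-(1 - α)) * gx - g * px', by
      field_simp; linear_combination (-(1 - α)) * gy - g * py'⟩
  have hw : α + u * g = t := by rw [hα]; ring
  rcases lt_or_gt_of_ne g0 with hneg | hpos
  · rw [div_le_iff_of_neg hneg, le_div_iff_of_neg hneg] at b3 b4
    have w0 : u * g < 0 := mul_neg_of_pos_of_neg u0 hneg
    have w1 : g < u * g := by nlinarith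
    obtain ⟨c1, c2⟩ := key_neg α g (u * g) t t0 t1 hw w0 w1 b1 b2 (by simpa using b3)
      (by simpa using b4)
    rw [c1] at px' py'
    rw [c2] at gx gy
    exact swap ⟨by linarith, by linarith⟩ ⟨by linarith, by linarith⟩
  · rw [div_le_iff₀ hpos, le_div_iff₀ hpos] at b3 b4
    have w0 : 0 < u * g := mul_pos u0 hpos
    have w1 : u * g < g := by nlinarith
    obtain ⟨c1, c2⟩ := key_pos α g (u * g) t t0 t1 hw w0 w1 b1 b2 (by simpa using b3)
      (by simpa using b4)
    rw [c1] at px' py'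
    rw [c2] at gx gy
    exact same ⟨by linarith, by linarith⟩ ⟨by linarith, by linarith⟩

end Instance
end NodeTrix
namespace NodeTrix

/-! ## Monotone arcs -/

/-- A simple arc from `p` to `q` along which every coordinate is constant or injective. -/
structure Arc (δ : unitInterval → ℝ × ℝ) (p q : ℝ × ℝ) : Prop where
  cont : Continuous δ
  inj : Function.Injective δ
  source : δ 0 = p
  target : δ 1 = q
  coord : ∀ s : Side, (∀ t, s.nrm (δ t) = s.nrm p) ∨ Function.Injective fun t => s.nrm (δ t)

namespace Arc

variable {δ : unitInterval → ℝ × ℝ} {p q : ℝ × ℝ}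

theorem reverse (h : Arc δ p q) : Arc (fun t => δ (unitInterval.symm t)) q p where
  cont := h.cont.comp unitInterval.continuous_symm
  inj := h.inj.comp unitInterval.symm_bijective.injective
  source := by simpa using h.target
  target := by simpa using h.source
  coord s := by
    rcases h.coord s with h1 | h1
    · left
      intro t
      rw [h1, ← h.target, h1]
    · right
      exact h1.comp unitInterval.symm_bijective.injective

/-- Continuous injective functions on an interval are strictly monotone; the end values exclude
constancy and fix the direction. -/
theorem strictMono (h : Arc δ p q) {s : Side} (hpq : s.nrm p < s.nrm q) :
    StrictMono fun t => s.nrm (δ t) := by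
  have hc : Continuous fun t => s.nrm (δ t) := (continuous_nrm s).comp h.cont
  rcases h.coord s with h1 | h1
  · have := h1 1
    rw [h.target] at this
    exact absurd this hpq.ne'
  · rcases hc.strictMono_of_inj h1 with h2 | h2
    · exact h2
    · have := h2 (show (0 : unitInterval) < 1 from zero_lt_one)
      simp only [h.source, h.target] at this
      exact absurd this hpq.not_gt

theorem nrm_le (h : Arc δ p q) {s : Side} (hpq : s.nrm q ≤ s.nrm p) (t : unitInterval) :
    s.nrm (δ t) ≤ s.nrm p := by
  rcases hpq.lt_or_eq with hlt | heq
  · have hm := h.reverse.strictMono hlt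
    have := hm.monotone (show unitInterval.symm t ≤ 1 from unitInterval.le_one')
    simpa [h.source] using this
  · rcases h.coord s with h1 | h1
    · exact (h1 t).le
    · have := @h1 0 1 (by simp [h.source, h.target, heq])
      exact absurd this zero_ne_one

theorem exists_nrm_eq (h : Arc δ p q) {s : Side} {y : ℝ} (hp : s.nrm p ≤ y) (hq : y ≤ s.nrm q) :
    ∃ t, s.nrm (δ t) = y := by
  have hc : Continuous fun t => s.nrm (δ t) := (continuous_nrm s).comp h.cont
  exact mem_range_of_exists_le_of_exists_ge hc ⟨0, by simpa [h.source] using hp⟩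
    ⟨1, by simpa [h.target] using hq⟩

/-- An arc with a constant coordinate is a straight segment. -/
theorem pt_mem_range (h : Arc δ p q) {a : Side} (ha : a.nrm p = a.nrm q) {t : ℝ} (h0 : 0 ≤ t)
    (h1 : t ≤ 1) : ∃ u, δ u = pt p q t := by
  obtain ⟨c, hc1, hc2⟩ := Instance.exists_perp a
  have hconst : ∀ u, a.nrm (δ u) = a.nrm p := by
    rcases h.coord a with h2 | h2
    · exact h2
    · have := @h2 0 1 (by simp [h.source, h.target, ha])
      exact absurd this zero_ne_one
  have hex : ∃ u, c.nrm (δ u) = c.nrm (pt p q t) := by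
    rw [Side.nrm_pt]
    rcases le_total (c.nrm p) (c.nrm q) with hle | hle
    · exact h.exists_nrm_eq (by nlinarith) (by nlinarith)
    · obtain ⟨u, hu⟩ := h.reverse.exists_nrm_eq (s := c)
        (y := (1 - t) * c.nrm p + t * c.nrm q) (by nlinarith) (by nlinarith)
      exact ⟨_, hu⟩
  obtain ⟨u, hu⟩ := hex
  refine ⟨u, eq_of_nrm_eq hc1 hc2 ?_ hu⟩
  rw [hconst, Side.nrm_pt, ← ha]; ring

end Arc

/-- Two graphs that swap their order meet. -/
theorem exists_common_point {f₁ g₁ f₂ g₂ : unitInterval → ℝ} (hf₁ : Continuous f₁)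
    (hg₁ : Continuous g₁) (hf₂ : Continuous f₂) (hg₂ : Continuous g₂) (hm₁ : StrictMono f₁)
    (hm₂ : StrictMono f₂) {t₀ t₁ u₀ u₁ : unitInterval} (h₀ : f₁ t₀ = f₂ u₀) (h₁ : f₁ t₁ = f₂ u₁)
    (hlt : f₁ t₀ < f₁ t₁) (hs₀ : g₁ t₀ < g₂ u₀) (hs₁ : g₂ u₁ < g₁ t₁) :
    ∃ t u, f₁ t = f₂ u ∧ g₁ t = g₂ u ∧ f₁ t₀ < f₁ t ∧ f₁ t < f₁ t₁ := by
  -- By compactness the levels at which either weak order holds form two closed sets. They cover a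
  -- connected interval, so they share a level, and strict monotonicity leaves one parameter per
  -- curve at that level.
  let A : Set (unitInterval × unitInterval) := {z | f₁ z.1 = f₂ z.2 ∧ g₁ z.1 ≤ g₂ z.2}
  let B : Set (unitInterval × unitInterval) := {z | f₁ z.1 = f₂ z.2 ∧ g₂ z.2 ≤ g₁ z.1}
  have hc : Continuous fun z : unitInterval × unitInterval => f₁ z.1 := hf₁.comp continuous_fst
  have hc' : Continuous fun z : unitInterval × unitInterval => f₂ z.2 := hf₂.comp continuous_snd
  have hg : Continuous fun z : unitInterval × unitInterval => g₁ z.1 := hg₁.comp continuous_fst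
  have hg' : Continuous fun z : unitInterval × unitInterval => g₂ z.2 := hg₂.comp continuous_snd
  have hA : IsClosed A := (isClosed_eq hc hc').inter (isClosed_le hg hg')
  have hB : IsClosed B := (isClosed_eq hc hc').inter (isClosed_le hg' hg)
  have hA' := (hA.isCompact.image hc).isClosed
  have hB' := (hB.isCompact.image hc).isClosed
  have hcov : Set.Icc (f₁ t₀) (f₁ t₁) ⊆
      (fun z : unitInterval × unitInterval => f₁ z.1) '' A ∪
      (fun z : unitInterval × unitInterval => f₁ z.1) '' B := by
    intro x hx
    obtain ⟨t, ht⟩ := mem_range_of_exists_le_of_exists_ge hf₁ ⟨t₀, hx.1⟩ ⟨t₁, hx.2⟩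
    obtain ⟨u, hu⟩ := mem_range_of_exists_le_of_exists_ge hf₂ ⟨u₀, h₀ ▸ hx.1⟩ ⟨u₁, h₁ ▸ hx.2⟩
    rcases le_total (g₁ t) (g₂ u) with h | h
    · exact .inl ⟨(t, u), ⟨ht.trans hu.symm, h⟩, ht⟩
    · exact .inr ⟨(t, u), ⟨ht.trans hu.symm, h⟩, ht⟩
  obtain ⟨x, hx, ⟨⟨t, u⟩, ⟨ha1, ha2⟩, ha3⟩, ⟨⟨t', u'⟩, ⟨hb1, hb2⟩, hb3⟩⟩ :=
    isPreconnected_closed_iff.1 (isPreconnected_Icc (a := f₁ t₀) (b := f₁ t₁)) _ _ hA' hB' hcov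
    ⟨_, Set.left_mem_Icc.2 hlt.le, (t₀, u₀), ⟨h₀, hs₀.le⟩, rfl⟩
    ⟨_, Set.right_mem_Icc.2 hlt.le, (t₁, u₁), ⟨h₁, hs₁.le⟩, rfl⟩
  simp only at ha1 ha2 ha3 hb1 hb2 hb3
  obtain rfl : t = t' := hm₁.injective (ha3.trans hb3.symm)
  obtain rfl : u = u' := hm₂.injective (ha1.symm.trans hb1)
  have hg := le_antisymm ha2 hb2
  -- The orders at the two end levels are strict, so the common level is interior.
  refine ⟨t, u, ha1, hg, lt_of_le_of_ne (ha3 ▸ hx.1) ?_, lt_of_le_of_ne (ha3 ▸ hx.2) ?_⟩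
  · intro h
    obtain rfl := hm₁.injective h
    obtain rfl := hm₂.injective (h₀.symm.trans ha1)
    exact hs₀.ne hg
  · intro h
    obtain rfl := hm₁.injective h
    obtain rfl := hm₂.injective (h₁.symm.trans ha1)
    exact hs₁.ne hg.symm

/-- The arc does not pass to the other side of `W` with respect to the segment. -/
def NoSqueeze (δ : unitInterval → ℝ × ℝ) (p q W : ℝ × ℝ) : Prop :=
  ∀ t r : ℝ, 0 ≤ t → t ≤ 1 → 0 ≤ r → r ≤ 1 → ∀ u,
    (pt p q t = p ↔ δ u = p) → (pt p q t = q ↔ δ u = q) → pt (pt p q t) (δ u) r = W →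
    pt p q t = δ u

theorem NoSqueeze.reverse {δ : unitInterval → ℝ × ℝ} {p q W : ℝ × ℝ} (h : NoSqueeze δ p q W) :
    NoSqueeze (fun t => δ (unitInterval.symm t)) q p W := by
  intro t r h1 h2 h3 h4 u h5 h6 h7
  have e : pt q p t = pt p q (1 - t) := by
    have := pt_symm p q (1 - t); rwa [sub_sub_cancel] at this
  rw [e] at h5 h6 h7 ⊢
  exact h (1 - t) r (by linarith) (by linarith) h3 h4 _ h6 h5 h7

/-- If curve and segment lay on different sides of `W` at its level, `W` would lie on the chord
between them, and `NoSqueeze` would identify the two. Its two equivalences hold because curve and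
segment reach the levels of `p` and `q` only at `p` and `q`. -/
theorem Arc.compare {δ : unitInterval → ℝ × ℝ} {p q W : ℝ × ℝ} (h : Arc δ p q) {a c : Side}
    (h1 : c ≠ a) (h2 : c ≠ a.opp) (hpq : a.nrm p < a.nrm q) (hW : NoSqueeze δ p q W)
    {t : ℝ} (ht0 : 0 ≤ t) (ht1 : t ≤ 1) (htW : a.nrm (pt p q t) = a.nrm W) :
    ∃ u, a.nrm (δ u) = a.nrm W ∧ (c.nrm W < c.nrm (pt p q t) → c.nrm W < c.nrm (δ u)) ∧
      (c.nrm (pt p q t) < c.nrm W → c.nrm (δ u) < c.nrm W) := by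
  have hd : 0 < a.nrm q - a.nrm p := sub_pos.2 hpq
  have e0 := htW
  rw [Side.nrm_pt] at e0
  obtain ⟨u, hu⟩ := h.exists_nrm_eq (s := a) (y := a.nrm W) (by nlinarith) (by nlinarith)
  have hp : pt p q t = p ↔ δ u = p := by
    constructor
    · intro h'
      rw [h', ← h.source] at htW
      rw [(h.strictMono hpq).injective (hu.trans htW.symm), h.source]
    · intro h'
      rw [h'] at hu
      have : t = 0 := by
        have : t * (a.nrm q - a.nrm p) = 0 := by linarith
        exact (mul_eq_zero.1 this).resolve_right hd.ne'
      rw [this, pt_zero]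
  have hq : pt p q t = q ↔ δ u = q := by
    constructor
    · intro h'
      rw [h', ← h.target] at htW
      rw [(h.strictMono hpq).injective (hu.trans htW.symm), h.target]
    · intro h'
      rw [h'] at hu
      have : t = 1 := by
        have : (1 - t) * (a.nrm q - a.nrm p) = 0 := by linarith
        have := (mul_eq_zero.1 this).resolve_right hd.ne'
        linarith
      rw [this, pt_one]
  have key : ∀ r : ℝ, 0 ≤ r → r ≤ 1 →
      (1 - r) * c.nrm (pt p q t) + r * c.nrm (δ u) = c.nrm W → pt p q t = δ u := by
    intro r hr0 hr1 hr
    refine hW t r ht0 ht1 hr0 hr1 u hp hq (eq_of_nrm_eq h1 h2 ?_ ?_)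
    · rw [Side.nrm_pt, htW, hu]; ring
    · rw [Side.nrm_pt, hr]
  refine ⟨u, hu, fun hlt => ?_, fun hlt => ?_⟩
  · by_contra hcon
    have hpos : 0 < c.nrm (pt p q t) - c.nrm (δ u) := by linarith
    -- The position of `W` on the chord from the segment to the curve.
    have := key ((c.nrm (pt p q t) - c.nrm W) / (c.nrm (pt p q t) - c.nrm (δ u)))
      (div_nonneg (by linarith) hpos.le) (by rw [div_le_one hpos]; linarith)
      (by field_simp; ring)
    rw [this] at hpos
    linarith
  · by_contra hcon
    have hpos : 0 < c.nrm (δ u) - c.nrm (pt p q t) := by linarith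
    have := key ((c.nrm W - c.nrm (pt p q t)) / (c.nrm (δ u) - c.nrm (pt p q t)))
      (div_nonneg (by linarith) hpos.le) (by rw [div_le_one hpos]; linarith)
      (by field_simp; ring)
    rw [this] at hpos
    linarith

theorem det_eq_nrm {a c : Side} (h1 : c ≠ a) (h2 : c ≠ a.opp) (p q p' q' : ℝ × ℝ)
    (h : (a.nrm q - a.nrm p) * (c.nrm q' - c.nrm p') =
      (c.nrm q - c.nrm p) * (a.nrm q' - a.nrm p')) : det (q - p) (q' - p') = 0 := by
  cases a <;> cases c <;> simp [Side.opp] at h1 h2 <;>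
    simp only [Side.nrm, det, Prod.fst_sub, Prod.snd_sub] at * <;> linarith

section
variable {δ δ' : unitInterval → ℝ × ℝ} {p q p' q' : ℝ × ℝ}

/-- Arcs whose straightenings cross properly and that are increasing in a common direction meet. -/
theorem Arc.meet_of_increasing (h : Arc δ p q) (h' : Arc δ' p' q') {a : Side}
    (hpq : a.nrm p < a.nrm q) (hpq' : a.nrm p' < a.nrm q') (hc : Cross p q p' q')
    (hd : det (q - p) (q' - p') ≠ 0) (hp : NoSqueeze δ' p' q' p) (hq : NoSqueeze δ' p' q' q)
    (hp' : NoSqueeze δ p q p') (hq' : NoSqueeze δ p q q') :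
    ∃ t u, δ t = δ' u ∧ δ t ≠ p ∧ δ t ≠ q := by
  obtain ⟨c, h1, h2⟩ := Instance.exists_perp a
  obtain ⟨t, u, t0, t1, u0, u1, hz⟩ := hc
  have hN : (1 - t) * a.nrm p + t * a.nrm q = (1 - u) * a.nrm p' + u * a.nrm q' := by
    rw [← Side.nrm_pt, ← Side.nrm_pt, hz]
  have hM : (1 - t) * c.nrm p + t * c.nrm q = (1 - u) * c.nrm p' + u * c.nrm q' := by
    rw [← Side.nrm_pt, ← Side.nrm_pt, hz]
  set X := (1 - t) * a.nrm p + t * a.nrm q with hX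
  have D : 0 < a.nrm q - a.nrm p := by linarith
  have D' : 0 < a.nrm q' - a.nrm p' := by linarith
  -- The sign of `κ` decides which segment is the upper one beyond the crossing level `X`; it is
  -- nonzero because the segments are not parallel.
  set κ := (c.nrm q' - c.nrm p') * (a.nrm q - a.nrm p) - (c.nrm q - c.nrm p) * (a.nrm q' - a.nrm p')
    with hκ
  have κ0 : κ ≠ 0 := by
    intro h0
    apply hd
    apply det_eq_nrm h1 h2
    linarith
  -- the difference of the two segments at a level is proportional to the distance from the crossing
  have diff : ∀ t' u' : ℝ, a.nrm (pt p q t') = a.nrm (pt p' q' u') →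
      (c.nrm (pt p' q' u') - c.nrm (pt p q t')) * ((a.nrm q - a.nrm p) * (a.nrm q' - a.nrm p')) =
        (a.nrm (pt p q t') - X) * κ := by
    intro t' u' he
    simp only [Side.nrm_pt] at *
    have e1 : (u' - u) * (a.nrm q' - a.nrm p') = (t' - t) * (a.nrm q - a.nrm p) := by
      rw [hX] at hN; linarith
    rw [hκ, hX]
    linear_combination (-(a.nrm q - a.nrm p) * (a.nrm q' - a.nrm p')) * hM +
      (a.nrm q - a.nrm p) * (c.nrm q' - c.nrm p') * e1
  have DD := mul_pos D D'
  have sgn : ∀ t' u' : ℝ, a.nrm (pt p q t') = a.nrm (pt p' q' u') →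
      (0 < (a.nrm (pt p q t') - X) * κ → c.nrm (pt p q t') < c.nrm (pt p' q' u')) ∧
      ((a.nrm (pt p q t') - X) * κ < 0 → c.nrm (pt p' q' u') < c.nrm (pt p q t')) := by
    intro t' u' he
    rw [← diff t' u' he]
    constructor
    · intro h0; have := pos_of_mul_pos_left h0 DD.le; linarith
    · intro h0; have := neg_of_mul_neg_left h0 DD.le; linarith
  have hpX : a.nrm p < X := by rw [hX]; nlinarith
  have hqX : X < a.nrm q := by rw [hX]; nlinarith
  have hpX' : a.nrm p' < X := by rw [hN]; nlinarith
  have hqX' : X < a.nrm q' := by rw [hN]; nlinarith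
  -- levels below and above the crossing where the arcs are ordered as the segments
  have low : ∃ x t' u', x < X ∧ a.nrm p ≤ x ∧ a.nrm (δ t') = x ∧ a.nrm (δ' u') = x ∧
      (κ < 0 → c.nrm (δ t') < c.nrm (δ' u')) ∧ (0 < κ → c.nrm (δ' u') < c.nrm (δ t')) := by
    -- Take the higher of the two starting points. There one arc agrees with its segment, and
    -- `Arc.compare` transfers the position of the other segment to the other arc.
    rcases le_total (a.nrm p') (a.nrm p) with hle | hle
    · obtain ⟨v, v0, v1, hv, -, -⟩ := exists_level hpq' hle (hpX.trans hqX').le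
      obtain ⟨u', e1, e2, e3⟩ := h'.compare h1 h2 hpq' hp v0 v1 hv
      have hs := sgn 0 v (by rw [hv, pt_zero])
      simp only [pt_zero] at hs
      refine ⟨_, 0, u', hpX, le_rfl, by rw [h.source], e1, fun hk => ?_, fun hk => ?_⟩
      · rw [h.source]; exact e2 (hs.1 (mul_pos_of_neg_of_neg (sub_neg.2 hpX) hk))
      · rw [h.source]; exact e3 (hs.2 (mul_neg_of_neg_of_pos (sub_neg.2 hpX) hk))
    · obtain ⟨v, v0, v1, hv, -, -⟩ := exists_level hpq hle (hpX'.trans hqX).le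
      obtain ⟨t', e1, e2, e3⟩ := h.compare h1 h2 hpq hp' v0 v1 hv
      have hs := sgn v 0 (by rw [hv, pt_zero])
      simp only [pt_zero, hv] at hs
      refine ⟨_, t', 0, hpX', hle, e1, by rw [h'.source], fun hk => ?_, fun hk => ?_⟩
      · rw [h'.source]; exact e3 (hs.1 (mul_pos_of_neg_of_neg (sub_neg.2 hpX') hk))
      · rw [h'.source]; exact e2 (hs.2 (mul_neg_of_neg_of_pos (sub_neg.2 hpX') hk))
  have high : ∃ x t' u', X < x ∧ x ≤ a.nrm q ∧ a.nrm (δ t') = x ∧ a.nrm (δ' u') = x ∧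
      (κ < 0 → c.nrm (δ' u') < c.nrm (δ t')) ∧ (0 < κ → c.nrm (δ t') < c.nrm (δ' u')) := by
    rcases le_total (a.nrm q) (a.nrm q') with hle | hle
    · obtain ⟨v, v0, v1, hv, -, -⟩ := exists_level hpq' (hpX'.trans hqX).le hle
      obtain ⟨u', e1, e2, e3⟩ := h'.compare h1 h2 hpq' hq v0 v1 hv
      have hs := sgn 1 v (by rw [hv, pt_one])
      simp only [pt_one] at hs
      refine ⟨_, 1, u', hqX, le_rfl, by rw [h.target], e1, fun hk => ?_, fun hk => ?_⟩
      · rw [h.target]; exact e3 (hs.2 (mul_neg_of_pos_of_neg (sub_pos.2 hqX) hk))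
      · rw [h.target]; exact e2 (hs.1 (mul_pos (sub_pos.2 hqX) hk))
    · obtain ⟨v, v0, v1, hv, -, -⟩ := exists_level hpq (hpX.trans hqX').le hle
      obtain ⟨t', e1, e2, e3⟩ := h.compare h1 h2 hpq hq' v0 v1 hv
      have hs := sgn v 1 (by rw [hv, pt_one])
      simp only [pt_one, hv] at hs
      refine ⟨_, t', 1, hqX', hle, e1, by rw [h'.target], fun hk => ?_, fun hk => ?_⟩
      · rw [h'.target]; exact e2 (hs.2 (mul_neg_of_pos_of_neg (sub_pos.2 hqX') hk))
      · rw [h'.target]; exact e3 (hs.1 (mul_pos (sub_pos.2 hqX') hk))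
  obtain ⟨x₀, t₀, u₀, l1, l2, l3, l4, l5, l6⟩ := low
  obtain ⟨x₁, t₁, u₁, g1, g2, g3, g4, g5, g6⟩ := high
  have cN : Continuous fun t => a.nrm (δ t) := (continuous_nrm a).comp h.cont
  have cM : Continuous fun t => c.nrm (δ t) := (continuous_nrm c).comp h.cont
  have cN' : Continuous fun t => a.nrm (δ' t) := (continuous_nrm a).comp h'.cont
  have cM' : Continuous fun t => c.nrm (δ' t) := (continuous_nrm c).comp h'.cont
  have fin : ∀ t u, a.nrm (δ t) = a.nrm (δ' u) → c.nrm (δ t) = c.nrm (δ' u) →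
      x₀ < a.nrm (δ t) → a.nrm (δ t) < x₁ → ∃ t u, δ t = δ' u ∧ δ t ≠ p ∧ δ t ≠ q := by
    intro t u f1 f2 f3 f4
    refine ⟨t, u, eq_of_nrm_eq h1 h2 f1 f2, ?_, ?_⟩
    · intro hh; rw [hh] at f3; linarith
    · intro hh; rw [hh] at f4; linarith
  rcases lt_or_gt_of_ne κ0 with hk | hk
  · obtain ⟨t, u, f1, f2, f3, f4⟩ := exists_common_point cN cM cN' cM' (h.strictMono hpq)
      (h'.strictMono hpq') (l3.trans l4.symm) (g3.trans g4.symm)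
      (by simp only [l3, g3]; linarith) (l5 hk) (g5 hk)
    exact fin t u f1 f2 (l3 ▸ f3) (g3 ▸ f4)
  · obtain ⟨u, t, f1, f2, f3, f4⟩ := exists_common_point cN' cM' cN cM (h'.strictMono hpq')
      (h.strictMono hpq) (l4.trans l3.symm) (g4.trans g3.symm)
      (by simp only [l4, g4]; linarith) (l6 hk) (g6 hk)
    exact fin t u f1.symm f2.symm (by rw [← f1, ← l4]; exact f3) (by rw [← f1, ← g4]; exact f4)

/-- Reversing an arc preserves crossings and `NoSqueeze`, so both arcs may be taken increasing. -/
theorem Arc.meet_of_not_const (h : Arc δ p q) (h' : Arc δ' p' q') {a : Side}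
    (hpq : a.nrm p ≠ a.nrm q) (hpq' : a.nrm p' ≠ a.nrm q') (hc : Cross p q p' q')
    (hd : det (q - p) (q' - p') ≠ 0) (hp : NoSqueeze δ' p' q' p) (hq : NoSqueeze δ' p' q' q)
    (hp' : NoSqueeze δ p q p') (hq' : NoSqueeze δ p q q') :
    ∃ t u, δ t = δ' u ∧ δ t ≠ p ∧ δ t ≠ q := by
  have d1 : det (p - q) (q' - p') ≠ 0 := by
    intro hh; apply hd; simp only [det, Prod.fst_sub, Prod.snd_sub] at *; linarith
  have d2 : det (q - p) (p' - q') ≠ 0 := by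
    intro hh; apply hd; simp only [det, Prod.fst_sub, Prod.snd_sub] at *; linarith
  have d3 : det (p - q) (p' - q') ≠ 0 := by
    intro hh; apply hd; simp only [det, Prod.fst_sub, Prod.snd_sub] at *; linarith
  rcases lt_or_gt_of_ne hpq with h1 | h1 <;> rcases lt_or_gt_of_ne hpq' with h2 | h2
  · exact h.meet_of_increasing h' h1 h2 hc hd hp hq hp' hq'
  · obtain ⟨t, u, e1, e2, e3⟩ := h.meet_of_increasing h'.reverse h1 h2 hc.swap_right d2 hp.reverse
      hq.reverse hq' hp'
    exact ⟨t, _, e1, e2, e3⟩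
  · obtain ⟨t, u, e1, e2, e3⟩ := h.reverse.meet_of_increasing h' h1 h2 hc.swap_left d1 hq hp
      hp'.reverse hq'.reverse
    exact ⟨_, u, e1, e3, e2⟩
  · obtain ⟨t, u, e1, e2, e3⟩ := h.reverse.meet_of_increasing h'.reverse h1 h2
      hc.swap_left.swap_right d3 hq.reverse hp.reverse hq'.reverse hp'.reverse
    exact ⟨_, _, e1, e3, e2⟩

/-- Arcs whose straightenings cross properly meet. -/
theorem Arc.meet (h : Arc δ p q) (h' : Arc δ' p' q') (hc : Cross p q p' q')
    (hd : det (q - p) (q' - p') ≠ 0) (hp : NoSqueeze δ' p' q' p) (hq : NoSqueeze δ' p' q' q)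
    (hp' : NoSqueeze δ p q p') (hq' : NoSqueeze δ p q q') :
    ∃ t u, δ t = δ' u ∧ δ t ≠ p ∧ δ t ≠ q := by
  by_cases hx : Side.right.nrm p ≠ Side.right.nrm q ∧ Side.right.nrm p' ≠ Side.right.nrm q'
  · exact h.meet_of_not_const h' hx.1 hx.2 hc hd hp hq hp' hq'
  by_cases hy : Side.top.nrm p ≠ Side.top.nrm q ∧ Side.top.nrm p' ≠ Side.top.nrm q'
  · exact h.meet_of_not_const h' hy.1 hy.2 hc hd hp hq hp' hq'
  -- If each arc has a constant coordinate, both arcs cover their segments, and the crossing point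
  -- itself is common to them.
  have fin : ∀ a b : Side, a.nrm p = a.nrm q → b.nrm p' = b.nrm q' →
      ∃ t u, δ t = δ' u ∧ δ t ≠ p ∧ δ t ≠ q := by
    intro a b ha hb
    obtain ⟨t, u, t0, t1, u0, u1, hz⟩ := hc
    obtain ⟨v, hv⟩ := h.pt_mem_range ha t0.le t1.le
    obtain ⟨w, hw⟩ := h'.pt_mem_range hb u0.le u1.le
    refine ⟨v, w, by rw [hv, hw, hz], ?_, ?_⟩
    · rw [hv]
      intro hh
      apply hd
      have e1 := congrArg Prod.fst hh
      have e2 := congrArg Prod.snd hh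
      simp only [pt] at e1 e2
      have f1 : q.1 - p.1 = 0 := (mul_eq_zero.1 (show t * (q.1 - p.1) = 0 by linarith)).resolve_left t0.ne'
      have f2 : q.2 - p.2 = 0 := (mul_eq_zero.1 (show t * (q.2 - p.2) = 0 by linarith)).resolve_left t0.ne'
      simp [det, f1, f2]
    · rw [hv]
      intro hh
      apply hd
      have e1 := congrArg Prod.fst hh
      have e2 := congrArg Prod.snd hh
      simp only [pt] at e1 e2
      have f1 : q.1 - p.1 = 0 :=
        (mul_eq_zero.1 (show (1 - t) * (q.1 - p.1) = 0 by linarith)).resolve_left (by linarith)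
      have f2 : q.2 - p.2 = 0 :=
        (mul_eq_zero.1 (show (1 - t) * (q.2 - p.2) = 0 by linarith)).resolve_left (by linarith)
      simp [det, f1, f2]
  -- Outside `fin`, one of the segments would be constant in both coordinates, that is a point,
  -- against `hd`.
  by_cases h1 : Side.right.nrm p = Side.right.nrm q
  · by_cases h2 : Side.top.nrm p' = Side.top.nrm q'
    · exact fin _ _ h1 h2
    · have h3 : Side.top.nrm p = Side.top.nrm q := by tauto
      exfalso
      apply hd
      simp only [Side.nrm] at h1 h3
      simp [det, h1, h3]
  · have h2 : Side.right.nrm p' = Side.right.nrm q' := by tauto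
    by_cases h3 : Side.top.nrm p = Side.top.nrm q
    · exact fin _ _ h3 h2
    · have h4 : Side.top.nrm p' = Side.top.nrm q' := by tauto
      exfalso
      apply hd
      simp only [Side.nrm] at h2 h4
      simp [det, h2, h4]

end

end NodeTrix
namespace NodeTrix
namespace Instance

variable {I : Instance}

/-! ## Reduction to straight segments -/

theorem numCrossings_eq_zero_iff (curve : I.Drawing) :
    I.numCrossings curve = 0 ↔ ∀ i, I.crossings curve i = ∅ := by
  simp [numCrossings]

/-- The segments themselves are the curves. A common point that is an end of one of them lies in a
square, hence is an end of the other too and is no local crossing; a common point interior to both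
is excluded by `hS`. -/
theorem mntlp_of_solution (hv : I.Valid) {S : Fin I.numE → Side × Side} (hS : I.Solution S) :
    I.MNTLP := by
  set side : I.SideAssignment := fun i e => if I.clA e = i then (S e).1 else (S e).2 with hside
  set curve : I.Drawing := fun e t =>
    pt (I.anchor (I.fst e) (side (I.cluster (I.fst e)) e))
      (I.anchor (I.snd e) (side (I.cluster (I.snd e)) e)) t with hcurve
  let P := fun e => I.anchor (I.endA e) (S e).1
  let Q := fun e => I.anchor (I.endB e) (S e).2
  -- The pair `S e` is ordered by cluster index, whereas the curve runs from `fst` to `snd`.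
  have cases : ∀ e, I.IsInter e →
      (∀ t, curve e t = pt (P e) (Q e) t) ∨ (∀ t, curve e t = pt (Q e) (P e) t) := by
    intro e he
    have hne := he.ne
    rcases ends_cases e with ⟨h1, h2⟩ | ⟨h1, h2⟩
    · left
      intro t
      have e1 : side (I.cluster (I.fst e)) e = (S e).1 := by simp [hside, clA, h1]
      have e2 : side (I.cluster (I.snd e)) e = (S e).2 := by
        simp only [hside, ← h2]; exact if_neg hne
      simp only [hcurve, e1, e2, P, Q, h1, h2]
    · right
      intro t
      have e1 : side (I.cluster (I.snd e)) e = (S e).1 := by simp [hside, clA, h1]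
      have e2 : side (I.cluster (I.fst e)) e = (S e).2 := by
        simp only [hside, ← h2]; exact if_neg hne
      simp only [hcurve, e1, e2, P, Q, h1, h2]
  have hPQ : ∀ e, I.IsInter e → P e ≠ Q e := fun e he => (hS.1 e he).ne
  have range : ∀ e, I.IsInter e → ∀ z ∈ Set.range (curve e),
      ∃ t : ℝ, 0 ≤ t ∧ t ≤ 1 ∧ z = pt (P e) (Q e) t := by
    rintro e he z ⟨t, rfl⟩
    rcases cases e he with h | h
    · exact ⟨t, t.2.1, t.2.2, h t⟩
    · exact ⟨1 - t, by linarith [t.2.2], by linarith [t.2.1], by rw [h, pt_symm (Q e) (P e)]⟩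
  have ends : ∀ e, I.IsInter e → ∀ z, (z = P e ∨ z = Q e) → I.IsEnd curve e z := by
    intro e he z hz
    unfold IsEnd
    rcases cases e he with h | h <;> rw [h, h] <;> simp only [Set.Icc.coe_zero,
      Set.Icc.coe_one, pt_zero, pt_one]
    · exact hz
    · exact hz.symm
  have inside : ∀ e, I.IsInter e → ∀ t : ℝ, 0 ≤ t → t ≤ 1 →
      ¬ I.IsEnd curve e (pt (P e) (Q e) t) → 0 < t ∧ t < 1 := by
    intro e he t h0 h1 hne
    constructor
    · refine lt_of_le_of_ne h0 ?_
      rintro rfl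
      exact hne (ends e he _ (.inl (pt_zero _ _)))
    · refine lt_of_le_of_ne h1 ?_
      rintro rfl
      exact hne (ends e he _ (.inr (pt_one _ _)))
  have avoid : ∀ e, I.IsInter e → ∀ i, ∀ z ∈ Set.range (curve e), z ∈ (I.square i).toSet →
      I.IsEnd curve e z := by
    intro e he i z hz hi
    obtain ⟨t, h0, h1, rfl⟩ := range e he z hz
    by_contra hne
    obtain ⟨h0', h1'⟩ := inside e he t h0 h1 hne
    exact hv.open_seg_avoids he (hS.1 e he) h0' h1' i hi
  have end_mem : ∀ e, I.IsInter e → ∀ z, I.IsEnd curve e z → ∃ i, z ∈ (I.square i).toSet := by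
    intro e he z hz
    unfold IsEnd at hz
    rcases cases e he with h | h <;> rw [h, h] at hz <;> simp only [Set.Icc.coe_zero,
      Set.Icc.coe_one, pt_zero, pt_one] at hz <;> rcases hz with rfl | rfl <;>
      exact ⟨_, I.anchor_mem _ _⟩
  have inj_pt : ∀ p q : ℝ × ℝ, p ≠ q → Function.Injective (pt p q) := by
    intro p q hpq t u htu
    by_contra hne
    apply hpq
    have e1 := congrArg Prod.fst htu
    have e2 := congrArg Prod.snd htu
    simp only [pt] at e1 e2
    have hne' : t - u ≠ 0 := sub_ne_zero.2 hne
    ext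
    · have := (mul_eq_zero.1 (show (t - u) * (q.1 - p.1) = 0 by linarith)).resolve_left hne'
      linarith
    · have := (mul_eq_zero.1 (show (t - u) * (q.2 - p.2) = 0 by linarith)).resolve_left hne'
      linarith
  refine ⟨side, curve, ⟨hv.disjoint, ?_, ?_, ?_, ?_, ?_, hv.pipe_disjoint, ?_⟩, ?_, avoid⟩
  · intro e _
    exact (continuous_pt _ _).comp continuous_subtype_val
  · intro e he
    apply Function.Injective.comp (g := pt _ _) _ Subtype.val_injective
    apply inj_pt
    rcases cases e he with h | h
    · have h0 := h 0
      have h1 := h 1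
      simp only [hcurve, Set.Icc.coe_zero, Set.Icc.coe_one, pt_zero, pt_one] at h0 h1
      rw [h0, h1]; exact hPQ e he
    · have h0 := h 0
      have h1 := h 1
      simp only [hcurve, Set.Icc.coe_zero, Set.Icc.coe_one, pt_zero, pt_one] at h0 h1
      rw [h0, h1]; exact (hPQ e he).symm
  · intro e _; simp [hcurve]
  · intro e _; simp [hcurve]
  · intro e he
    by_cases hy : (P e).2 = (Q e).2
    · refine .inl ⟨(P e).2, fun z hz => ?_⟩
      obtain ⟨t, -, -, rfl⟩ := range e he z hz
      simp only [pt, ← hy]; ring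
    by_cases hx : (P e).1 = (Q e).1
    · refine .inr (.inl ⟨(P e).1, fun z hz => ?_⟩)
      obtain ⟨t, -, -, rfl⟩ := range e he z hz
      simp only [pt, ← hx]; ring
    · refine .inr (.inr ⟨fun z hz w hw h => ?_, fun z hz w hw h => ?_⟩)
      · obtain ⟨t, -, -, rfl⟩ := range e he z hz
        obtain ⟨u, -, -, rfl⟩ := range e he w hw
        simp only [pt] at h
        have := (mul_eq_zero.1 (show (t - u) * ((Q e).1 - (P e).1) = 0 by linarith)).resolve_right
          (sub_ne_zero.2 (Ne.symm hx))
        rw [sub_eq_zero.1 this]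
      · obtain ⟨t, -, -, rfl⟩ := range e he z hz
        obtain ⟨u, -, -, rfl⟩ := range e he w hw
        simp only [pt] at h
        have := (mul_eq_zero.1 (show (t - u) * ((Q e).2 - (P e).2) = 0 by linarith)).resolve_right
          (sub_ne_zero.2 (Ne.symm hy))
        rw [sub_eq_zero.1 this]
  · intro e he z hz
    rw [pipe_cluster]
    obtain ⟨t, h0, h1, rfl⟩ := range e he z hz
    exact seg_mem_pipe e (S e) h0 h1
  · rw [numCrossings_eq_zero_iff]
    intro i
    ext ⟨e, f, z⟩
    simp only [crossings, Set.mem_ofPred_eq, Set.mem_empty_iff_false, iff_false]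
    rintro ⟨hlt, he, hf, hei, hfi, hze, hzf, hz⟩
    have nf : ¬ I.IsEnd curve f z := by
      intro h
      obtain ⟨k, hk⟩ := end_mem f hf z h
      exact hz ⟨avoid e he k z hze hk, h⟩
    have ne : ¬ I.IsEnd curve e z := by
      intro h
      obtain ⟨k, hk⟩ := end_mem e he z h
      exact hz ⟨h, avoid f hf k z hzf hk⟩
    obtain ⟨t, h0, h1, rfl⟩ := range e he z hze
    obtain ⟨u, h0', h1', hu⟩ := range f hf _ hzf
    obtain ⟨t0, t1⟩ := inside e he t h0 h1 ne
    obtain ⟨u0, u1⟩ := inside f hf u h0' h1' (hu ▸ nf)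
    exact hS.2 e f hlt.ne he hf ⟨i, hei, hfi⟩ ⟨t, u, t0, t1, u0, u1, hu⟩

/-- An arc that starts on a side and avoids the interior of the square leaves outwards. -/
theorem nrm_lt_of_arc {δ : unitInterval → ℝ × ℝ} {q : ℝ × ℝ} {v : Fin I.numV} {s : Side}
    (h : Arc δ (I.anchor v s) q)
    (ha : ∀ t, δ t ∈ (I.square (I.cluster v)).toSet → t = 0 ∨ t = 1) :
    s.nrm (I.anchor v s) < s.nrm q := by
  by_contra hcon
  have hle := h.nrm_le (not_lt.1 hcon)
  -- The coordinate of the side `s` never exceeds its initial value, and the other three are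
  -- strictly below their bounds at the anchor, so the arc would begin inside the square.
  have hev : ∀ᶠ t in nhds (0 : unitInterval), δ t ∈ (I.square (I.cluster v)).toSet := by
    have : ∀ c : Side, ∀ᶠ t in nhds (0 : unitInterval),
        c.nrm (δ t) ≤ (I.square (I.cluster v)).sup c := by
      intro c
      by_cases hc : c = s
      · subst hc
        refine .of_forall fun t => (hle t).trans (I.anchor_nrm_self v c).le
      · have hcont : ContinuousAt (fun t => c.nrm (δ t)) 0 :=
          ((continuous_nrm c).comp h.cont).continuousAt
        have := hcont.eventually (p := fun y => y < (I.square (I.cluster v)).sup c)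
          (Iio_mem_nhds (by simpa [h.source] using I.anchor_nrm_lt v hc))
        exact this.mono fun t ht => ht.le
    filter_upwards [this .top, this .bottom, this .left, this .right] with t h1 h2 h3 h4
    rw [Square.mem_toSet_iff]
    intro c
    cases c <;> assumption
  have h1 : ∀ᶠ t in nhds (0 : unitInterval), t < 1 := Iio_mem_nhds zero_lt_one
  have := nhdsGT_neBot_of_exists_gt (a := (0 : unitInterval)) ⟨1, zero_lt_one⟩
  obtain ⟨t, ⟨ht, ht1⟩, ht0⟩ := (((hev.and h1).filter_mono nhdsWithin_le_nhds).and
    (self_mem_nhdsWithin (s := Set.Ioi (0 : unitInterval)))).exists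
  rcases ha t ht with rfl | rfl
  · exact lt_irrefl _ ht0
  · exact lt_irrefl _ ht1

/-- Chords between curve and segment stay in the pipe, which excludes third squares. Curve and
segment never have an outward coordinate below that of the anchor, so a chord point in an end square
forces either the curve (when `r = 1`) or the segment to be at that anchor; the equivalences in
`NoSqueeze` then bring the other one there. -/
theorem noSqueeze_of_valid (hv : I.Valid) {e : Fin I.numE} (he : I.IsInter e) {τ : Side × Side}
    (hl : I.Legal e τ) {δ : unitInterval → ℝ × ℝ}
    (h : Arc δ (I.anchor (I.endA e) τ.1) (I.anchor (I.endB e) τ.2))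
    (hpipe : ∀ t, δ t ∈ I.pipe (I.clA e) (I.clB e)) {W : ℝ × ℝ} {k : Fin I.numC}
    (hW : W ∈ (I.square k).toSet) :
    NoSqueeze δ (I.anchor (I.endA e) τ.1) (I.anchor (I.endB e) τ.2) W := by
  intro t r t0 t1 r0 r1 u hp hq hr
  have hmem := (Square.mem_toSet_iff _ _).1 hW
  have m0 : (0 : unitInterval) ≤ u := unitInterval.nonneg'
  have m1 : u ≤ (1 : unitInterval) := unitInterval.le_one'
  by_cases hA : k = I.clA e
  · have h1 := hmem τ.1
    have h2 := hl.1
    have hm := h.strictMono h2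
    have h3 : τ.1.nrm (I.anchor (I.endA e) τ.1) ≤ τ.1.nrm (δ u) := by
      have := hm.monotone m0
      simpa only [h.source] using this
    rw [hA, clA, ← I.anchor_nrm_self, ← hr, Side.nrm_pt, Side.nrm_pt] at h1
    by_cases hr1 : r = 1
    · subst hr1
      have : τ.1.nrm (δ u) = τ.1.nrm (δ 0) := by rw [h.source]; linarith
      have hu := hm.injective this
      have hs : δ u = I.anchor (I.endA e) τ.1 := by rw [hu, h.source]
      rw [hp.2 hs, hs]
    · have hr' : 0 < 1 - r := by
        have := lt_of_le_of_ne r1 hr1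
        linarith
      have ht : t = 0 := by
        by_contra hne
        have htp : 0 < t := lt_of_le_of_ne t0 (Ne.symm hne)
        have e1 : 0 < t * (τ.1.nrm (I.anchor (I.endB e) τ.2) - τ.1.nrm (I.anchor (I.endA e) τ.1)) :=
          mul_pos htp (by linarith)
        have e2 := mul_pos hr' e1
        have e3 : 0 ≤ r * (τ.1.nrm (δ u) - τ.1.nrm (I.anchor (I.endA e) τ.1)) :=
          mul_nonneg r0 (by linarith)
        linarith
      subst ht
      rw [hp.1 (pt_zero _ _), pt_zero]
  by_cases hB : k = I.clB e
  · have h1 := hmem τ.2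
    have h2 := hl.2
    have hm := h.reverse.strictMono h2
    have h3 : τ.2.nrm (I.anchor (I.endB e) τ.2) ≤ τ.2.nrm (δ u) := by
      have := hm.monotone (show 0 ≤ unitInterval.symm u from unitInterval.nonneg')
      simpa [h.target] using this
    rw [hB, clB, ← I.anchor_nrm_self, ← hr, Side.nrm_pt, Side.nrm_pt] at h1
    by_cases hr1 : r = 1
    · subst hr1
      have : τ.2.nrm (δ (unitInterval.symm (unitInterval.symm u))) =
          τ.2.nrm (δ (unitInterval.symm 0)) := by
        rw [unitInterval.symm_symm, unitInterval.symm_zero, h.target]; linarith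
      have hu := hm.injective this
      have hs : δ u = I.anchor (I.endB e) τ.2 := by
        rw [← unitInterval.symm_symm u, hu, unitInterval.symm_zero, h.target]
      rw [hq.2 hs, hs]
    · have hr' : 0 < 1 - r := by
        have := lt_of_le_of_ne r1 hr1
        linarith
      have ht : t = 1 := by
        by_contra hne
        have htp : 0 < 1 - t := sub_pos.2 (lt_of_le_of_ne t1 hne)
        have e1 : 0 < (1 - t) * (τ.2.nrm (I.anchor (I.endA e) τ.1) -
            τ.2.nrm (I.anchor (I.endB e) τ.2)) := mul_pos htp (by linarith)
        have e2 := mul_pos hr' e1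
        have e3 : 0 ≤ r * (τ.2.nrm (δ u) - τ.2.nrm (I.anchor (I.endB e) τ.2)) :=
          mul_nonneg r0 (by linarith)
        linarith
      subst ht
      rw [hq.1 (pt_one _ _), pt_one]
  · exfalso
    refine Set.disjoint_left.1 (hv.pipe_disjoint _ _ he.adjacent k hA hB) ?_ hW
    rw [← hr]
    exact pt_mem_of_convex (convex_convexHull ℝ _) (seg_mem_pipe e τ t0 t1) (hpipe u) r0 r1

/-- The sides of the representation already form a solution: `nrm_lt_of_arc` gives legality, and a
crossing of two segments would produce, through `Arc.meet`, a common point of the curves that is not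
an end of one of them. -/
theorem solution_of_mntlp (h : I.MNTLP) : I.Valid ∧ ∃ S, I.Solution S := by
  obtain ⟨side, curve, hrep, hcr, havoid⟩ := h
  have hv : I.Valid := ⟨hrep.disjoint, hrep.pipe_disjoint⟩
  set S : Fin I.numE → Side × Side := fun e => (side (I.clA e) e, side (I.clB e) e) with hS
  have arcs : ∀ e, I.IsInter e → ∃ δ, Arc δ (I.anchor (I.endA e) (S e).1)
      (I.anchor (I.endB e) (S e).2) ∧ Set.range δ = Set.range (curve e) := by
    intro e he
    have h0 : Arc (curve e) (I.anchor (I.fst e) (side (I.cluster (I.fst e)) e))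
        (I.anchor (I.snd e) (side (I.cluster (I.snd e)) e)) := by
      refine ⟨hrep.continuous e he, hrep.injective e he, hrep.source e he, hrep.target e he, ?_⟩
      have hinj := hrep.injective e he
      have hsrc := hrep.source e he
      have hsub : ∀ t, curve e t ∈ Set.range (curve e) := fun t => ⟨t, rfl⟩
      have hx : (∀ t, (curve e t).1 = (curve e 0).1) ∨ Function.Injective fun t => (curve e t).1 := by
        rcases hrep.xyMonotone e he with ⟨y, hy⟩ | ⟨x, hx⟩ | ⟨h1, h2⟩
        · right
          intro t u htu
          exact hinj (Prod.ext htu ((hy _ (hsub t)).trans (hy _ (hsub u)).symm))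
        · left
          intro t
          rw [hx _ (hsub t), hx _ (hsub 0)]
        · right
          intro t u htu
          exact hinj (h1 (hsub t) (hsub u) htu)
      have hy : (∀ t, (curve e t).2 = (curve e 0).2) ∨ Function.Injective fun t => (curve e t).2 := by
        rcases hrep.xyMonotone e he with ⟨y, hy⟩ | ⟨x, hx⟩ | ⟨h1, h2⟩
        · left
          intro t
          rw [hy _ (hsub t), hy _ (hsub 0)]
        · right
          intro t u htu
          exact hinj (Prod.ext ((hx _ (hsub t)).trans (hx _ (hsub u)).symm) htu)
        · right
          intro t u htu
          exact hinj (h2 (hsub t) (hsub u) htu)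
      rw [hsrc] at hx hy
      intro s
      cases s
      · exact hy
      · exact hy.imp (fun h t => congrArg Neg.neg (h t)) (fun h t u htu => h (neg_injective htu))
      · exact hx.imp (fun h t => congrArg Neg.neg (h t)) (fun h t u htu => h (neg_injective htu))
      · exact hx
    rcases ends_cases e with ⟨h1, h2⟩ | ⟨h1, h2⟩
    · refine ⟨curve e, ?_, rfl⟩
      simpa only [hS, clA, clB, h1, h2] using h0
    · refine ⟨_, ?_, unitInterval.symm_bijective.surjective.range_comp (curve e)⟩
      have : Arc (curve e ∘ unitInterval.symm) _ _ := h0.reverse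
      simpa only [hS, clA, clB, h1, h2] using this
  choose! δ hδ hrange using arcs
  -- The arc may run against the given curve, so its ends are identified through the common range:
  -- both lie in squares, hence they are the two ends of the curve.
  have hδ_end : ∀ e, I.IsInter e → ∀ k t, δ e t ∈ (I.square k).toSet → t = 0 ∨ t = 1 := by
    intro e he k t hk
    have hr : δ e t ∈ Set.range (curve e) := hrange e he ▸ ⟨t, rfl⟩
    have hend := havoid e he k _ hr hk
    have hA : δ e 0 ∈ Set.range (curve e) := hrange e he ▸ ⟨0, rfl⟩
    have hB : δ e 1 ∈ Set.range (curve e) := hrange e he ▸ ⟨1, rfl⟩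
    have hA' := havoid e he (I.clA e) _ hA (by rw [(hδ e he).source]; exact I.anchor_mem _ _)
    have hB' := havoid e he (I.clB e) _ hB (by rw [(hδ e he).target]; exact I.anchor_mem _ _)
    have hinj := (hδ e he).inj
    have h01 : δ e 0 ≠ δ e 1 := fun h => zero_ne_one (hinj h)
    unfold IsEnd at hend hA' hB'
    have : δ e t = δ e 0 ∨ δ e t = δ e 1 := by
      rcases hend with h1 | h1 <;> rcases hA' with h2 | h2 <;> rcases hB' with h3 | h3
      all_goals first
        | exact absurd (h2.trans h3.symm) h01
        | exact .inl (h1.trans h2.symm)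
        | exact .inr (h1.trans h3.symm)
    exact this.imp (fun h => hinj h) (fun h => hinj h)
  have hlegal : ∀ e, I.IsInter e → I.Legal e (S e) := by
    intro e he
    refine ⟨nrm_lt_of_arc (hδ e he) fun t ht => hδ_end e he _ t ht,
      nrm_lt_of_arc (hδ e he).reverse fun t ht => ?_⟩
    rcases hδ_end e he _ _ ht with h | h
    · right; rw [← unitInterval.symm_symm t, h, unitInterval.symm_zero]
    · left; rw [← unitInterval.symm_symm t, h, unitInterval.symm_one]
  have hpipe : ∀ e, I.IsInter e → ∀ t, δ e t ∈ I.pipe (I.clA e) (I.clB e) := by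
    intro e he t
    have hr : δ e t ∈ Set.range (curve e) := hrange e he ▸ ⟨t, rfl⟩
    have := hrep.inside_pipe e he hr
    rwa [pipe_cluster] at this
  refine ⟨hv, S, hlegal, fun e f hef he hf ⟨i, hei, hfi⟩ hc => ?_⟩
  have hd := hv.det_ne_zero he hf hef (hlegal e he) (hlegal f hf) hc
  have nsq := fun (e : Fin I.numE) (he : I.IsInter e) (v : Fin I.numV) (s : Side) =>
    noSqueeze_of_valid hv he (hlegal e he) (hδ e he) (hpipe e he) (I.anchor_mem v s)
  obtain ⟨t, u, h1, h2, h3⟩ := (hδ e he).meet (hδ f hf) hc hd (nsq f hf _ _) (nsq f hf _ _)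
    (nsq e he _ _) (nsq e he _ _)
  have hr : δ e t ∈ Set.range (curve e) := hrange e he ▸ ⟨t, rfl⟩
  have hr' : δ e t ∈ Set.range (curve f) := hrange f hf ▸ ⟨u, h1.symm⟩
  have hne : ¬ I.IsEnd curve e (δ e t) := by
    intro hend
    have : ∃ k, δ e t ∈ (I.square k).toSet := by
      rcases hend with h | h
      · rw [h, hrep.source e he]; exact ⟨_, I.anchor_mem _ _⟩
      · rw [h, hrep.target e he]; exact ⟨_, I.anchor_mem _ _⟩
    obtain ⟨k, hk⟩ := this
    rcases hδ_end e he k t hk with rfl | rfl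
    · exact h2 (hδ e he).source
    · exact h3 (hδ e he).target
  rw [numCrossings_eq_zero_iff] at hcr
  rcases lt_or_gt_of_ne hef with hlt | hlt
  · have : (e, f, δ e t) ∈ I.crossings curve i :=
      ⟨hlt, he, hf, hei, hfi, hr, hr', fun h => hne h.1⟩
    rw [hcr i] at this
    exact this
  · have : (f, e, δ e t) ∈ I.crossings curve i :=
      ⟨hlt, hf, he, hfi, hei, hr', hr, fun h => hne h.2⟩
    rw [hcr i] at this
    exact this

/-- Straight segments suffice. -/
theorem mntlp_iff : I.MNTLP ↔ I.Valid ∧ ∃ S, I.Solution S :=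
  ⟨solution_of_mntlp, fun ⟨hv, _, hS⟩ => mntlp_of_solution hv hS⟩

end Instance
end NodeTrix
namespace NodeTrix

/-! ## Crossings forced by the sides -/

/-- Since the coordinate `c` does not decrease along `r r'`, the order at the levels of `p` and `q`
is inherited from the ends `r` and `r'`, and `cross_of_strip` applies. -/
theorem cross_of_swap {a c : Side} (h1 : c ≠ a) (h2 : c ≠ a.opp) {p q r r' : ℝ × ℝ}
    (hpq : a.nrm p < a.nrm q) (hr : a.nrm r ≤ a.nrm p) (hr' : a.nrm q ≤ a.nrm r')
    (hM : c.nrm p < c.nrm r) (hM' : c.nrm r' < c.nrm q) (hrr : c.nrm r ≤ c.nrm r') :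
    Cross p q r r' := by
  have hlt : a.nrm r < a.nrm r' := by linarith
  obtain ⟨t₀, a0, a1, a2, -, -⟩ := exists_level hlt hr (by linarith)
  obtain ⟨t₁, b0, b1, b2, -, -⟩ := exists_level hlt (show a.nrm r ≤ a.nrm q by linarith) hr'
  refine cross_of_strip h1 h2 a0 a1 b0 b1 hpq a2 b2 ?_ ?_
  · rw [Side.nrm_pt]; nlinarith
  · rw [Side.nrm_pt]; nlinarith

/-- Segments with a common end do not cross unless they are parallel. -/
theorem det_eq_zero_of_cross {p q p' : ℝ × ℝ} (h : Cross p q p' q) : det (q - p) (q - p') = 0 := by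
  obtain ⟨t, u, t0, t1, u0, u1, h⟩ := h
  have e1 := congrArg Prod.fst h
  have e2 := congrArg Prod.snd h
  simp only [pt] at e1 e2
  have f1 : (1 - t) * (q.1 - p.1) = (1 - u) * (q.1 - p'.1) := by linarith
  have f2 : (1 - t) * (q.2 - p.2) = (1 - u) * (q.2 - p'.2) := by linarith
  have : (1 - t) * det (q - p) (q - p') = 0 := by
    simp only [det, Prod.fst_sub, Prod.snd_sub]
    linear_combination f1 * (q.2 - p'.2) - f2 * (q.1 - p'.1)
  exact (mul_eq_zero.1 this).resolve_left (by linarith)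

set_option maxHeartbeats 800000 in
/-- A segment that crosses the middle one of three segments with a common end crosses one of the
other two. -/
theorem not_cross_of_sandwich {a c : Side} (h1 : c ≠ a) (h2 : c ≠ a.opp)
    {P₁ P₀ P₂ q r r' : ℝ × ℝ} {α : ℝ} (hP₁ : a.nrm P₁ = α) (hP₀ : a.nrm P₀ = α)
    (hP₂ : a.nrm P₂ = α) (hαq : α < a.nrm q) (h10 : c.nrm P₁ ≤ c.nrm P₀)
    (h02 : c.nrm P₀ ≤ c.nrm P₂) (n1 : ¬ Cross P₁ q r r') (n2 : ¬ Cross P₂ q r r')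
    (hdet : det (q - P₀) (r' - r) ≠ 0) {K : Set (ℝ × ℝ)} (hK : Convex ℝ K) (k1 : P₁ ∈ K)
    (k2 : P₂ ∈ K) (kq : q ∈ K) (kr : r ∈ K → a.nrm r ≤ α ∨ a.nrm q ≤ a.nrm r)
    (kr' : r' ∈ K → a.nrm r' ≤ α ∨ a.nrm q ≤ a.nrm r') : ¬ Cross P₀ q r r' := by
  -- by symmetry, the crossing segment is directed upwards
  wlog hup : a.nrm r ≤ a.nrm r' generalizing r r' with H
  · intro h
    refine H (fun h => n1 h.swap_right) (fun h => n2 h.swap_right) ?_ kr' kr (le_of_not_ge hup)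
      h.swap_right
    intro h; apply hdet; simp only [det, Prod.fst_sub, Prod.snd_sub] at *; linarith
  rintro ⟨t, u, t0, t1, u0, u1, hz⟩
  set β := a.nrm q with hβ
  have hzN : (1 - t) * α + t * β = (1 - u) * a.nrm r + u * a.nrm r' := by
    rw [← Side.nrm_pt, ← hz, Side.nrm_pt, hP₀]
  have hzM : (1 - t) * c.nrm P₀ + t * c.nrm q = (1 - u) * c.nrm r + u * c.nrm r' := by
    rw [← Side.nrm_pt, ← Side.nrm_pt, hz]
  have hd : 0 < β - α := by linarith
  -- the side of a point with respect to the line through `P` and `q`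
  let H : ℝ × ℝ → ℝ → ℝ := fun P v =>
    (c.nrm (pt r r' v) - c.nrm q) * (β - α) - (c.nrm P - c.nrm q) * (β - a.nrm (pt r r' v))
  have Hzero : ∀ P v, a.nrm P = α → 0 < v → v < 1 → α < a.nrm (pt r r' v) →
      a.nrm (pt r r' v) < β → H P v = 0 → Cross P q r r' := by
    intro P v hP v0 v1 l1 l2 hH
    refine ⟨(a.nrm (pt r r' v) - α) / (β - α), v, div_pos (by linarith) hd,
      by rw [div_lt_one hd]; linarith, v0, v1, eq_of_nrm_eq h1 h2 ?_ ?_⟩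
    · rw [Side.nrm_pt, hP, ← hβ]; field_simp; ring
    · rw [Side.nrm_pt]
      simp only [H] at hH
      field_simp
      linear_combination -hH
  have hHu : ∀ P, H P u = (c.nrm P₀ - c.nrm P) * ((1 - t) * (β - α)) := by
    intro P
    simp only [H, Side.nrm_pt]
    rw [← hzN, ← hzM]; ring
  have hlev : α < a.nrm (pt r r' u) ∧ a.nrm (pt r r' u) < β := by
    rw [Side.nrm_pt, ← hzN]; constructor <;> nlinarith
  have hpos : 0 < (1 - t) * (β - α) := mul_pos (by linarith) hd
  have strict1 : 0 < H P₁ u := by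
    refine lt_of_le_of_ne ?_ fun h => n1 (Hzero P₁ u hP₁ u0 u1 hlev.1 hlev.2 h.symm)
    rw [hHu]; exact mul_nonneg (by linarith) hpos.le
  have strict2 : H P₂ u < 0 := by
    refine lt_of_le_of_ne ?_ fun h => n2 (Hzero P₂ u hP₂ u0 u1 hlev.1 hlev.2 h)
    rw [hHu]; exact mul_nonpos_of_nonpos_of_nonneg (by linarith) hpos.le
  have Haff : ∀ P v l, H P (u + l * (v - u)) = (1 - l) * H P u + l * H P v := by
    intro P v l
    simp only [H, Side.nrm_pt]; ring
  have Naff : ∀ v l, a.nrm (pt r r' (u + l * (v - u))) =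
      (1 - l) * a.nrm (pt r r' u) + l * a.nrm (pt r r' v) := by
    intro v l
    simp only [Side.nrm_pt]; ring
  -- above the crossing, the segment stays in the wedge
  have wedge : ∀ v, u < v → v ≤ 1 → a.nrm (pt r r' v) ≤ β → 0 ≤ H P₁ v ∧ H P₂ v ≤ 0 := by
    intro v huv v1 hvβ
    have hvα : α < a.nrm (pt r r' v) := by
      rw [Side.nrm_pt]
      have := hlev.1
      rw [Side.nrm_pt] at this
      nlinarith
    -- The affine function `H P` vanishes where it changes sign, and there the segment meets the rib
    -- from `P` to `q`.
    have cross : ∀ P, a.nrm P = α → H P u * H P v < 0 → Cross P q r r' := by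
      intro P hP hprod
      have hne : H P u - H P v ≠ 0 := by
        intro h
        have : H P u = H P v := by linarith
        rw [this] at hprod
        nlinarith [mul_self_nonneg (H P v)]
      set l := H P u / (H P u - H P v) with hl
      have hl01 : 0 < l ∧ l < 1 := by
        rcases mul_neg_iff.1 hprod with ⟨x, y⟩ | ⟨x, y⟩
        · exact ⟨div_pos x (by linarith), by rw [hl, div_lt_one (by linarith)]; linarith⟩
        · refine ⟨div_pos_of_neg_of_neg x (by linarith), ?_⟩
          rw [hl, div_lt_one_of_neg (by linarith)]; linarith
      have hle : l * (H P u - H P v) = H P u := by rw [hl]; field_simp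
      obtain ⟨l0, l1⟩ := hl01
      clear_value l
      have hlv : 0 < l * (v - u) := mul_pos l0 (by linarith)
      have hlv' : l * (v - u) < v - u := mul_lt_of_lt_one_left (by linarith) l1
      refine Hzero P (u + l * (v - u)) hP (by linarith) (by linarith) ?_ ?_ ?_
      · rw [Naff]
        have e1 := mul_pos (sub_pos.2 l1) (sub_pos.2 hlev.1)
        have e2 := mul_pos l0 (sub_pos.2 hvα)
        linarith
      · rw [Naff]
        have e1 := mul_pos (sub_pos.2 l1) (sub_pos.2 hlev.2)
        have e2 := mul_nonneg l0.le (sub_nonneg.2 hvβ)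
        linarith
      · rw [Haff]; linarith
    constructor
    · by_contra hcon
      exact n1 (cross P₁ hP₁ (mul_neg_of_pos_of_neg strict1 (not_le.1 hcon)))
    · by_contra hcon
      exact n2 (cross P₂ hP₂ (mul_neg_of_neg_of_pos strict2 (not_le.1 hcon)))
  -- If the segment reaches the level of `q`, the wedge has shrunk to the point `q`. It then passes
  -- through `q` and meets `P₀ q` below, so the two are parallel, against `hdet`.
  rcases le_or_gt β (a.nrm r') with hge | hlt
  · have hrlt : a.nrm r < a.nrm r' := by
      have := hlev.2
      rw [Side.nrm_pt] at this
      nlinarith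
    have hrβ : a.nrm r ≤ β := by
      have := hlev.2
      rw [Side.nrm_pt] at this
      nlinarith
    obtain ⟨v, v0, v1, hv, -, -⟩ := exists_level hrlt hrβ hge
    have huv : u < v := by
      have h3 := hlev.2
      rw [← hv, Side.nrm_pt, Side.nrm_pt] at h3
      nlinarith
    obtain ⟨w1, w2⟩ := wedge v huv v1 hv.le
    simp only [H, hv, sub_self, mul_zero, sub_zero] at w1 w2
    have hMq : c.nrm (pt r r' v) = c.nrm q := by
      have e1 := nonneg_of_mul_nonneg_left w1 hd
      have e2 := nonpos_of_mul_nonpos_left w2 hd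
      linarith
    apply hdet
    apply det_eq_nrm h1 h2
    rw [Side.nrm_pt] at hv hMq
    rw [hP₀, ← hβ]
    have hne : v - u ≠ 0 := by linarith
    have x1 : (1 - t) * (β - α) = (v - u) * (a.nrm r' - a.nrm r) := by linarith
    have x2 : (1 - t) * (c.nrm q - c.nrm P₀) = (v - u) * (c.nrm r' - c.nrm r) := by linarith
    apply mul_left_cancel₀ hne
    linear_combination (-(β - α)) * x2 + (c.nrm q - c.nrm P₀) * x1
  -- Otherwise the segment ends inside the wedge, so `r'` lies in the triangle `P₁ P₂ q`, hence in
  -- `K`, at a level where `kr'` forbids it.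
  · obtain ⟨w1, w2⟩ := wedge 1 u1 le_rfl (by rw [pt_one]; exact hlt.le)
    have hα' : α < a.nrm r' := by
      have := hlev.1
      rw [Side.nrm_pt] at this
      nlinarith
    simp only [H, pt_one] at w1 w2
    refine (kr' ?_).elim (fun h => absurd h hα'.not_ge) (fun h => absurd h hlt.not_ge)
    set s := (a.nrm r' - α) / (β - α) with hs
    have s0 : 0 < s := div_pos (by linarith) hd
    have s1 : s < 1 := by rw [hs, div_lt_one hd]; linarith
    have hs' : s * (β - α) = a.nrm r' - α := by rw [hs]; field_simp
    clear_value s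
    -- Projecting `r'` from `q` onto the base line gives a point between `P₁` and `P₂` with this
    -- coordinate.
    set m := (c.nrm r' - s * c.nrm q) / (1 - s) with hm
    have s1' : 0 < 1 - s := by linarith
    have hm' : (1 - s) * m = c.nrm r' - s * c.nrm q := by rw [hm]; field_simp
    clear_value m
    have hbr : β - a.nrm r' = (1 - s) * (β - α) := by linarith
    have m1 : c.nrm P₁ ≤ m := by
      rw [hbr] at w1
      have : 0 ≤ (m - c.nrm P₁) * ((1 - s) * (β - α)) := by
        have e : (m - c.nrm P₁) * ((1 - s) * (β - α)) = (c.nrm r' - c.nrm q) * (β - α) -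
          (c.nrm P₁ - c.nrm q) * ((1 - s) * (β - α)) := by linear_combination (β - α) * hm'
        rw [e]; exact w1
      have := nonneg_of_mul_nonneg_left this (mul_pos s1' hd)
      linarith
    have m2 : m ≤ c.nrm P₂ := by
      rw [hbr] at w2
      have : 0 ≤ (c.nrm P₂ - m) * ((1 - s) * (β - α)) := by
        have e : (c.nrm P₂ - m) * ((1 - s) * (β - α)) = -((c.nrm r' - c.nrm q) * (β - α) -
          (c.nrm P₂ - c.nrm q) * ((1 - s) * (β - α))) := by linear_combination (-(β - α)) * hm'
        rw [e]; linarith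
      have := nonneg_of_mul_nonneg_left this (mul_pos s1' hd)
      linarith
    have : ∃ l, 0 ≤ l ∧ l ≤ 1 ∧ c.nrm (pt P₁ P₂ l) = m := by
      rcases (m1.trans m2).lt_or_eq with hh | hh
      · obtain ⟨l, l0, l1, hl, -, -⟩ := exists_level hh m1 m2
        exact ⟨l, l0, l1, hl⟩
      · exact ⟨0, le_rfl, zero_le_one, by rw [pt_zero]; linarith⟩
    obtain ⟨l, l0, l1, hl⟩ := this
    have : r' = pt (pt P₁ P₂ l) q s := by
      apply eq_of_nrm_eq h1 h2
      · rw [Side.nrm_pt, Side.nrm_pt, hP₁, hP₂, ← hβ]; linarith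
      · rw [Side.nrm_pt, hl]; linarith
    rw [this]
    exact pt_mem_of_convex hK (pt_mem_of_convex hK k1 k2 l0 l1) kq s0.le s1.le

/-! ### Sides available to an edge between two separated squares -/

namespace Instance

variable {I : Instance}

/-- Two edges join the same pair of clusters. -/
def SamePair (e f : Fin I.numE) : Prop := I.clA e = I.clA f ∧ I.clB e = I.clB f

theorem SamePair.isInter {e f : Fin I.numE} (h : SamePair e f) (he : I.IsInter e) :
    I.IsInter f := by
  rw [isInter_iff] at *
  rwa [← h.1, ← h.2]

/-- The first square lies strictly behind the second one in direction `a`. -/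
theorem Legal.nrm_lt {e : Fin I.numE} {a : Side} (h : I.Legal e (a, a.opp)) {z w : ℝ × ℝ}
    (hz : z ∈ (I.square (I.clA e)).toSet) (hw : w ∈ (I.square (I.clB e)).toSet) :
    a.nrm z < a.nrm w := by
  have h0 := h.1
  have h1 := (Square.mem_toSet_iff _ _).1 hz a
  have h2 := (Square.mem_toSet_iff _ _).1 hw a.opp
  have h3 := I.anchor_nrm_self (I.endA e) a
  have h4 := I.anchor_nrm_self (I.endB e) a.opp
  rw [Side.nrm_opp] at h2 h4
  simp only [clA, clB] at *
  linarith

/-- A square lies strictly behind another one in some direction. -/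
theorem exists_separating {A B : Square} (h : Disjoint A.toSet B.toSet) :
    ∃ a : Side, ∀ z ∈ A.toSet, ∀ w ∈ B.toSet, a.nrm z < a.nrm w := by
  have hA := A.side_pos
  have hB := B.side_pos
  have key : A.x + A.side < B.x ∨ B.x + B.side < A.x ∨ A.y + A.side < B.y ∨ B.y + B.side < A.y := by
    by_contra hcon
    push Not at hcon
    obtain ⟨h1, h2, h3, h4⟩ := hcon
    have hm : (max A.x B.x, max A.y B.y) ∈ A.toSet ∧ (max A.x B.x, max A.y B.y) ∈ B.toSet := by
      constructor
      · exact ⟨⟨le_max_left _ _, max_le (by linarith) h1⟩, le_max_left _ _, max_le (by linarith) h3⟩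
      · exact ⟨⟨le_max_right _ _, max_le h2 (by linarith)⟩, le_max_right _ _, max_le h4 (by linarith)⟩
    exact Set.disjoint_left.1 h hm.1 hm.2
  rcases key with hk | hk | hk | hk
  · exact ⟨.right, fun z hz w hw => lt_of_le_of_lt hz.1.2 (lt_of_lt_of_le hk hw.1.1)⟩
  · exact ⟨.left, fun z hz w hw => neg_lt_neg (lt_of_le_of_lt hw.1.2 (lt_of_lt_of_le hk hz.1.1))⟩
  · exact ⟨.top, fun z hz w hw => lt_of_le_of_lt hz.2.2 (lt_of_lt_of_le hk hw.2.1)⟩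
  · exact ⟨.bottom, fun z hz w hw => neg_lt_neg (lt_of_le_of_lt hw.2.2 (lt_of_lt_of_le hk hz.2.1))⟩

/-- The possible pairs of sides of an edge between squares separated in direction `a`. -/
theorem Legal.classify {e : Fin I.numE} {a : Side}
    (hsep : ∀ z ∈ (I.square (I.clA e)).toSet, ∀ w ∈ (I.square (I.clB e)).toSet, a.nrm z < a.nrm w)
    {τ : Side × Side} (h : I.Legal e τ) :
    τ.2 = τ.1.opp ∨ ∃ c : Side, (c ≠ a ∧ c ≠ a.opp) ∧
      ((τ = (c, a.opp) ∧ (I.square (I.clA e)).sup c < (I.square (I.clB e)).sup c) ∨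
        (τ = (a, c) ∧ (I.square (I.clB e)).sup c < (I.square (I.clA e)).sup c)) := by
  obtain ⟨s, t⟩ := τ
  obtain ⟨h1, h2⟩ := h
  simp only at h1 h2
  have hA := I.anchor_mem (I.endA e) s
  have hB := I.anchor_mem (I.endB e) t
  have h3 := hsep _ hA _ hB
  have h4 := (Square.mem_toSet_iff _ _).1 hA
  have h5 := (Square.mem_toSet_iff _ _).1 hB
  have hs : s ≠ a.opp := by
    rintro rfl
    rw [Side.nrm_opp, Side.nrm_opp] at h1
    linarith
  have ht : t ≠ a := by
    rintro rfl
    linarith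
  by_cases hta : t = a.opp
  · subst hta
    by_cases hsa : s = a
    · left; rw [hsa]
    · right
      refine ⟨s, ⟨hsa, hs⟩, .inl ⟨rfl, ?_⟩⟩
      have := h5 s
      rw [I.anchor_nrm_self] at h1
      exact lt_of_lt_of_le h1 this
  · by_cases hsa : s = a
    · subst hsa
      right
      refine ⟨t, ⟨ht, hta⟩, .inr ⟨rfl, ?_⟩⟩
      have := h4 t
      rw [I.anchor_nrm_self] at h2
      exact lt_of_lt_of_le h2 this
    · left
      -- Here `s` and `t` are both perpendicular to `a`. Legality with equal sides would ask for two
      -- contrary inequalities, so they are opposite.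
      have hst : s ≠ t := by
        rintro rfl
        linarith
      revert hs ht hta hsa hst
      cases a <;> cases s <;> cases t <;> decide

/-- At most two pairs of non-opposite sides are possible. -/
theorem exists_opp_of_three (hv : I.Valid) {e : Fin I.numE} (he : I.IsInter e)
    {τ₁ τ₂ τ₃ : Side × Side} (h₁ : I.Legal e τ₁) (h₂ : I.Legal e τ₂) (h₃ : I.Legal e τ₃)
    (h12 : τ₁ ≠ τ₂) (h13 : τ₁ ≠ τ₃) (h23 : τ₂ ≠ τ₃) :
    τ₁.2 = τ₁.1.opp ∨ τ₂.2 = τ₂.1.opp ∨ τ₃.2 = τ₃.1.opp := by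
  obtain ⟨a, ha⟩ := exists_separating (hv.disjoint _ _ he.ne)
  rcases h₁.classify ha with h | ⟨c₁, hc₁, h₁⟩
  · exact .inl h
  rcases h₂.classify ha with h | ⟨c₂, hc₂, h₂⟩
  · exact .inr (.inl h)
  rcases h₃.classify ha with h | ⟨c₃, hc₃, h₃⟩
  · exact .inr (.inr h)
  exfalso
  -- For a side `c` perpendicular to `a`, the square that extends less far in direction `c` decides
  -- between `(c, a.opp)` and `(a, c)`. As there are only two such `c`, three distinct options are
  -- too many.
  have uniq : ∀ {c : Side} {σ τ : Side × Side},
      ((σ = (c, a.opp) ∧ (I.square (I.clA e)).sup c < (I.square (I.clB e)).sup c) ∨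
        (σ = (a, c) ∧ (I.square (I.clB e)).sup c < (I.square (I.clA e)).sup c)) →
      ((τ = (c, a.opp) ∧ (I.square (I.clA e)).sup c < (I.square (I.clB e)).sup c) ∨
        (τ = (a, c) ∧ (I.square (I.clB e)).sup c < (I.square (I.clA e)).sup c)) → σ = τ := by
    rintro c σ τ (⟨x, y⟩ | ⟨x, y⟩) (⟨x', y'⟩ | ⟨x', y'⟩)
    · rw [x, x']
    · exact absurd y y'.not_gt
    · exact absurd y y'.not_gt
    · rw [x, x']
  have : c₁ = c₂ ∨ c₁ = c₃ ∨ c₂ = c₃ := by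
    clear h₁ h₂ h₃ ha
    revert hc₁ hc₂ hc₃
    cases a <;> cases c₁ <;> cases c₂ <;> cases c₃ <;> decide
  rcases this with rfl | rfl | rfl
  · exact h12 (uniq h₁ h₂)
  · exact h13 (uniq h₁ h₃)
  · exact h23 (uniq h₂ h₃)

end Instance
end NodeTrix
namespace NodeTrix
namespace Instance

/-! ## Pinned options -/

/-- An edge together with a pair of sides. -/
abbrev Opt (I : Instance) : Type := Fin I.numE × (Side × Side)

variable {I : Instance}

/-- Two options can be chosen simultaneously. -/
def Compat (x y : I.Opt) : Prop :=
  (x.1 = y.1 → x.2 = y.2) ∧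
    (x.1 ≠ y.1 → I.IsInter x.1 → I.IsInter y.1 → Share x.1 y.1 → ¬ I.ECross x.1 x.2 y.1 y.2)

theorem Compat.symm {x y : I.Opt} (h : Compat x y) : Compat y x :=
  ⟨fun e => (h.1 e.symm).symm, fun e h1 h2 h3 hc => h.2 e.symm h2 h1 h3.symm (Cross.symm hc)⟩

theorem solution_iff (S : Fin I.numE → Side × Side) :
    I.Solution S ↔ (∀ e, I.IsInter e → I.Legal e (S e)) ∧ ∀ e f, Compat (e, S e) (f, S f) := by
  unfold Solution Compat
  refine and_congr_right fun _ => ⟨fun h e f => ⟨?_, h e f⟩, fun h e f => (h e f).2⟩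
  rintro (rfl : e = f); rfl

/-- The option lies between pinned options of the same kind. -/
def InRange (P : Set I.Opt) (x : I.Opt) : Prop :=
  ((∃ p ∈ P, p.2 = x.2 ∧ SamePair p.1 x.1 ∧ I.order (I.endA p.1) ≤ I.order (I.endA x.1)) ∧
    ∃ p ∈ P, p.2 = x.2 ∧ SamePair p.1 x.1 ∧ I.order (I.endA x.1) ≤ I.order (I.endA p.1)) ∧
  (∃ p ∈ P, p.2 = x.2 ∧ SamePair p.1 x.1 ∧ I.order (I.endB p.1) ≤ I.order (I.endB x.1)) ∧
    ∃ p ∈ P, p.2 = x.2 ∧ SamePair p.1 x.1 ∧ I.order (I.endB x.1) ≤ I.order (I.endB p.1)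

/-- The option is not excluded by the pinned options. -/
def Survives (P : Set I.Opt) (x : I.Opt) : Prop :=
  (I.IsInter x.1 → I.Legal x.1 x.2) ∧ (∀ p ∈ P, Compat p x) ∧
    (x.2.2 = x.2.1.opp → InRange P x)

/-- The pinned options contain the corners of the ranges. -/
def HasCorners (P : Set I.Opt) : Prop :=
  ∀ x : I.Opt, x.2.2 = x.2.1.opp → I.IsInter x.1 → InRange P x →
    ((∀ p ∈ P, p.2 = x.2 → SamePair p.1 x.1 → I.order (I.endA p.1) ≤ I.order (I.endA x.1)) ∨
      ∀ p ∈ P, p.2 = x.2 → SamePair p.1 x.1 → I.order (I.endA x.1) ≤ I.order (I.endA p.1)) →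
    ((∀ p ∈ P, p.2 = x.2 → SamePair p.1 x.1 → I.order (I.endB p.1) ≤ I.order (I.endB x.1)) ∨
      ∀ p ∈ P, p.2 = x.2 → SamePair p.1 x.1 → I.order (I.endB x.1) ≤ I.order (I.endB p.1)) →
    ∃ σ, (x.1, σ) ∈ P

theorem SamePair.share {e f g : Fin I.numE} (h : SamePair f e) (hs : Share e g) : Share f g := by
  obtain ⟨i, h1, h2⟩ := hs
  refine ⟨i, ?_, h2⟩
  rw [incident_iff] at *
  rwa [h.1, h.2]

theorem anchor_between {s c : Side} (h1 : c ≠ s) (h2 : c ≠ s.opp) {v₁ v v₂ : Fin I.numV}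
    (e1 : I.cluster v₁ = I.cluster v) (e2 : I.cluster v₂ = I.cluster v)
    (o1 : I.order v₁ ≤ I.order v) (o2 : I.order v ≤ I.order v₂) :
    (c.nrm (I.anchor v₁ s) ≤ c.nrm (I.anchor v s) ∧ c.nrm (I.anchor v s) ≤ c.nrm (I.anchor v₂ s)) ∨
    (c.nrm (I.anchor v₂ s) ≤ c.nrm (I.anchor v s) ∧ c.nrm (I.anchor v s) ≤ c.nrm (I.anchor v₁ s)) := by
  rcases I.anchor_mono s c h1 h2 with hm | hm
  · left
    constructor <;> rw [← not_lt, hm _ _ (by simp [e1, e2])] <;> omega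
  · right
    constructor <;> rw [← not_lt, hm _ _ (by simp [e1, e2])] <;> omega

/-- Where the anchors in the pipe of an edge with opposite sides lie. -/
theorem anchor_level (hv : I.Valid) {e : Fin I.numE} (he : I.IsInter e) {a : Side} {v : Fin I.numV}
    {s : Side} (h : I.anchor v s ∈ I.pipe (I.clA e) (I.clB e)) :
    a.nrm (I.anchor v s) ≤ (I.square (I.clA e)).sup a ∨
      a.opp.nrm (I.anchor v s) ≤ (I.square (I.clB e)).sup a.opp := by
  have hm := I.anchor_mem v s
  by_cases hA : I.cluster v = I.clA e
  · left
    rw [← hA]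
    exact (Square.mem_toSet_iff _ _).1 hm a
  by_cases hB : I.cluster v = I.clB e
  · right
    rw [← hB]
    exact (Square.mem_toSet_iff _ _).1 hm a.opp
  · exact absurd hm (Set.disjoint_left.1 (hv.pipe_disjoint _ _ he.adjacent _ hA hB) h)

/-! ### Fans of pinned segments -/

section
variable {e f₁ f₂ g : Fin I.numE} {a : Side} {σ : Side × Side}

theorem not_cross_of_compat {f : Fin I.numE} (hg : I.IsInter g)
    (hf : I.IsInter f) (hfe : SamePair f e) (hs : Share e g)
    {τ : Side × Side} (hc : Compat (f, τ) (g, σ)) (hfg : f ≠ g) : ¬ I.ECross f τ g σ :=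
  hc.2 hfg hf hg (hfe.share hs)

/-- The segments of `f₁`, `e` and `f₂` form a fan with its apex on the second square and that of `e`
in the middle. The pipe serves as the convex set `K`: it contains anchors of the two end squares
only, and these are not between the levels of base and apex. -/
theorem not_cross_of_pins_endB (hv : I.Valid) (he : I.IsInter e) (hg : I.IsInter g) (heg : e ≠ g)
    (hs : Share e g) (hl : I.Legal e (a, a.opp)) (hlg : I.Legal g σ)
    (p1 : SamePair f₁ e) (p2 : SamePair f₂ e) (c1 : Compat (f₁, (a, a.opp)) (g, σ))
    (c2 : Compat (f₂, (a, a.opp)) (g, σ)) (b1 : I.endB f₁ = I.endB e) (b2 : I.endB f₂ = I.endB e)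
    (o1 : I.order (I.endA f₁) ≤ I.order (I.endA e)) (o2 : I.order (I.endA e) ≤ I.order (I.endA f₂)) :
    ¬ I.ECross e (a, a.opp) g σ := by
  intro hcr
  have hdet := hv.det_ne_zero he hg heg hl hlg hcr
  -- If `g` were one of the pins, its segment would share an end with that of `e`, and such segments
  -- cross only when parallel.
  have hfg : ∀ f, Compat (f, (a, a.opp)) (g, σ) → I.endB f = I.endB e → f ≠ g := by
    rintro f hc hb rfl
    have hσ : (a, a.opp) = σ := hc.1 rfl
    subst hσ
    unfold ECross at hcr
    simp only [hb] at hcr hdet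
    exact hdet (det_eq_zero_of_cross hcr)
  have hinter : ∀ f, SamePair f e → I.IsInter f := fun f hf =>
    SamePair.isInter ⟨hf.1.symm, hf.2.symm⟩ he
  have n1 := not_cross_of_compat hg (hinter _ p1) p1 hs c1 (hfg _ c1 b1)
  have n2 := not_cross_of_compat hg (hinter _ p2) p2 hs c2 (hfg _ c2 b2)
  obtain ⟨c, h1, h2⟩ := exists_perp a
  have hlev : ∀ v, I.cluster v = I.clA e → a.nrm (I.anchor v a) = (I.square (I.clA e)).sup a := by
    intro v h; rw [I.anchor_nrm_self, h]
  have hq : a.nrm (I.anchor (I.endB e) a.opp) = -(I.square (I.clB e)).sup a.opp := by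
    rw [clB, ← I.anchor_nrm_self, Side.nrm_opp, neg_neg]
  have hαq : (I.square (I.clA e)).sup a < a.nrm (I.anchor (I.endB e) a.opp) := by
    have := hl.1
    rwa [I.anchor_nrm_self] at this
  have hK : ∀ v s, I.anchor v s ∈ I.pipe (I.clA e) (I.clB e) →
      a.nrm (I.anchor v s) ≤ (I.square (I.clA e)).sup a ∨
        a.nrm (I.anchor (I.endB e) a.opp) ≤ a.nrm (I.anchor v s) := by
    intro v s h
    refine (anchor_level hv he (a := a) h).imp_right fun h => ?_
    rw [hq]; rw [Side.nrm_opp] at h; linarith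
  have k1 : I.anchor (I.endA f₁) a ∈ I.pipe (I.clA e) (I.clB e) := by
    have := anchorA_mem_pipe f₁ a
    rwa [p1.1, p1.2] at this
  have k2 : I.anchor (I.endA f₂) a ∈ I.pipe (I.clA e) (I.clB e) := by
    have := anchorA_mem_pipe f₂ a
    rwa [p2.1, p2.2] at this
  unfold ECross at n1 n2
  simp only [b1, b2] at n1 n2
  rcases anchor_between h1 h2 p1.1 p2.1 o1 o2 with ⟨m1, m2⟩ | ⟨m1, m2⟩
  · exact not_cross_of_sandwich h1 h2 (hlev _ p1.1) (hlev _ rfl) (hlev _ p2.1) hαq m1 m2 n1 n2 hdet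
      (convex_convexHull ℝ _) k1 k2 (anchorB_mem_pipe e _) (hK _ _) (hK _ _) hcr
  · exact not_cross_of_sandwich h1 h2 (hlev _ p2.1) (hlev _ rfl) (hlev _ p1.1) hαq m1 m2 n2 n1 hdet
      (convex_convexHull ℝ _) k2 k1 (anchorB_mem_pipe e _) (hK _ _) (hK _ _) hcr

/-- The mirror image: the apex is on the first square and the ribs spread over the side `a.opp` of
the second. -/
theorem not_cross_of_pins_endA (hv : I.Valid) (he : I.IsInter e) (hg : I.IsInter g) (heg : e ≠ g)
    (hs : Share e g) (hl : I.Legal e (a, a.opp)) (hlg : I.Legal g σ)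
    (p1 : SamePair f₁ e) (p2 : SamePair f₂ e) (c1 : Compat (f₁, (a, a.opp)) (g, σ))
    (c2 : Compat (f₂, (a, a.opp)) (g, σ)) (b1 : I.endA f₁ = I.endA e) (b2 : I.endA f₂ = I.endA e)
    (o1 : I.order (I.endB f₁) ≤ I.order (I.endB e)) (o2 : I.order (I.endB e) ≤ I.order (I.endB f₂)) :
    ¬ I.ECross e (a, a.opp) g σ := by
  intro hcr
  have hdet := hv.det_ne_zero he hg heg hl hlg hcr
  have hfg : ∀ f, Compat (f, (a, a.opp)) (g, σ) → I.endA f = I.endA e → f ≠ g := by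
    rintro f hc hb rfl
    have hσ : (a, a.opp) = σ := hc.1 rfl
    subst hσ
    unfold ECross at hcr
    simp only [hb] at hcr hdet
    have := det_eq_zero_of_cross hcr.swap_left.swap_right
    apply hdet
    simp only [det, Prod.fst_sub, Prod.snd_sub] at *; linarith
  have hinter : ∀ f, SamePair f e → I.IsInter f := fun f hf =>
    SamePair.isInter ⟨hf.1.symm, hf.2.symm⟩ he
  have n1 := not_cross_of_compat hg (hinter _ p1) p1 hs c1 (hfg _ c1 b1)
  have n2 := not_cross_of_compat hg (hinter _ p2) p2 hs c2 (hfg _ c2 b2)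
  obtain ⟨c, h1, h2⟩ := exists_perp a.opp
  have hlev : ∀ v, I.cluster v = I.clB e →
      a.opp.nrm (I.anchor v a.opp) = (I.square (I.clB e)).sup a.opp := by
    intro v h; rw [I.anchor_nrm_self, h]
  have hq : a.opp.nrm (I.anchor (I.endA e) a) = -(I.square (I.clA e)).sup a := by
    rw [clA, ← I.anchor_nrm_self, Side.nrm_opp]
  have hαq : (I.square (I.clB e)).sup a.opp < a.opp.nrm (I.anchor (I.endA e) a) := by
    have := hl.2
    simp only at this
    rwa [I.anchor_nrm_self] at this
  have hK : ∀ v s, I.anchor v s ∈ I.pipe (I.clA e) (I.clB e) →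
      a.opp.nrm (I.anchor v s) ≤ (I.square (I.clB e)).sup a.opp ∨
        a.opp.nrm (I.anchor (I.endA e) a) ≤ a.opp.nrm (I.anchor v s) := by
    intro v s h
    rcases anchor_level hv he (a := a) h with h | h
    · right; rw [hq, Side.nrm_opp]; linarith
    · exact .inl h
  have k1 : I.anchor (I.endB f₁) a.opp ∈ I.pipe (I.clA e) (I.clB e) := by
    have := anchorB_mem_pipe f₁ a.opp
    rwa [p1.1, p1.2] at this
  have k2 : I.anchor (I.endB f₂) a.opp ∈ I.pipe (I.clA e) (I.clB e) := by
    have := anchorB_mem_pipe f₂ a.opp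
    rwa [p2.1, p2.2] at this
  have hdet' : det (I.anchor (I.endA e) a - I.anchor (I.endB e) a.opp)
      (I.anchor (I.endB g) σ.2 - I.anchor (I.endA g) σ.1) ≠ 0 := by
    intro h; apply hdet; simp only [det, Prod.fst_sub, Prod.snd_sub] at *; linarith
  unfold ECross at n1 n2
  simp only [b1, b2] at n1 n2
  rcases anchor_between h1 h2 p1.2 p2.2 o1 o2 with ⟨m1, m2⟩ | ⟨m1, m2⟩
  · exact not_cross_of_sandwich h1 h2 (hlev _ p1.2) (hlev _ rfl) (hlev _ p2.2) hαq m1 m2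
      (fun h => n1 h.swap_left) (fun h => n2 h.swap_left) hdet'
      (convex_convexHull ℝ _) k1 k2 (anchorA_mem_pipe e _) (hK _ _) (hK _ _) hcr.swap_left
  · exact not_cross_of_sandwich h1 h2 (hlev _ p2.2) (hlev _ rfl) (hlev _ p1.2) hαq m1 m2
      (fun h => n2 h.swap_left) (fun h => n1 h.swap_left) hdet'
      (convex_convexHull ℝ _) k2 k1 (anchorA_mem_pipe e _) (hK _ _) (hK _ _) hcr.swap_left

end

theorem order_eq_of_nrm_eq {s c : Side} (h1 : c ≠ s) (h2 : c ≠ s.opp) {v w : Fin I.numV}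
    (hc : I.cluster v = I.cluster w) (h : c.nrm (I.anchor v s) = c.nrm (I.anchor w s)) : v = w := by
  apply I.order_inj hc
  rcases I.anchor_mono s c h1 h2 with hm | hm
  · have e1 := (hm v w hc).not.1 (by rw [h]; exact lt_irrefl _)
    have e2 := (hm w v hc.symm).not.1 (by rw [h]; exact lt_irrefl _)
    omega
  · have e1 := (hm v w hc).not.1 (by rw [h]; exact lt_irrefl _)
    have e2 := (hm w v hc.symm).not.1 (by rw [h]; exact lt_irrefl _)
    omega

/-- If a vertex is extreme in a direction, it is extreme in the row-column order. -/
theorem extreme_of_nrm {s c : Side} (h1 : c ≠ s) (h2 : c ≠ s.opp) {v : Fin I.numV}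
    {X : Fin I.numV → Prop} (hX : ∀ w, X w → I.cluster w = I.cluster v)
    (h : ∀ w, X w → c.nrm (I.anchor w s) ≤ c.nrm (I.anchor v s)) :
    (∀ w, X w → I.order w ≤ I.order v) ∨ (∀ w, X w → I.order v ≤ I.order w) := by
  rcases I.anchor_mono s c h1 h2 with hm | hm
  · left
    intro w hw
    rw [← not_lt, ← hm v w (hX w hw).symm, not_lt]
    exact h w hw
  · right
    intro w hw
    rw [← not_lt, ← hm v w (hX w hw).symm, not_lt]
    exact h w hw

/-- An edge with three surviving options: the option with opposite sides is compatible with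
everything that survives. -/
theorem compat_of_three (hv : I.Valid) {P : Set I.Opt}
    (hPl : ∀ p ∈ P, I.IsInter p.1 ∧ I.Legal p.1 p.2) (hC : HasCorners P) {e : Fin I.numE}
    (he : I.IsInter e) {a : Side} {τ₂ τ₃ : Side × Side} (s₁ : Survives P (e, (a, a.opp)))
    (s₂ : Survives P (e, τ₂)) (s₃ : Survives P (e, τ₃)) (h12 : (a, a.opp) ≠ τ₂)
    (h13 : (a, a.opp) ≠ τ₃) (h23 : τ₂ ≠ τ₃) {y : I.Opt} (hy : Survives P y) (hey : e ≠ y.1) :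
    Compat (e, (a, a.opp)) y := by
  have hl := s₁.1 he
  have hrange := s₁.2.2 rfl
  -- the edge is not pinned
  have hpin : ∀ σ, (e, σ) ∉ P := by
    intro σ hσ
    have e1 := (s₁.2.1 _ hσ).1 rfl
    have e2 := (s₂.2.1 _ hσ).1 rfl
    exact h12 (e1.symm.trans e2)
  have hpne : ∀ p ∈ P, p.1 ≠ e := by
    rintro ⟨f, σ⟩ hp (rfl : f = e)
    exact hpin σ hp
  let X : Fin I.numE → Prop := fun f => (f, (a, a.opp)) ∈ P ∧ SamePair f e
  have hX : ∀ p ∈ P, p.2 = (a, a.opp) → SamePair p.1 e → X p.1 := by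
    rintro ⟨f, σ⟩ hp hσ hs
    exact ⟨hσ ▸ hp, hs⟩
  obtain ⟨⟨⟨p₁, hp₁, t₁, q₁, o₁⟩, ⟨p₂, hp₂, t₂, q₂, o₂⟩⟩, ⟨⟨p₃, hp₃, t₃, q₃, o₃⟩,
    ⟨p₄, hp₄, t₄, q₄, o₄⟩⟩⟩ := s₁.2.2 rfl
  have x₁ := hX _ hp₁ t₁ q₁
  have x₂ := hX _ hp₂ t₂ q₂
  have x₃ := hX _ hp₃ t₃ q₃
  have x₄ := hX _ hp₄ t₄ q₄
  have nocross : ∀ f, X f → ∀ τ, Survives P (e, τ) → ¬ I.ECross f (a, a.opp) e τ := by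
    intro f hf τ hτ
    refine (hτ.2.1 _ hf.1).2 (hpne _ hf.1) (hPl _ hf.1).1 he ?_
    exact share_of_clA hf.2.1
  have hsep := fun z hz w hw => hl.nrm_lt (z := z) (w := w) hz hw
  -- A further survivor uses one facing side and one perpendicular side `c`. Since it crosses no pin
  -- of type `(a, a.opp)`, its end on the facing side is extreme in direction `c` among the ends of
  -- those pins.
  have class' : ∀ τ, Survives P (e, τ) → (a, a.opp) ≠ τ → ∃ c : Side, (c ≠ a ∧ c ≠ a.opp) ∧
      ((τ = (c, a.opp) ∧ (∀ f, X f →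
        c.nrm (I.anchor (I.endB f) a.opp) ≤ c.nrm (I.anchor (I.endB e) a.opp)) ∧
        (I.square (I.clA e)).sup c < (I.square (I.clB e)).sup c) ∨
      (τ = (a, c) ∧ (∀ f, X f → c.nrm (I.anchor (I.endA f) a) ≤ c.nrm (I.anchor (I.endA e) a)) ∧
        (I.square (I.clB e)).sup c < (I.square (I.clA e)).sup c)) := by
    intro τ hτ hne
    have hlτ := hτ.1 he
    have hsup : ∀ f, X f → ∀ s, s.nrm (I.anchor (I.endA f) s) = (I.square (I.clA e)).sup s := by
      intro f hf s; rw [I.anchor_nrm_self, ← hf.2.1]; rfl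
    have hsup' : ∀ f, X f → ∀ s, s.nrm (I.anchor (I.endB f) s) = (I.square (I.clB e)).sup s := by
      intro f hf s; rw [I.anchor_nrm_self, ← hf.2.2]; rfl
    have hlt : ∀ f, X f → ∀ c : Side, c ≠ a → c.nrm (I.anchor (I.endA f) a) <
        (I.square (I.clA e)).sup c := by
      intro f hf c hc; have := I.anchor_nrm_lt (I.endA f) hc; rwa [← hf.2.1]
    have hlt' : ∀ f, X f → ∀ c : Side, c ≠ a.opp → c.nrm (I.anchor (I.endB f) a.opp) <
        (I.square (I.clB e)).sup c := by
      intro f hf c hc; have := I.anchor_nrm_lt (I.endB f) hc; rwa [← hf.2.2]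
    have memA : ∀ s t, t.nrm (I.anchor (I.endA e) s) ≤ (I.square (I.clA e)).sup t := fun s t =>
      (Square.mem_toSet_iff _ _).1 (I.anchor_mem (I.endA e) s) t
    have memB : ∀ s t, t.nrm (I.anchor (I.endB e) s) ≤ (I.square (I.clB e)).sup t := fun s t =>
      (Square.mem_toSet_iff _ _).1 (I.anchor_mem (I.endB e) s) t
    rcases hlτ.classify hsep with h | ⟨c, hc, ⟨h, hh⟩ | ⟨h, hh⟩⟩
    · -- an option with opposite sides in another direction crosses the pins
      exfalso
      obtain ⟨c, d⟩ := τ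
      obtain rfl : d = c.opp := h
      have hca : c ≠ a := by rintro rfl; exact hne rfl
      have hca' : c ≠ a.opp := by
        rintro rfl
        have h3 := hlτ.1
        have h4 := hsep _ (I.anchor_mem (I.endA e) a.opp) _ (I.anchor_mem (I.endB e) a.opp.opp)
        simp only [Side.nrm_opp] at h3
        linarith
      refine nocross _ x₁ _ hτ ?_
      -- From the side `c` of the first square to the side `c.opp` of the second, the segment spans
      -- the gap and passes from one side of every pin to the other.
      refine cross_of_swap hca hca' (hPl _ x₁.1).2.1 ?_ ?_ ?_ ?_ hlτ.1.le
      · exact (memA c a).trans (hsup _ x₁ a).ge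
      · have h3 := memB c.opp a.opp
        have h4 := hsup' _ x₁ a.opp
        rw [Side.nrm_opp] at h3 h4
        simp only
        linarith
      · have h3 := hlt _ x₁ c hca
        have h4 := I.anchor_nrm_self (I.endA e) c
        simp only [clA] at h3
        simp only
        linarith
      · have h3 := hlt' _ x₁ c.opp (by intro h; apply hca; rw [← Side.opp_opp c, h, Side.opp_opp])
        have h4 := I.anchor_nrm_self (I.endB e) c.opp
        rw [Side.nrm_opp] at h3 h4
        simp only [clB] at h3
        simp only
        linarith
    · refine ⟨c, hc, .inl ⟨h, fun f hf => ?_, hh⟩⟩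
      subst h
      by_contra hcon
      push Not at hcon
      refine nocross f hf _ hτ ?_
      refine cross_of_swap hc.1 hc.2 (hPl _ hf.1).2.1 ?_ ?_ ?_ hcon hlτ.1.le
      · exact (memA c a).trans (hsup _ hf a).ge
      · have h3 := memB a.opp a.opp
        have h4 := hsup' _ hf a.opp
        rw [Side.nrm_opp] at h3 h4
        simp only
        linarith
      · have h3 := hlt _ hf c hc.1
        have h4 := I.anchor_nrm_self (I.endA e) c
        simp only [clA] at h3
        simp only
        linarith
    · refine ⟨c, hc, .inr ⟨h, fun f hf => ?_, hh⟩⟩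
      subst h
      by_contra hcon
      push Not at hcon
      refine nocross f hf _ hτ ?_
      refine Cross.swap_left (Cross.swap_right ?_)
      refine cross_of_swap (a := a.opp) hc.2 (by rw [Side.opp_opp]; exact hc.1)
        (hPl _ hf.1).2.2 ?_ ?_ ?_ hcon hlτ.2.le
      · exact (memB c a.opp).trans (hsup' _ hf a.opp).ge
      · have h3 := memA a a
        have h4 := hsup _ hf a
        rw [Side.nrm_opp, Side.nrm_opp]
        simp only
        linarith
      · have h3 := hlt' _ hf c hc.2
        have h4 := I.anchor_nrm_self (I.endB e) c
        simp only [clB] at h3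
        simp only
        linarith
  obtain ⟨c₂, hc₂, k₂⟩ := class' _ s₂ h12
  obtain ⟨c₃, hc₃, k₃⟩ := class' _ s₃ h13
  -- With the same `c`, the comparison of extents would make both survivors the same option.
  have hopp : c₃ = c₂.opp := by
    have hne : c₃ ≠ c₂ := by
      rintro rfl
      rcases k₂ with ⟨u, -, v⟩ | ⟨u, -, v⟩ <;> rcases k₃ with ⟨u', -, v'⟩ | ⟨u', -, v'⟩
      · exact h23 (u.trans u'.symm)
      · exact v.not_gt v'
      · exact v.not_gt v'
      · exact h23 (u.trans u'.symm)
    clear k₂ k₃ class' nocross s₁ hl hsep x₁ x₂ x₃ x₄ X hX t₁ t₂ t₃ t₄ h12 h13 hrange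
    revert hc₂ hc₃ hne
    cases a <;> cases c₂ <;> cases c₃ <;> decide
  have hXA : ∀ w, (∃ f, X f ∧ I.endA f = w) → I.cluster w = I.cluster (I.endA e) := by
    rintro w ⟨f, hf, rfl⟩; exact hf.2.1
  have hXB : ∀ w, (∃ f, X f ∧ I.endB f = w) → I.cluster w = I.cluster (I.endB e) := by
    rintro w ⟨f, hf, rfl⟩; exact hf.2.2
  -- both ends cannot be extreme
  have corner : ∀ c d : Side, (c ≠ a ∧ c ≠ a.opp) → (d ≠ a ∧ d ≠ a.opp) →
      (∀ f, X f → c.nrm (I.anchor (I.endB f) a.opp) ≤ c.nrm (I.anchor (I.endB e) a.opp)) →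
      (∀ f, X f → d.nrm (I.anchor (I.endA f) a) ≤ d.nrm (I.anchor (I.endA e) a)) → False := by
    intro c d hc hd hB hA
    have hA' := extreme_of_nrm hd.1 hd.2 hXA (by rintro w ⟨f, hf, rfl⟩; exact hA f hf)
    have hB' := extreme_of_nrm hc.2 (by rw [Side.opp_opp]; exact hc.1) hXB
      (by rintro w ⟨f, hf, rfl⟩; exact hB f hf)
    obtain ⟨σ, hσ⟩ := hC (e, (a, a.opp)) rfl he hrange
      (hA'.imp (fun h p hp t q => h _ ⟨_, hX p hp t q, rfl⟩)
        (fun h p hp t q => h _ ⟨_, hX p hp t q, rfl⟩))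
      (hB'.imp (fun h p hp t q => h _ ⟨_, hX p hp t q, rfl⟩)
        (fun h p hp t q => h _ ⟨_, hX p hp t q, rfl⟩))
    exact hpin σ hσ
  refine ⟨fun h => absurd h hey, fun _ _ hyi hs => ?_⟩
  have hlg := hy.1 hyi
  have comp : ∀ f, X f → Compat (f, (a, a.opp)) (y.1, y.2) := fun f hf => hy.2.1 _ hf.1
  -- If both survivors keep the same end on its facing side, that end is extreme in both directions,
  -- so all pins of this type share it and form a fan around `e`. In the mixed cases `e` is at a
  -- corner of the range, which `corner` rules out.
  rcases k₂ with ⟨-, k₂, -⟩ | ⟨-, k₂, -⟩ <;> rcases k₃ with ⟨-, k₃, -⟩ | ⟨-, k₃, -⟩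
  · have hB : ∀ f, X f → I.endB f = I.endB e := by
      intro f hf
      refine order_eq_of_nrm_eq hc₂.2 (by rw [Side.opp_opp]; exact hc₂.1) hf.2.2 ?_
      have e1 := k₂ f hf
      have e2 := k₃ f hf
      rw [hopp, Side.nrm_opp, Side.nrm_opp] at e2
      linarith
    exact not_cross_of_pins_endB hv he hyi hey hs hl hlg q₁ q₂ (comp _ x₁) (comp _ x₂) (hB _ x₁)
      (hB _ x₂) o₁ o₂
  · exact (corner _ _ hc₂ hc₃ k₂ k₃).elim
  · exact (corner _ _ hc₃ hc₂ k₃ k₂).elim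
  · have hA : ∀ f, X f → I.endA f = I.endA e := by
      intro f hf
      refine order_eq_of_nrm_eq hc₂.1 hc₂.2 hf.2.1 ?_
      have e1 := k₂ f hf
      have e2 := k₃ f hf
      rw [hopp, Side.nrm_opp, Side.nrm_opp] at e2
      linarith
    exact not_cross_of_pins_endA hv he hyi hey hs hl hlg q₃ q₄ (comp _ x₃) (comp _ x₄) (hA _ x₃)
      (hA _ x₄) o₃ o₄

end Instance
end NodeTrix
namespace NodeTrix

/-! ## Binary constraints with at most two values -/

section TwoValued

variable {Ω E : Type*} (edge : Ω → E) (R : Ω → Ω → Prop) (V : Ω → Prop)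

/-- Every other value of the variable of `y` is incompatible with `x`. -/
def Forces (x y : Ω) : Prop := V y ∧ ∀ z, V z → edge z = edge y → z ≠ y → ¬ R x z

/-- No contradiction follows from the value `o` by unit propagation. -/
def Good (o : Ω) : Prop :=
  V o ∧ ∀ x y, Relation.ReflTransGen (Forces edge R V) o x →
    Relation.ReflTransGen (Forces edge R V) o y → R x y

variable {edge R V}

/-- A value of the solution cannot exclude the solution's value at another variable, so everything
it forces belongs to the solution. -/
theorem good_of_solution {f : E → Ω} (hf : ∀ e, edge (f e) = e) (hV : ∀ e, V (f e))
    (hR : ∀ e e', R (f e) (f e')) (e : E) : Good edge R V (f e) := by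
  have key : ∀ x, Relation.ReflTransGen (Forces edge R V) (f e) x → ∃ e', x = f e' := by
    intro x hx
    induction hx with
    | refl => exact ⟨e, rfl⟩
    | tail _ h ih =>
      rename_i y z _
      obtain ⟨e', rfl⟩ := ih
      refine ⟨edge z, ?_⟩
      by_contra hne
      exact h.2 (f (edge z)) (hV _) (hf _) (Ne.symm hne) (hR _ _)
  refine ⟨hV e, fun x y hx hy => ?_⟩
  obtain ⟨e₁, rfl⟩ := key x hx
  obtain ⟨e₂, rfl⟩ := key y hy
  exact hR _ _

/-- A maximal consistent set `T` closed under forcing meets every variable. If it missed one, the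
closure of a good value of that variable could be added: with two values per variable, every
conflict with `T` can be traced back along the forcing chain to a value of the missed variable in
`T`. -/
theorem solution_of_good [Finite Ω] (hsymm : ∀ x y, R x y → R y x)
    (htwo : ∀ x y z, V x → V y → V z → edge x = edge y → edge x = edge z → x = y ∨ x = z ∨ y = z)
    (h : ∀ e, ∃ o, edge o = e ∧ Good edge R V o) :
    ∃ f : E → Ω, (∀ e, edge (f e) = e) ∧ (∀ e, V (f e)) ∧ ∀ e e', R (f e) (f e') := by
  let Cl : Set Ω → Prop := fun T => (∀ x ∈ T, V x) ∧ (∀ x ∈ T, ∀ y ∈ T, R x y) ∧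
    ∀ x ∈ T, ∀ y, Forces edge R V x y → y ∈ T
  obtain ⟨T, hT, hmax⟩ := (Set.toFinite {T : Set Ω | Cl T}).exists_maximal ⟨∅, by simp [Cl]⟩
  obtain ⟨hT1, hT2, hT3⟩ := hT
  have hit : ∀ e, ∃ x ∈ T, edge x = e := by
    intro e
    by_contra hno
    push Not at hno
    obtain ⟨o, ho, hgood⟩ := h e
    -- an option in conflict with `T` has a different value in `T`
    have conflict : ∀ x ∈ T, ∀ y, V y → ¬ R x y → ∃ z ∈ T, edge z = edge y ∧ z ≠ y := by
      intro x hx y hy hxy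
      by_cases hex : ∃ z, V z ∧ edge z = edge y ∧ z ≠ y
      · obtain ⟨z, hz, hzy, hne⟩ := hex
        refine ⟨z, hT3 x hx z ⟨hz, fun w hw hwz hwne => ?_⟩, hzy, hne⟩
        rcases htwo w z y hw hz hy hwz (hwz.trans hzy) with h' | h' | h'
        · exact absurd h' hwne
        · rw [h']; exact hxy
        · exact absurd h' hne
      -- Here `y` is the only value of its variable, so it is forced vacuously.
      · push Not at hex
        have : y ∈ T := hT3 x hx y ⟨hy, fun w hw hwy hne => absurd (hex w hw hwy) hne⟩
        exact absurd (hT2 x hx y this) hxy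
    have hMV : ∀ y, Relation.ReflTransGen (Forces edge R V) o y → V y := by
      intro y hy
      rcases Relation.ReflTransGen.cases_tail hy with h' | ⟨w, -, h'⟩
      · rw [h']; exact hgood.1
      · exact h'.1
    -- If `T` held another value at a forced variable, the forcing value would conflict with `T`, so
    -- `T` would hold another value one step earlier too. At the start `o` this is impossible.
    have nodiff : ∀ y, Relation.ReflTransGen (Forces edge R V) o y →
        ∀ z ∈ T, edge z = edge y → z = y := by
      intro y hy
      induction hy with
      | refl => intro z hz hzo; exact absurd (hzo.trans ho) (hno z hz)
      | tail hy h' ih =>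
        rename_i y y'
        intro z hz hzy
        by_contra hne
        have h1 : ¬ R y z := h'.2 z (hT1 z hz) hzy hne
        obtain ⟨w, hw, hwy, hwne⟩ := conflict z hz y (hMV y hy) fun h2 => h1 (hsymm _ _ h2)
        exact hwne (ih w hw hwy)
    have cross : ∀ x ∈ T, ∀ y, Relation.ReflTransGen (Forces edge R V) o y → R x y := by
      intro x hx y hy
      by_contra hxy
      obtain ⟨z, hz, hzy, hne⟩ := conflict x hx y (hMV y hy) hxy
      exact hne (nodiff y hy z hz hzy)
    have hcl : Cl (T ∪ {y | Relation.ReflTransGen (Forces edge R V) o y}) := by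
      refine ⟨?_, ?_, ?_⟩
      · rintro x (hx | hx)
        · exact hT1 x hx
        · exact hMV x hx
      · rintro x (hx | hx) y (hy | hy)
        · exact hT2 x hx y hy
        · exact cross x hx y hy
        · exact hsymm _ _ (cross y hy x hx)
        · exact hgood.2 x y hx hy
      · rintro x (hx | hx) y hxy
        · exact .inl (hT3 x hx y hxy)
        · exact .inr (Relation.ReflTransGen.tail hx hxy)
    have hoT : o ∈ T := hmax hcl (Set.subset_union_left) (.inr .refl)
    exact hno o hoT ho
  choose f hfT hf using hit
  exact ⟨f, hf, fun e => hT1 _ (hfT e), fun e e' => hT2 _ (hfT e) _ (hfT e')⟩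

end TwoValued

namespace Instance

variable {I : Instance}

/-! ## The pinned options of a solution -/

/-- Four edges are extreme among those with sides `τ`. Up to four more sit at the corners of the box
of extreme positions, whatever sides they have in `S`, because an edge between two clusters is
determined by its two positions. The last clause holds since an edge within the range that is
extreme in both orders is at a corner. -/
theorem exists_local_pins (S : Fin I.numE → Side × Side) (i j : Fin I.numC) (τ : Side × Side) :
    ∃ F : Finset (Fin I.numE), F.card ≤ 8 ∧
      (∀ f ∈ F, I.IsInter f ∧ I.clA f = i ∧ I.clB f = j) ∧
      (∀ e, I.IsInter e → I.clA e = i → I.clB e = j → S e = τ →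
        ((∃ f ∈ F, S f = τ ∧ I.order (I.endA f) ≤ I.order (I.endA e)) ∧
          ∃ f ∈ F, S f = τ ∧ I.order (I.endA e) ≤ I.order (I.endA f)) ∧
        (∃ f ∈ F, S f = τ ∧ I.order (I.endB f) ≤ I.order (I.endB e)) ∧
          ∃ f ∈ F, S f = τ ∧ I.order (I.endB e) ≤ I.order (I.endB f)) ∧
      ∀ e, I.IsInter e → I.clA e = i → I.clB e = j →
        (∃ f, I.IsInter f ∧ I.clA f = i ∧ I.clB f = j ∧ S f = τ ∧
          I.order (I.endA f) ≤ I.order (I.endA e)) →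
        (∃ f, I.IsInter f ∧ I.clA f = i ∧ I.clB f = j ∧ S f = τ ∧
          I.order (I.endA e) ≤ I.order (I.endA f)) →
        (∃ f, I.IsInter f ∧ I.clA f = i ∧ I.clB f = j ∧ S f = τ ∧
          I.order (I.endB f) ≤ I.order (I.endB e)) →
        (∃ f, I.IsInter f ∧ I.clA f = i ∧ I.clB f = j ∧ S f = τ ∧
          I.order (I.endB e) ≤ I.order (I.endB f)) →
        ((∀ f ∈ F, S f = τ → I.order (I.endA f) ≤ I.order (I.endA e)) ∨
          ∀ f ∈ F, S f = τ → I.order (I.endA e) ≤ I.order (I.endA f)) →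
        ((∀ f ∈ F, S f = τ → I.order (I.endB f) ≤ I.order (I.endB e)) ∨
          ∀ f ∈ F, S f = τ → I.order (I.endB e) ≤ I.order (I.endB f)) → e ∈ F := by
  classical
  let X : Finset (Fin I.numE) :=
    {e | I.IsInter e ∧ I.clA e = i ∧ I.clB e = j ∧ S e = τ}
  have memX : ∀ e, e ∈ X ↔ I.IsInter e ∧ I.clA e = i ∧ I.clB e = j ∧ S e = τ := by simp [X]
  by_cases hX : X.Nonempty
  · obtain ⟨e₁, h₁, m₁⟩ := X.exists_min_image (fun e => I.order (I.endA e)) hX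
    obtain ⟨e₂, h₂, m₂⟩ := X.exists_max_image (fun e => I.order (I.endA e)) hX
    obtain ⟨e₃, h₃, m₃⟩ := X.exists_min_image (fun e => I.order (I.endB e)) hX
    obtain ⟨e₄, h₄, m₄⟩ := X.exists_max_image (fun e => I.order (I.endB e)) hX
    let K : Finset (ℕ × ℕ) := {I.order (I.endA e₁), I.order (I.endA e₂)} ×ˢ
      {I.order (I.endB e₃), I.order (I.endB e₄)}
    let C : Finset (Fin I.numE) := {e | (I.IsInter e ∧ I.clA e = i ∧ I.clB e = j) ∧
      (I.order (I.endA e), I.order (I.endB e)) ∈ K}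
    have cardC : C.card ≤ 4 := by
      have h : C.card ≤ K.card := by
        apply Finset.card_le_card_of_injOn (fun e => (I.order (I.endA e), I.order (I.endB e)))
        · intro e he
          have he : e ∈ C := he
          simp only [C, Finset.mem_filter] at he
          exact he.2.2
        · intro e he f hf hef
          have he : e ∈ C := he
          have hf : f ∈ C := hf
          simp only [C, Finset.mem_filter] at he hf
          simp only [Prod.mk.injEq] at hef
          apply edge_eq
          rw [I.order_inj (he.2.1.2.1.trans hf.2.1.2.1.symm) hef.1,
            I.order_inj (he.2.1.2.2.trans hf.2.1.2.2.symm) hef.2]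
      refine h.trans ?_
      rw [Finset.card_product]
      exact Nat.mul_le_mul Finset.card_le_two Finset.card_le_two
    refine ⟨{e₁, e₂, e₃, e₄} ∪ C, ?_, ?_, ?_, ?_⟩
    · refine (Finset.card_union_le _ _).trans ?_
      have := Finset.card_le_four (a := e₁) (b := e₂) (c := e₃) (d := e₄)
      omega
    · intro f hf
      have hXi : ∀ e ∈ X, I.IsInter e ∧ I.clA e = i ∧ I.clB e = j := fun e he =>
        ⟨((memX e).1 he).1, ((memX e).1 he).2.1, ((memX e).1 he).2.2.1⟩
      simp only [Finset.mem_union, Finset.mem_insert, Finset.mem_singleton, C,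
        Finset.mem_filter] at hf
      rcases hf with (rfl | rfl | rfl | rfl) | hf
      · exact hXi _ h₁
      · exact hXi _ h₂
      · exact hXi _ h₃
      · exact hXi _ h₄
      · exact hf.2.1
    · intro e he hi hj hτ
      have hX' := (memX e).2 ⟨he, hi, hj, hτ⟩
      refine ⟨⟨⟨e₁, by simp, ((memX _).1 h₁).2.2.2, m₁ e hX'⟩,
        ⟨e₂, by simp, ((memX _).1 h₂).2.2.2, m₂ e hX'⟩⟩,
        ⟨e₃, by simp, ((memX _).1 h₃).2.2.2, m₃ e hX'⟩,
        ⟨e₄, by simp, ((memX _).1 h₄).2.2.2, m₄ e hX'⟩⟩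
    · rintro e he hi hj ⟨f₁, a1, a2, a3, a4, a5⟩ ⟨f₂, b1, b2, b3, b4, b5⟩ ⟨f₃, c1, c2, c3, c4, c5⟩
        ⟨f₄, d1, d2, d3, d4, d5⟩ hA hB
      have g₁ := (m₁ f₁ ((memX _).2 ⟨a1, a2, a3, a4⟩)).trans a5
      have g₂ := b5.trans (m₂ f₂ ((memX _).2 ⟨b1, b2, b3, b4⟩))
      have g₃ := (m₃ f₃ ((memX _).2 ⟨c1, c2, c3, c4⟩)).trans c5
      have g₄ := d5.trans (m₄ f₄ ((memX _).2 ⟨d1, d2, d3, d4⟩))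
      have kA : I.order (I.endA e) = I.order (I.endA e₁) ∨
          I.order (I.endA e) = I.order (I.endA e₂) := by
        rcases hA with hA | hA
        · right; exact le_antisymm g₂ (hA e₂ (by simp) ((memX _).1 h₂).2.2.2)
        · left; exact le_antisymm (hA e₁ (by simp) ((memX _).1 h₁).2.2.2) g₁
      have kB : I.order (I.endB e) = I.order (I.endB e₃) ∨
          I.order (I.endB e) = I.order (I.endB e₄) := by
        rcases hB with hB | hB
        · right; exact le_antisymm g₄ (hB e₄ (by simp) ((memX _).1 h₄).2.2.2)
        · left; exact le_antisymm (hB e₃ (by simp) ((memX _).1 h₃).2.2.2) g₃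
      apply Finset.mem_union_right
      simp only [C, K, Finset.mem_filter, Finset.mem_univ, true_and, Finset.mem_product,
        Finset.mem_insert, Finset.mem_singleton]
      exact ⟨⟨he, hi, hj⟩, kA, kB⟩
  · rw [Finset.not_nonempty_iff_eq_empty] at hX
    have hno : ∀ f, I.IsInter f → I.clA f = i → I.clB f = j → S f = τ → False := by
      intro f h1 h2 h3 h4
      have := (memX f).2 ⟨h1, h2, h3, h4⟩
      rw [hX] at this
      simp at this
    refine ⟨∅, by simp, by simp, fun e h1 h2 h3 h4 => (hno e h1 h2 h3 h4).elim, ?_⟩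
    rintro e - - - ⟨f, h1, h2, h3, h4, -⟩
    exact (hno f h1 h2 h3 h4).elim

instance : Fintype Side := ⟨{.top, .bottom, .left, .right}, by rintro (_ | _ | _ | _) <;> decide⟩

/-- The count is eight for each of `k²` pairs and four directions. Every pin carries the sides it
has in `S`, even if it was chosen as a corner for another direction; hence pins never conflict with
`S`, and `HasCorners` promises some sides only. -/
theorem exists_pins {S : Fin I.numE → Side × Side} (hS : I.Solution S) :
    ∃ P : Finset I.Opt, P.card ≤ 32 * (I.numC * I.numC) ∧
      (∀ p ∈ P, I.IsInter p.1 ∧ I.Legal p.1 p.2) ∧ HasCorners (P : Set I.Opt) ∧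
      (∀ e, I.IsInter e → Survives (P : Set I.Opt) (e, S e)) ∧ ∀ p ∈ P, p.2 = S p.1 := by
  classical
  choose F hF1 hF2 hF3 hF4 using fun x : (Fin I.numC × Fin I.numC) × Side =>
    exists_local_pins S x.1.1 x.1.2 (x.2, x.2.opp)
  let U : Finset (Fin I.numE) := Finset.univ.biUnion F
  let P : Finset I.Opt := U.image fun e => (e, S e)
  have memP : ∀ p : I.Opt, p ∈ P ↔ (∃ x, p.1 ∈ F x) ∧ p.2 = S p.1 := by
    rintro ⟨e, σ⟩
    simp only [P, U, Finset.mem_image, Finset.mem_biUnion, Finset.mem_univ, true_and,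
      Prod.mk.injEq]
    constructor
    · rintro ⟨f, hx, rfl, rfl⟩; exact ⟨hx, rfl⟩
    · rintro ⟨hx, rfl⟩; exact ⟨e, hx, rfl, rfl⟩
  have hcompat := ((solution_iff S).1 hS).2
  have hrange : ∀ (a : Side) (e : Fin I.numE), I.IsInter e → S e = (a, a.opp) →
      InRange (P : Set I.Opt) (e, S e) := by
    intro a e he hSe
    have lift : ∀ Q : Fin I.numE → Prop, (∃ f ∈ F ((I.clA e, I.clB e), a), S f = (a, a.opp) ∧ Q f) →
        ∃ p ∈ (P : Set I.Opt), p.2 = S e ∧ SamePair p.1 e ∧ Q p.1 := by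
      rintro Q ⟨f, hf, hSf, hq⟩
      obtain ⟨-, hi, hj⟩ := hF2 _ f hf
      exact ⟨(f, S f), Finset.mem_coe.2 ((memP _).2 ⟨⟨_, hf⟩, rfl⟩), hSf.trans hSe.symm, ⟨hi, hj⟩, hq⟩
    obtain ⟨⟨r1, r2⟩, r3, r4⟩ := hF3 ((I.clA e, I.clB e), a) e he rfl rfl hSe
    exact ⟨⟨lift _ r1, lift _ r2⟩, lift _ r3, lift _ r4⟩
  refine ⟨P, ?_, ?_, ?_, ?_, fun p hp => ((memP p).1 hp).2⟩
  · refine Finset.card_image_le.trans ((Finset.card_biUnion_le_card_mul _ _ 8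
      fun x _ => hF1 x).trans ?_)
    rw [Finset.card_univ, Fintype.card_prod, Fintype.card_prod, Fintype.card_fin]
    have : Fintype.card Side = 4 := rfl
    rw [this]; omega
  · rintro ⟨e, σ⟩ hp
    obtain ⟨⟨x, hx⟩, hσ⟩ := (memP _).1 hp
    simp only at hx hσ
    subst hσ
    have := (hF2 _ _ hx).1
    exact ⟨this, hS.1 _ this⟩
  · rintro ⟨e, τ⟩ hτ he hr hA hB
    obtain ⟨a, b⟩ := τ
    obtain rfl : b = a.opp := hτ
    obtain ⟨⟨⟨p₁, q₁, t₁, w₁, o₁⟩, ⟨p₂, q₂, t₂, w₂, o₂⟩⟩, ⟨p₃, q₃, t₃, w₃, o₃⟩, ⟨p₄, q₄, t₄, w₄, o₄⟩⟩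
      := hr
    have conv : ∀ (p : I.Opt), p ∈ (P : Set I.Opt) → p.2 = (a, a.opp) → SamePair p.1 e →
        I.IsInter p.1 ∧ I.clA p.1 = I.clA e ∧ I.clB p.1 = I.clB e ∧ S p.1 = (a, a.opp) := by
      intro p hp ht hs
      obtain ⟨⟨x, hx⟩, hσ⟩ := (memP _).1 (Finset.mem_coe.1 hp)
      exact ⟨(hF2 _ _ hx).1, hs.1, hs.2, hσ.symm.trans ht⟩
    have mem : ∀ f ∈ F ((I.clA e, I.clB e), a), S f = (a, a.opp) →
        (f, S f) ∈ (P : Set I.Opt) ∧ SamePair f e := by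
      intro f hf hSf
      obtain ⟨-, hi, hj⟩ := hF2 _ f hf
      exact ⟨Finset.mem_coe.2 ((memP _).2 ⟨⟨_, hf⟩, rfl⟩), hi, hj⟩
    have key : e ∈ F ((I.clA e, I.clB e), a) := by
      refine hF4 ((I.clA e, I.clB e), a) e he rfl rfl ?_ ?_ ?_ ?_ ?_ ?_
      · obtain ⟨c1, c2, c3, c4⟩ := conv p₁ q₁ t₁ w₁; exact ⟨_, c1, c2, c3, c4, o₁⟩
      · obtain ⟨c1, c2, c3, c4⟩ := conv p₂ q₂ t₂ w₂; exact ⟨_, c1, c2, c3, c4, o₂⟩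
      · obtain ⟨c1, c2, c3, c4⟩ := conv p₃ q₃ t₃ w₃; exact ⟨_, c1, c2, c3, c4, o₃⟩
      · obtain ⟨c1, c2, c3, c4⟩ := conv p₄ q₄ t₄ w₄; exact ⟨_, c1, c2, c3, c4, o₄⟩
      · exact hA.imp (fun h f hf hSf => h _ (mem f hf hSf).1 hSf (mem f hf hSf).2)
          (fun h f hf hSf => h _ (mem f hf hSf).1 hSf (mem f hf hSf).2)
      · exact hB.imp (fun h f hf hSf => h _ (mem f hf hSf).1 hSf (mem f hf hSf).2)
          (fun h f hf hSf => h _ (mem f hf hSf).1 hSf (mem f hf hSf).2)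
    exact ⟨S e, Finset.mem_coe.2 ((memP _).2 ⟨⟨_, key⟩, rfl⟩)⟩
  · intro e he
    refine ⟨hS.1 e, ?_, ?_⟩
    · rintro ⟨f, σ⟩ hp
      obtain ⟨-, hσ⟩ := (memP _).1 (Finset.mem_coe.1 hp)
      simp only at hσ
      subst hσ
      exact hcompat f e
    · intro hopp
      exact hrange (S e).1 e he (Prod.ext rfl hopp)

/-! ## Numbering the options -/

end Instance

/-- The side with a given number. -/
def Side.ofNat : ℕ → Side
  | 0 => .top
  | 1 => .bottom
  | 2 => .left
  | _ => .right

/-- Exchange of rows and columns. -/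
def Side.flip : Side → Side
  | .top => .left
  | .bottom => .right
  | .left => .top
  | .right => .bottom

/-- The first component of the pair of sides with number `n < 16`. -/
def tyA (n : ℕ) : Side := Side.ofNat (n % 4)

/-- The second component of the pair of sides with number `n < 16`. -/
def tyB (n : ℕ) : Side :=
  match n / 4 with
  | 0 => (tyA n).opp
  | 1 => tyA n
  | 2 => (tyA n).flip
  | _ => (tyA n).flip.opp

theorem ty_inj : ∀ m < 16, ∀ n < 16, tyA m = tyA n → tyB m = tyB n → m = n := by decide

theorem ty_surj : ∀ s t : Side, ∃ n < 16, tyA n = s ∧ tyB n = t := by decide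

/-- Opposite pairs get the smallest numbers, so the first survivor of an edge has opposite sides as
soon as some survivor does. -/
theorem ty_opp_iff : ∀ n < 16, tyB n = (tyA n).opp ↔ n < 4 := by decide

namespace Instance

variable {I : Instance}

/-- The option with a given number. -/
def optOf (I : Instance) (o : Fin (16 * I.numE)) : I.Opt :=
  (⟨o / 16, by omega⟩, (tyA (o % 16), tyB (o % 16)))

theorem optOf_injective : Function.Injective (optOf I) := by
  intro x y h
  simp only [optOf, Prod.mk.injEq, Fin.mk.injEq] at h
  have := ty_inj _ (Nat.mod_lt x (by norm_num)) _ (Nat.mod_lt y (by norm_num)) h.2.1 h.2.2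
  ext
  omega

theorem optOf_surjective : Function.Surjective (optOf I) := by
  rintro ⟨e, s, t⟩
  obtain ⟨n, hn, h1, h2⟩ := ty_surj s t
  refine ⟨⟨16 * e + n, by omega⟩, ?_⟩
  have e1 : (16 * (e : ℕ) + n) / 16 = e := by omega
  have e2 : (16 * (e : ℕ) + n) % 16 = n := by omega
  simp [optOf, e1, e2, h1, h2]

/-- The number of the edge of an option. -/
def optEdge (I : Instance) (o : Fin (16 * I.numE)) : Fin I.numE := (optOf I o).1

/-- The arithmetic test for the compatibility of two options. -/
def CompatDet (x y : I.Opt) : Prop :=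
  (x.1 = y.1 → x.2 = y.2) ∧
    (x.1 ≠ y.1 → I.IsInter x.1 → I.IsInter y.1 → Share x.1 y.1 →
      ¬ CrossDet (I.anchor (I.endA x.1) x.2.1) (I.anchor (I.endB x.1) x.2.2)
        (I.anchor (I.endA y.1) y.2.1) (I.anchor (I.endB y.1) y.2.2))

/-- The arithmetic test for the survival of an option. -/
def SurvivesDet (P : Set I.Opt) (x : I.Opt) : Prop :=
  (I.IsInter x.1 → I.Legal x.1 x.2) ∧ (∀ p ∈ P, CompatDet p x) ∧
    (x.2.2 = x.2.1.opp → InRange P x)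

theorem Compat.det {x y : I.Opt} (h : Compat x y) : CompatDet x y :=
  ⟨h.1, fun h1 h2 h3 h4 h5 => h.2 h1 h2 h3 h4 h5.cross⟩

theorem CompatDet.compat (hv : I.Valid) {x y : I.Opt} (hx : I.IsInter x.1 → I.Legal x.1 x.2)
    (hy : I.IsInter y.1 → I.Legal y.1 y.2) (h : CompatDet x y) : Compat x y :=
  ⟨h.1, fun h1 h2 h3 h4 h5 => h.2 h1 h2 h3 h4
    (Cross.crossDet h5 (hv.det_ne_zero h2 h3 h1 (hx h2) (hy h3) h5))⟩

theorem CompatDet.symm {x y : I.Opt} (h : CompatDet x y) : CompatDet y x :=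
  ⟨fun e => (h.1 e.symm).symm, fun h1 h2 h3 h4 h5 => h.2 h1.symm h3 h2 h4.symm ⟨h5.2, h5.1⟩⟩

/-- For legal options of a valid instance crossings are never parallel, so the determinant test is
exact. Legality of `x` is itself part of survival. -/
theorem survivesDet_iff (hv : I.Valid) {P : Set I.Opt} (hP : ∀ p ∈ P, I.Legal p.1 p.2)
    (x : I.Opt) : SurvivesDet P x ↔ Survives P x := by
  refine and_congr_right fun hx => and_congr_left fun _ => forall₂_congr fun p hp => ?_
  exact ⟨CompatDet.compat hv (fun _ => hP p hp) hx, Compat.det⟩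

/-- Compatibility of options given by their numbers. -/
def OptCompat (I : Instance) (x y : Fin (16 * I.numE)) : Prop := CompatDet (optOf I x) (optOf I y)

/-- The first and the last surviving option of every edge. -/
def Chosen (Sv : Fin (16 * I.numE) → Prop) (o : Fin (16 * I.numE)) : Prop :=
  Sv o ∧ ((∀ x, x < o → optEdge I x = optEdge I o → ¬ Sv x) ∨
      ∀ x, o < x → optEdge I x = optEdge I o → ¬ Sv x)

/-- Soundness asks nothing of the pins: surviving options are legal, at most two per edge are
chosen, and two-valued constraints with good values are solvable. -/
theorem solution_of_guess (hv : I.Valid) {Sv : Fin (16 * I.numE) → Prop}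
    (hSv : ∀ o, Sv o → I.IsInter (optEdge I o) → I.Legal (optEdge I o) (optOf I o).2)
    (h : ∀ e, ∃ o, optEdge I o = e ∧ Good (optEdge I) (OptCompat I) (Chosen Sv) o) :
    ∃ S, I.Solution S := by
  have htwo : ∀ x y z, Chosen Sv x → Chosen Sv y → Chosen Sv z → optEdge I x = optEdge I y →
      optEdge I x = optEdge I z → x = y ∨ x = z ∨ y = z := by
    intro x y z hx hy hz hxy hxz
    by_contra hcon
    push Not at hcon
    obtain ⟨n1, n2, n3⟩ := hcon
    -- The middle one of three options would be neither the first nor the last survivor.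
    have mid : ∀ u v w : Fin (16 * I.numE), Chosen Sv u → Chosen Sv v → Chosen Sv w → u < v → v < w →
        optEdge I u = optEdge I v → optEdge I w = optEdge I v → False := by
      intro u v w hu hv hw huv hvw e1 e2
      rcases hv.2 with h' | h'
      · exact h' u huv e1 hu.1
      · exact h' w hvw e2 hw.1
    have e1 := hxy
    have e2 := hxz
    have e3 : optEdge I y = optEdge I z := hxy.symm.trans hxz
    rcases lt_or_gt_of_ne n1 with a | a <;> rcases lt_or_gt_of_ne n2 with b | b <;>
      rcases lt_or_gt_of_ne n3 with c | c
    · exact mid x y z hx hy hz a c e1 e3.symm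
    · exact mid x z y hx hz hy b c e2 e3
    · exact absurd (a.trans (c.trans b)) (lt_irrefl _)
    · exact mid z x y hz hx hy b a e2.symm e1.symm
    · exact mid y x z hy hx hz a b e1.symm e2.symm
    · exact absurd (a.trans (b.trans c)) (lt_irrefl _)
    · exact mid y z x hy hz hx c b e3 e2
    · exact mid z y x hz hy hx c a e3.symm e1
  obtain ⟨f, hf, hV, hR⟩ := solution_of_good (fun x y h => CompatDet.symm h) htwo h
  refine ⟨fun e => (optOf I (f e)).2, (solution_iff _).2 ⟨fun e he => ?_, fun e e' => ?_⟩⟩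
  · have := hSv _ (hV e).1
    rw [hf e] at this
    exact this he
  · have := CompatDet.compat hv (hSv _ (hV e).1) (hSv _ (hV e').1) (hR e e')
    rwa [show optOf I (f e) = (e, (optOf I (f e)).2) from Prod.ext (hf e) rfl,
      show optOf I (f e') = (e', (optOf I (f e')).2) from Prod.ext (hf e') rfl] at this

/-- Pin the extreme edges of the solution. Where its option is strictly between the first and the
last survivor, replace it by the first. By `compat_of_three` that one is compatible with every
survivor elsewhere, so all replacements can be made at once. -/
theorem guess_of_solution (hv : I.Valid) {S : Fin I.numE → Side × Side} (hS : I.Solution S) :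
    ∃ P : Finset I.Opt, P.card ≤ 32 * (I.numC * I.numC) ∧
      ∀ e, ∃ o, optEdge I o = e ∧
        Good (optEdge I) (OptCompat I)
          (Chosen fun o => SurvivesDet (P : Set I.Opt) (optOf I o)) o := by
  classical
  obtain ⟨P, hcard, hPl, hC, hsurv, hPS⟩ := exists_pins hS
  refine ⟨P, hcard, ?_⟩
  have hdet : (fun o => SurvivesDet (P : Set I.Opt) (optOf I o)) =
      fun o => Survives (P : Set I.Opt) (optOf I o) :=
    funext fun o => propext (survivesDet_iff hv (fun p hp => (hPl p hp).2) _)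
  rw [hdet]
  set Sv : Fin (16 * I.numE) → Prop := fun o => Survives (P : Set I.Opt) (optOf I o) with hSv
  -- Edges inside a cluster are variables too. A non-opposite pair survives for them without any
  -- range condition.
  let S' : Fin I.numE → Side × Side := fun e => if I.IsInter e then S e else (.top, .top)
  have hS'i : ∀ e, I.IsInter e → S' e = S e := fun e he => if_pos he
  have hcompat := ((solution_iff S).1 hS).2
  have hsurv' : ∀ e, Survives (P : Set I.Opt) (e, S' e) := by
    intro e
    by_cases he : I.IsInter e
    · rw [hS'i e he]; exact hsurv e he
    · have : S' e = (.top, .top) := if_neg he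
      rw [this]
      refine ⟨fun h => absurd h he, fun p hp => ⟨?_, fun _ _ h => absurd h he⟩, ?_⟩
      · intro h
        have := (hPl p hp).1
        rw [h] at this
        exact absurd this he
      · intro h; exact absurd (show Side.top = Side.top.opp from h) (by decide)
  have hcompat' : ∀ e e', e ≠ e' → Compat (e, S' e) (e', S' e') := by
    intro e e' hne
    refine ⟨fun h => absurd h hne, fun _ h1 h2 => ?_⟩
    have := (hcompat e e').2 hne h1 h2
    simp only [hS'i e h1, hS'i e' h2]
    exact this
  choose code hcode using fun x => optOf_surjective (I := I) x
  have hfirst : ∀ e, ∃ o, optEdge I o = e ∧ Survives (P : Set I.Opt) (optOf I o) ∧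
      ∀ x, x < o → optEdge I x = e → ¬ Survives (P : Set I.Opt) (optOf I x) := by
    intro e
    let Z : Finset (Fin (16 * I.numE)) :=
      {o | optEdge I o = e ∧ Survives (P : Set I.Opt) (optOf I o)}
    have hZ : Z.Nonempty := ⟨code (e, S' e), by
      rw [Finset.mem_filter, optEdge, hcode]
      exact ⟨Finset.mem_univ _, rfl, hsurv' e⟩⟩
    obtain ⟨o, ho, hmin⟩ := Z.exists_min_image id hZ
    simp only [Z, Finset.mem_filter, Finset.mem_univ, true_and] at ho hmin
    exact ⟨o, ho.1, ho.2, fun x hx hxe hs => absurd (hmin x ⟨hxe, hs⟩) (not_le.2 hx)⟩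
  choose first hf1 hf2 hf3 using hfirst
  let f : Fin I.numE → Fin (16 * I.numE) := fun e =>
    if Chosen Sv (code (e, S' e)) then code (e, S' e) else first e
  have hfe : ∀ e, optEdge I (f e) = e := by
    intro e
    simp only [f]
    split
    · simp [optEdge, hcode]
    · exact hf1 e
  have hfV : ∀ e, Chosen Sv (f e) := by
    intro e
    simp only [f]
    split
    · assumption
    · exact ⟨hf2 e, .inl fun x hx hxe => hf3 e x hx (hxe.trans (hf1 e))⟩
  -- a replaced option is compatible with all surviving options of other edges
  have hrep : ∀ e, ¬ Chosen Sv (code (e, S' e)) → ∀ y : I.Opt,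
      Survives (P : Set I.Opt) y → e ≠ y.1 → Compat (optOf I (first e)) y := by
    intro e hno y hy hey
    have he1 : (optOf I (first e)).1 = e := hf1 e
    by_cases he : I.IsInter e
    · have hcs : Survives (P : Set I.Opt) (optOf I (code (e, S' e))) := by
        rw [hcode]; exact hsurv' e
      have hce : optEdge I (code (e, S' e)) = e := by simp [optEdge, hcode]
      have hno' : ¬ ((∀ x, x < code (e, S' e) → optEdge I x = optEdge I (code (e, S' e)) →
          ¬ Survives (P : Set I.Opt) (optOf I x)) ∨
          ∀ x, code (e, S' e) < x → optEdge I x = optEdge I (code (e, S' e)) →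
            ¬ Survives (P : Set I.Opt) (optOf I x)) := fun h => hno ⟨hcs, h⟩
      push Not at hno'
      obtain ⟨⟨x, hx, hxe, hxs⟩, ⟨z, hz, hze, hzs⟩⟩ := hno'
      rw [hce] at hxe hze
      have hle : first e ≤ x := by
        by_contra hlt
        exact hf3 e x (not_le.1 hlt) hxe hxs
      have l1 : first e < code (e, S' e) := lt_of_le_of_lt hle hx
      have form : ∀ o, optEdge I o = e → optOf I o = (e, (optOf I o).2) := fun o ho =>
        Prod.ext ho rfl
      have s1 := hf2 e
      rw [form _ (hf1 e)] at s1
      rw [form _ hce] at hcs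
      rw [form _ hze] at hzs
      have ne : ∀ o o', optEdge I o = e → optEdge I o' = e → o < o' →
          (optOf I o).2 ≠ (optOf I o').2 := by
        intro o o' h1 h2 hlt heq
        exact hlt.ne (optOf_injective (Prod.ext (h1.trans h2.symm) heq))
      have n12 := ne _ _ (hf1 e) hce l1
      have n13 := ne _ _ (hf1 e) hze (l1.trans hz)
      have n23 := ne _ _ hce hze hz
      -- One of three survivors has opposite sides; by the numbering so does every earlier option of
      -- the edge, in particular the first survivor.
      have opp_lt : ∀ o o', optEdge I o = e → optEdge I o' = e → o ≤ o' →
          (optOf I o').2.2 = (optOf I o').2.1.opp → (optOf I o).2.2 = (optOf I o).2.1.opp := by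
        intro o o' h1 h2 hlt h3
        have h4 := (ty_opp_iff _ (Nat.mod_lt o' (by norm_num))).1 h3
        refine (ty_opp_iff _ (Nat.mod_lt o (by norm_num))).2 ?_
        have h5 : ((optEdge I o : Fin I.numE) : ℕ) = (optEdge I o' : Fin I.numE) := by rw [h1, h2]
        have h6 : (o : ℕ) / 16 = (o' : ℕ) / 16 := h5
        have h7 : (o : ℕ) ≤ o' := hlt
        omega
      have hopp : (optOf I (first e)).2.2 = (optOf I (first e)).2.1.opp := by
        rcases exists_opp_of_three hv he (s1.1 he) (hcs.1 he) (hzs.1 he) n12 n13 n23 with h | h | h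
        · exact h
        · exact opp_lt _ _ (hf1 e) hce l1.le h
        · exact opp_lt _ _ (hf1 e) hze (l1.trans hz).le h
      rw [form _ (hf1 e)]
      have hpair : (optOf I (first e)).2 =
          ((optOf I (first e)).2.1, (optOf I (first e)).2.1.opp) := Prod.ext rfl hopp
      rw [hpair] at s1 n12 n13 ⊢
      exact compat_of_three hv (fun p hp => hPl p hp) hC he s1 hcs hzs n12 n13 n23 hy hey
    · exact ⟨fun h => absurd (he1.symm.trans h) hey, fun _ h => absurd (he1 ▸ h) he⟩
  have hfR : ∀ e e', Compat (optOf I (f e)) (optOf I (f e')) := by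
    intro e e'
    by_cases hee : e = e'
    · subst hee
      exact ⟨fun _ => rfl, fun h => absurd rfl h⟩
    have hs := (hfV e).1
    have hs' := (hfV e').1
    by_cases h1 : Chosen Sv (code (e, S' e))
    · by_cases h2 : Chosen Sv (code (e', S' e'))
      · simp only [f, if_pos h1, if_pos h2, hcode]
        exact hcompat' e e' hee
      · have hfe' : f e' = first e' := if_neg h2
        rw [hfe']
        refine (hrep e' h2 _ hs ?_).symm
        rw [show (optOf I (f e)).1 = e from hfe e]
        exact fun h => hee h.symm
    · have hfe' : f e = first e := if_neg h1
      rw [hfe']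
      refine hrep e h1 _ hs' ?_
      rw [show (optOf I (f e')).1 = e' from hfe e']
      exact hee
  exact fun e => ⟨f e, hfe e, good_of_solution hfe hfV (fun e e' => (hfR e e').det) e⟩

end Instance
end NodeTrix
namespace NodeTrix

/-! ## A structured language on top of the machine -/

/-- The arrays of natural numbers an expression reads. -/
def NExpr.arrays : NExpr → List ℕ
  | const _ => []
  | get a i => a :: i.arrays
  | plus e₁ e₂ => e₁.arrays ++ e₂.arrays
  | minus e₁ e₂ => e₁.arrays ++ e₂.arrays

/-- The arrays of natural numbers an expression reads. -/
def RExpr.arrays : RExpr → List ℕ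
  | ofNat e => e.arrays
  | get _ i => i.arrays
  | plus e₁ e₂ => e₁.arrays ++ e₂.arrays
  | minus e₁ e₂ => e₁.arrays ++ e₂.arrays
  | times e₁ e₂ => e₁.arrays ++ e₂.arrays
  | quot e₁ e₂ => e₁.arrays ++ e₂.arrays

/-- The arrays of natural numbers a test reads. -/
def Test.arrays : Test → List ℕ
  | natLt e₁ e₂ => e₁.arrays ++ e₂.arrays
  | realLt e₁ e₂ => e₁.arrays ++ e₂.arrays
  | neg b => b.arrays
  | conj b₁ b₂ => b₁.arrays ++ b₂.arrays

/-- Formulas with quantifiers bounded by the cell `0` of an array. -/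
inductive Fml where
  | test (b : Test)
  | neg (φ : Fml)
  | conj (φ ψ : Fml)
  | all (v a : ℕ) (φ : Fml)

/-- The formula holds; the variable bound by a quantifier is the cell `0` of an array. -/
def Fml.Sat : Fml → Store → Prop
  | test b, s => b.Holds s
  | neg φ, s => ¬ φ.Sat s
  | conj φ ψ, s => φ.Sat s ∧ ψ.Sat s
  | all v a φ, s => ∀ i < s.nat a 0, φ.Sat (s.setNat v 0 i)

/-- The arrays of natural numbers a formula reads. -/
def Fml.arrays : Fml → List ℕ
  | test b => b.arrays
  | neg φ => φ.arrays
  | conj φ ψ => φ.arrays ++ ψ.arrays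
  | all _ a φ => a :: φ.arrays

/-- The array is available to structured programs. -/
def visible (a : ℕ) : Bool := a < 1000

/-- The array is reserved for the bounds of loops. -/
def isBound (a : ℕ) : Bool := 10 ≤ a && a < 20

/-- The formula uses the arrays properly. -/
def Fml.ok : Fml → Bool
  | test b => b.arrays.all visible
  | neg φ => φ.ok
  | conj φ ψ => φ.ok && ψ.ok
  | all v a φ => visible v && !isBound v && isBound a && φ.ok

/-- Statements; `forr v a p` executes `p` for `v = 0, 1, …`, up to the bound in the array `a`. -/
inductive Stmt where
  | setN (a : ℕ) (i e : NExpr)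
  | setR (a : ℕ) (i : NExpr) (e : RExpr)
  | seq (p q : Stmt)
  | ite (φ : Fml) (p q : Stmt)
  | forr (v a : ℕ) (p : Stmt)

/-- The store after `n` rounds of a loop. -/
def iter (f : Store → Store) (v : ℕ) (s : Store) : ℕ → Store
  | 0 => s
  | n + 1 => f ((iter f v s n).setNat v 0 n)

open Classical in
/-- The truth value of a proposition, as a number. -/
noncomputable def tv (p : Prop) : ℕ := if p then 1 else 0

theorem tv_pos {p : Prop} (h : p) : tv p = 1 := if_pos h

theorem tv_neg {p : Prop} (h : ¬ p) : tv p = 0 := if_neg h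

/-- Truncated subtraction realises conjunction; this is the update made by a compiled quantifier. -/
theorem tv_and (p q : Prop) : tv (p ∧ q) = tv p + tv q - 1 := by
  by_cases hp : p <;> by_cases hq : q <;> simp [tv, hp, hq]

open Classical in
/-- The effect of a statement. -/
noncomputable def Stmt.den : Stmt → Store → Store
  | setN a i e, s => s.setNat a (i.eval s) (e.eval s)
  | setR a i e, s => s.setReal a (i.eval s) (e.eval s)
  | seq p q, s => q.den (p.den s)
  | ite φ p q, s => if φ.Sat s then p.den s else q.den s
  | forr v a p, s => iter p.den v s (s.nat a 0)

/-- The arrays of natural numbers a statement changes. -/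
def Stmt.writes : Stmt → List ℕ
  | setN a _ _ => [a]
  | setR _ _ _ => []
  | seq p q => p.writes ++ q.writes
  | ite _ p q => p.writes ++ q.writes
  | forr v _ p => v :: p.writes

/-- The arrays of real numbers a statement changes. -/
def Stmt.rwrites : Stmt → List ℕ
  | setN _ _ _ => []
  | setR a _ _ => [a]
  | seq p q => p.rwrites ++ q.rwrites
  | ite _ p q => p.rwrites ++ q.rwrites
  | forr _ _ p => p.rwrites

/-- The statement uses the arrays properly. -/
def Stmt.ok : Stmt → Bool
  | setN a i e => visible a && !isBound a && i.arrays.all visible && e.arrays.all visible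
  | setR _ i e => i.arrays.all visible && e.arrays.all visible
  | seq p q => p.ok && q.ok
  | ite φ p q => φ.ok && p.ok && q.ok
  | forr v a p => visible v && !isBound v && isBound a && p.ok

/-! ### Frame properties -/

theorem NExpr.eval_congr {s s' : Store} (e : NExpr) (h : ∀ a ∈ e.arrays, s.nat a = s'.nat a) :
    e.eval s = e.eval s' := by
  induction e with
  | const n => rfl
  | get a i ih =>
    simp only [arrays, List.mem_cons, forall_eq_or_imp] at h
    simp only [eval, ih h.2, h.1]
  | plus e₁ e₂ h₁ h₂ | minus e₁ e₂ h₁ h₂ =>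
    simp only [arrays, List.mem_append] at h
    simp only [eval, h₁ fun a ha => h a (.inl ha), h₂ fun a ha => h a (.inr ha)]

theorem RExpr.eval_congr {s s' : Store} (e : RExpr) (h : ∀ a ∈ e.arrays, s.nat a = s'.nat a)
    (hr : s.real = s'.real) : e.eval s = e.eval s' := by
  induction e with
  | ofNat e => simp only [eval, e.eval_congr h]
  | get a i => simp only [eval, i.eval_congr h, hr]
  | plus e₁ e₂ h₁ h₂ | minus e₁ e₂ h₁ h₂ | times e₁ e₂ h₁ h₂ | quot e₁ e₂ h₁ h₂ =>
    simp only [arrays, List.mem_append] at h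
    simp only [eval, h₁ fun a ha => h a (.inl ha), h₂ fun a ha => h a (.inr ha)]

theorem Test.holds_congr {s s' : Store} (b : Test) (h : ∀ a ∈ b.arrays, s.nat a = s'.nat a)
    (hr : s.real = s'.real) : b.Holds s ↔ b.Holds s' := by
  induction b with
  | natLt e₁ e₂ =>
    simp only [arrays, List.mem_append] at h
    simp only [Holds, e₁.eval_congr fun a ha => h a (.inl ha),
      e₂.eval_congr fun a ha => h a (.inr ha)]
  | realLt e₁ e₂ =>
    simp only [arrays, List.mem_append] at h
    simp only [Holds, e₁.eval_congr (fun a ha => h a (.inl ha)) hr,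
      e₂.eval_congr (fun a ha => h a (.inr ha)) hr]
  | neg b ih => simp only [Holds, ih h]
  | conj b₁ b₂ h₁ h₂ =>
    simp only [arrays, List.mem_append] at h
    simp only [Holds, h₁ fun a ha => h a (.inl ha), h₂ fun a ha => h a (.inr ha)]

theorem Store.setNat_nat (s : Store) (a j n b i : ℕ) :
    (s.setNat a j n).nat b i = if b = a ∧ i = j then n else s.nat b i := by
  unfold Store.setNat
  by_cases hb : b = a
  · subst hb
    by_cases hi : i = j
    · subst hi; simp
    · simp [hi]
  · simp [hb]

theorem Store.setNat_nat_ne (s : Store) {a b : ℕ} (j n : ℕ) (h : b ≠ a) :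
    (s.setNat a j n).nat b = s.nat b := by
  unfold Store.setNat; simp [h]

theorem Store.setNat_real (s : Store) (a j n : ℕ) : (s.setNat a j n).real = s.real := rfl

theorem Store.setReal_nat (s : Store) (a j : ℕ) (x : ℝ) : (s.setReal a j x).nat = s.nat := rfl

theorem Store.setReal_real (s : Store) (a j : ℕ) (x : ℝ) (b i : ℕ) :
    (s.setReal a j x).real b i = if b = a ∧ i = j then x else s.real b i := by
  unfold Store.setReal
  by_cases hb : b = a
  · subst hb
    by_cases hi : i = j
    · subst hi; simp
    · simp [hi]
  · simp [hb]

theorem Store.setNat_congr {s s' : Store} {a b : ℕ} (j n : ℕ) (h : s.nat b = s'.nat b) :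
    (s.setNat a j n).nat b = (s'.setNat a j n).nat b := by
  funext i
  simp only [Store.setNat_nat, h]

theorem Fml.sat_congr (φ : Fml) : ∀ {s s' : Store}, (∀ a ∈ φ.arrays, s.nat a = s'.nat a) →
    s.real = s'.real → (φ.Sat s ↔ φ.Sat s') := by
  induction φ with
  | test b => intro s s' h hr; exact b.holds_congr h hr
  | neg φ ih => intro s s' h hr; exact not_congr (ih h hr)
  | conj φ ψ h₁ h₂ =>
    intro s s' h hr
    simp only [arrays, List.mem_append] at h
    exact and_congr (h₁ (fun a ha => h a (.inl ha)) hr) (h₂ (fun a ha => h a (.inr ha)) hr)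
  | all v a φ ih =>
    intro s s' h hr
    simp only [arrays, List.mem_cons, forall_eq_or_imp] at h
    simp only [Sat, h.1]
    exact forall₂_congr fun i _ => ih (fun b hb => Store.setNat_congr _ _ (h.2 b hb)) hr

theorem iter_nat {f : Store → Store} {v b : ℕ} (hv : b ≠ v) (hf : ∀ s, (f s).nat b = s.nat b)
    (s : Store) (n : ℕ) : (iter f v s n).nat b = s.nat b := by
  induction n with
  | zero => rfl
  | succ n ih => rw [iter, hf, Store.setNat_nat_ne _ _ _ hv, ih]

theorem iter_real {f : Store → Store} {v b : ℕ} (hf : ∀ s, (f s).real b = s.real b)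
    (s : Store) (n : ℕ) : (iter f v s n).real b = s.real b := by
  induction n with
  | zero => rfl
  | succ n ih => rw [iter, hf, Store.setNat_real, ih]

theorem Stmt.den_nat (p : Stmt) {b : ℕ} : b ∉ p.writes → ∀ s, (p.den s).nat b = s.nat b := by
  induction p with
  | setN a i e =>
    intro h s
    exact Store.setNat_nat_ne _ _ _ (by simpa [writes] using h)
  | setR a i e => intro _ s; rfl
  | seq p q h₁ h₂ =>
    intro h s
    simp only [writes, List.mem_append, not_or] at h
    rw [den, h₂ h.2, h₁ h.1]
  | ite φ p q h₁ h₂ =>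
    intro h s
    simp only [writes, List.mem_append, not_or] at h
    rw [den]
    split
    · exact h₁ h.1 s
    · exact h₂ h.2 s
  | forr v a p ih =>
    intro h s
    simp only [writes, List.mem_cons, not_or] at h
    exact iter_nat h.1 (ih h.2) _ _

theorem Stmt.den_real (p : Stmt) {b : ℕ} : b ∉ p.rwrites → ∀ s, (p.den s).real b = s.real b := by
  induction p with
  | setN a i e => intro _ s; rfl
  | setR a i e =>
    intro h s
    have : b ≠ a := by simpa [rwrites] using h
    funext i
    rw [den, Store.setReal_real, if_neg fun h' => this h'.1]
  | seq p q h₁ h₂ =>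
    intro h s
    simp only [rwrites, List.mem_append, not_or] at h
    rw [den, h₂ h.2, h₁ h.1]
  | ite φ p q h₁ h₂ =>
    intro h s
    simp only [rwrites, List.mem_append, not_or] at h
    rw [den]
    split
    · exact h₁ h.1 s
    · exact h₂ h.2 s
  | forr v a p ih => intro h s; exact iter_real (ih h) _ _

theorem Stmt.den_real_eq {p : Stmt} (h : p.rwrites = []) (s : Store) :
    (p.den s).real = s.real := by
  funext b
  exact p.den_real (by simp [h]) s

/-- The bounds survive every admissible statement. So a compiled loop, which rereads its bound in
each test, agrees with `iter`, and a common bound `B` persists. -/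
theorem Stmt.not_mem_writes {p : Stmt} (h : p.ok) {b : ℕ} (hb : isBound b) : b ∉ p.writes := by
  induction p with
  | setN a i e =>
    simp only [ok, Bool.and_eq_true, Bool.not_eq_true'] at h
    simp only [writes, List.mem_singleton]
    rintro rfl
    rw [h.1.1.2] at hb
    exact absurd hb (by simp)
  | setR a i e => simp [writes]
  | seq p q h₁ h₂ =>
    simp only [ok, Bool.and_eq_true] at h
    simp only [writes, List.mem_append, not_or]
    exact ⟨h₁ h.1, h₂ h.2⟩
  | ite φ p q h₁ h₂ =>
    simp only [ok, Bool.and_eq_true] at h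
    simp only [writes, List.mem_append, not_or]
    exact ⟨h₁ h.1.2, h₂ h.2⟩
  | forr v a p ih =>
    simp only [ok, Bool.and_eq_true, Bool.not_eq_true'] at h
    simp only [writes, List.mem_cons, not_or]
    refine ⟨?_, ih h.2⟩
    rintro rfl
    rw [h.1.1.2] at hb
    exact absurd hb (by simp)

/-! ### Compilation -/

/-- The body is executed for every value below the bound of a hidden counter. -/
def countLoop (r a : ℕ) (body : Prog) : Prog :=
  .seq (.setNat 1002 (.const r) (.const 0))
    (.loop (.natLt (.get 1002 (.const r)) (.get a (.const 0)))
      (.seq body (.setNat 1002 (.const r) (.plus (.get 1002 (.const r)) (.const 1)))))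

/-- A program that writes the truth value of the formula into the cell `r` of the array `1000`. -/
def Fml.comp : Fml → ℕ → Prog
  | test b, r =>
    .branch b (.setNat 1000 (.const r) (.const 1)) (.setNat 1000 (.const r) (.const 0))
  | neg φ, r =>
    .seq (φ.comp r) (.setNat 1000 (.const r) (.minus (.const 1) (.get 1000 (.const r))))
  | conj φ ψ, r =>
    .seq (φ.comp r) (.branch (.natLt (.const 0) (.get 1000 (.const r))) (ψ.comp r) .skip)
  | all v a φ, r =>
    .seq (.setNat 1001 (.const r) (.get v (.const 0)))
      (.seq (.setNat 1000 (.const r) (.const 1))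
        (.seq (countLoop r a
            (.seq (.setNat v (.const 0) (.get 1002 (.const r)))
              (.seq (φ.comp (r + 1))
                (.setNat 1000 (.const r) (.minus (.plus (.get 1000 (.const r))
                  (.get 1000 (.const (r + 1)))) (.const 1))))))
          (.setNat v (.const 0) (.get 1001 (.const r)))))

/-- The program of a statement inside `r` loops. -/
def Stmt.comp : Stmt → ℕ → Prog
  | setN a i e, _ => .setNat a i e
  | setR a i e, _ => .setReal a i e
  | seq p q, r => .seq (p.comp r) (q.comp r)
  | ite φ p q, r =>
    .seq (φ.comp r) (.branch (.natLt (.const 0) (.get 1000 (.const r))) (p.comp r) (q.comp r))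
  | forr v a p, r =>
    countLoop r a (.seq (.setNat v (.const 0) (.get 1002 (.const r))) (p.comp (r + 1)))

/-- A bound for the running time if all loop bounds are at most `B`. -/
def Fml.time (B : ℕ) : Fml → ℕ
  | test b => b.cost + 4
  | neg φ => φ.time B + 6
  | conj φ ψ => φ.time B + ψ.time B + 6
  | all _ _ φ => (φ.time B + 30) * (B + 1) + 20

/-- A bound for the running time if all loop bounds are at most `B`. -/
def Stmt.time (B : ℕ) : Stmt → ℕ
  | setN _ i e => i.cost + e.cost + 1
  | setR _ i e => i.cost + e.cost + 1
  | seq p q => p.time B + q.time B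
  | ite φ p q => φ.time B + p.time B + q.time B + 5
  | forr _ _ p => (p.time B + 30) * (B + 1) + 20

/-- The two stores agree on the visible part. -/
def Eqv (s s' : Store) : Prop := (∀ a, visible a → s.nat a = s'.nat a) ∧ s.real = s'.real

/-- The hidden cells of outer loops are unchanged. -/
def Keep (r : ℕ) (s s' : Store) : Prop :=
  ∀ a, visible a = false → ∀ j < r, s'.nat a j = s.nat a j

/-- All loop bounds are at most `B`. -/
def Bounded (B : ℕ) (s : Store) : Prop := ∀ a, isBound a → s.nat a 0 ≤ B

theorem Eqv.setNat {s s' : Store} (h : Eqv s s') (a j n : ℕ) :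
    Eqv (s.setNat a j n) (s'.setNat a j n) :=
  ⟨fun b hb => Store.setNat_congr _ _ (h.1 b hb), h.2⟩

theorem Eqv.hidden {s s' : Store} (h : Eqv s s') {a : ℕ} (ha : visible a = false) (j n : ℕ) :
    Eqv s (s'.setNat a j n) := by
  refine ⟨fun b hb => ?_, h.2⟩
  rw [Store.setNat_nat_ne _ _ _ (by rintro rfl; rw [ha] at hb; exact absurd hb (by simp))]
  exact h.1 b hb

theorem Eqv.neval {s s' : Store} (h : Eqv s s') {e : NExpr} (he : e.arrays.all visible) :
    e.eval s' = e.eval s :=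
  (e.eval_congr fun a ha => h.1 a (List.all_eq_true.1 he a ha)).symm

theorem Eqv.reval {s s' : Store} (h : Eqv s s') {e : RExpr} (he : e.arrays.all visible) :
    e.eval s' = e.eval s :=
  (e.eval_congr (fun a ha => h.1 a (List.all_eq_true.1 he a ha)) h.2).symm

theorem Keep.refl (r : ℕ) (s : Store) : Keep r s s := fun _ _ _ _ => rfl

theorem Keep.trans {r : ℕ} {s s' s'' : Store} (h : Keep r s s') (h' : Keep r s' s'') :
    Keep r s s'' := fun a ha j hj => (h' a ha j hj).trans (h a ha j hj)

theorem Keep.mono {r r' : ℕ} {s s' : Store} (h : Keep r' s s') (hr : r ≤ r') : Keep r s s' :=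
  fun a ha j hj => h a ha j (hj.trans_le hr)

theorem Keep.setNat {r : ℕ} {s s' : Store} (h : Keep r s s') (a : ℕ) {j : ℕ} (n : ℕ)
    (hj : visible a ∨ r ≤ j) : Keep r s (s'.setNat a j n) := by
  intro b hb i hi
  rw [Store.setNat_nat, if_neg, h b hb i hi]
  rintro ⟨rfl, rfl⟩
  rcases hj with hj | hj
  · rw [hb] at hj; exact absurd hj (by simp)
  · omega

theorem Bounded.setNat {B : ℕ} {s : Store} (h : Bounded B s) {v : ℕ} (hv : isBound v = false)
    (j n : ℕ) : Bounded B (s.setNat v j n) := by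
  intro a ha
  rw [Store.setNat_nat_ne _ _ _ (by rintro rfl; rw [hv] at ha; exact absurd ha (by simp))]
  exact h a ha

theorem Bounded.den {B : ℕ} {s : Store} (h : Bounded B s) {p : Stmt} (hp : p.ok) :
    Bounded B (p.den s) := by
  intro a ha
  rw [p.den_nat (Stmt.not_mem_writes hp ha)]
  exact h a ha

theorem visible_of_isBound {a : ℕ} (h : isBound a) : visible a := by
  simp only [isBound, visible, Bool.and_eq_true, decide_eq_true_eq] at *
  omega

/-- The counting loop preserves an invariant. -/
theorem exec_countLoop {r a n T : ℕ} {body : Prog} (Inv : ℕ → Store → Prop)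
    (hn : ∀ i s, Inv i s → s.nat a 0 = n) (hc : ∀ i s j, Inv i s → Inv i (s.setNat 1002 r j))
    (hb : ∀ i < n, ∀ s, Inv i s → s.nat 1002 r = i →
      ∃ t s', Exec body s t s' ∧ t ≤ T ∧ Inv (i + 1) s' ∧ s'.nat 1002 r = i)
    {s : Store} (hs : Inv 0 s) :
    ∃ t s', Exec (countLoop r a body) s t s' ∧ t ≤ (T + 12) * (n + 1) + 3 ∧ Inv n s' := by
  have key : ∀ m i, i + m = n → ∀ s, Inv i s → s.nat 1002 r = i →
      ∃ t s', Exec (.loop (.natLt (.get 1002 (.const r)) (.get a (.const 0)))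
        (.seq body (.setNat 1002 (.const r) (.plus (.get 1002 (.const r)) (.const 1))))) s t s' ∧
        t ≤ (T + 12) * (m + 1) ∧ Inv n s' := by
    intro m
    induction m with
    | zero =>
      intro i hi s hs hsi
      refine ⟨_, s, Exec.loopStop ?_, ?_, by simpa using hi ▸ hs⟩
      · simp [Test.Holds, NExpr.eval, hsi, hn i s hs, ← hi]
      · simp [Test.cost, NExpr.cost]
    | succ m ih =>
      intro i hi s hs hsi
      obtain ⟨t₁, s₁, h₁, ht₁, hi₁, hc₁⟩ := hb i (by omega) s hs hsi
      have hi₂ := hc (i + 1) s₁ (i + 1) hi₁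
      obtain ⟨t₂, s₂, h₂, ht₂, hi₃⟩ := ih (i + 1) (by omega) _ hi₂ (by simp [Store.setNat_nat])
      refine ⟨_, s₂, Exec.loopStep (t₂ := t₂) ?_ (Exec.seq h₁ (Exec.setNat _ _ _ _)) ?_, ?_, hi₃⟩
      · simp only [Test.Holds, NExpr.eval, hsi, hn i s hs]; omega
      · simp only [NExpr.eval, hc₁]; exact h₂
      · simp only [Test.cost, NExpr.cost]
        -- Each round costs six steps for the test and six for the counter, besides the body.
        have : (T + 12) * (m + 1 + 1) = (T + 12) * (m + 1) + (T + 12) := by ring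
        omega
  obtain ⟨t, s', h, ht, hi⟩ := key n 0 (by omega) (s.setNat 1002 r 0) (hc _ _ _ hs)
    (by simp [Store.setNat_nat])
  refine ⟨_, s', Exec.seq (t₂ := t) (Exec.setNat _ _ _ _) ?_, ?_, hi⟩
  · simpa only [NExpr.eval] using h
  · simp only [NExpr.cost]; omega

theorem hidden1000 : visible 1000 = false := by decide
theorem hidden1001 : visible 1001 = false := by decide
theorem hidden1002 : visible 1002 = false := by decide

/-- Here `v` is the ideal store and `s` the actual one, which agree on visible cells. A quantifier
overwrites its variable, so the old value is kept in a hidden cell and restored; hidden cells are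
indexed by the nesting level `r`, so inner evaluations leave the outer ones intact. -/
theorem Fml.exec {B : ℕ} (φ : Fml) : φ.ok → ∀ (r : ℕ) {v s : Store}, Bounded B v → Eqv v s →
    ∃ t s', Exec (φ.comp r) s t s' ∧ t ≤ φ.time B ∧ Eqv v s' ∧ Keep r s s' ∧
      s'.nat 1000 r = tv (φ.Sat v) := by
  induction φ with
  | test b =>
    intro hok r v s hB he
    have hb : b.Holds s ↔ b.Holds v :=
      (b.holds_congr (fun a ha => he.1 a (List.all_eq_true.1 hok a ha)) he.2).symm
    by_cases h : b.Holds v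
    · refine ⟨_, _, Exec.branchTrue (hb.2 h) (Exec.setNat _ _ _ _), ?_, he.hidden hidden1000 _ _,
        (Keep.refl r s).setNat _ _ (.inr le_rfl), ?_⟩
      · simp only [NExpr.cost, time]; omega
      · simp [Store.setNat_nat, NExpr.eval, Sat, tv, h]
    · refine ⟨_, _, Exec.branchFalse (fun h' => h (hb.1 h')) (Exec.setNat _ _ _ _), ?_,
        he.hidden hidden1000 _ _, (Keep.refl r s).setNat _ _ (.inr le_rfl), ?_⟩
      · simp only [NExpr.cost, time]; omega
      · simp [Store.setNat_nat, NExpr.eval, Sat, tv, h]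
  | neg φ ih =>
    intro hok r v s hB he
    obtain ⟨t, s₁, h₁, ht, he₁, hk, hr⟩ := ih hok r hB he
    refine ⟨_, _, Exec.seq h₁ (Exec.setNat _ _ _ _), ?_, he₁.hidden hidden1000 _ _,
      hk.setNat _ _ (.inr le_rfl), ?_⟩
    · simp only [NExpr.cost, time]; omega
    · simp only [Store.setNat_nat, NExpr.eval, Sat, hr]
      by_cases h : φ.Sat v <;> simp [tv, h]
  | conj φ ψ h₁ h₂ =>
    intro hok r v s hB he
    simp only [ok, Bool.and_eq_true] at hok
    obtain ⟨t, s₁, g₁, ht, he₁, hk, hr⟩ := h₁ hok.1 r hB he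
    by_cases h : φ.Sat v
    · obtain ⟨t₂, s₂, g₂, ht₂, he₂, hk₂, hr₂⟩ := h₂ hok.2 r hB he₁
      refine ⟨_, s₂, Exec.seq g₁ (Exec.branchTrue ?_ g₂), ?_, he₂, hk.trans hk₂, ?_⟩
      · simp [Test.Holds, NExpr.eval, hr, tv, h]
      · simp only [Test.cost, NExpr.cost, time]; omega
      · rw [hr₂, Sat, and_iff_right h]
    · refine ⟨_, s₁, Exec.seq g₁ (Exec.branchFalse ?_ (Exec.skip _)), ?_, he₁, hk, ?_⟩
      · simp [Test.Holds, NExpr.eval, hr, tv, h]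
      · simp only [Test.cost, NExpr.cost, time]; omega
      · simp [hr, Sat, tv, h]
  | all x a φ ih =>
    intro hok r v s hB he
    simp only [ok, Bool.and_eq_true, Bool.not_eq_true'] at hok
    obtain ⟨⟨⟨hx, hxb⟩, ha⟩, hφ⟩ := hok
    have hav := visible_of_isBound ha
    have hax : a ≠ x := by rintro rfl; rw [hxb] at ha; exact absurd ha (by simp)
    -- Up to the quantified variable the visible store is still `v`, and the result cell holds the
    -- conjunction of the first `i` instances.
    let Inv : ℕ → Store → Prop := fun i s' =>
      (∃ y, Eqv (v.setNat x 0 y) s') ∧ Keep r s s' ∧ s'.nat 1001 r = v.nat x 0 ∧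
        s'.nat 1000 r = tv (∀ j < i, φ.Sat (v.setNat x 0 j))
    have hself : Eqv (v.setNat x 0 (v.nat x 0)) s := by
      refine ⟨fun b hb => ?_, he.2⟩
      rw [← he.1 b hb]
      funext i
      rw [Store.setNat_nat]
      split
      · rename_i h'; rw [h'.1, h'.2]
      · rfl
    have h0 : Inv 0 ((s.setNat 1001 r (v.nat x 0)).setNat 1000 r 1) := by
      refine ⟨⟨_, (hself.hidden hidden1001 _ _).hidden hidden1000 _ _⟩,
        ((Keep.refl r s).setNat _ _ (.inr le_rfl)).setNat _ _ (.inr le_rfl), ?_, ?_⟩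
      · simp [Store.setNat_nat]
      · simp [Store.setNat_nat, tv]
    have hloop := exec_countLoop (r := r) (a := a) (n := v.nat a 0) (T := φ.time B + 14)
      (body := (.seq (.setNat x (.const 0) (.get 1002 (.const r)))
              (.seq (φ.comp (r + 1))
                (.setNat 1000 (.const r) (.minus (.plus (.get 1000 (.const r))
                  (.get 1000 (.const (r + 1)))) (.const 1))))))
      Inv ?_ ?_ ?_ h0
    · obtain ⟨t, s₁, h₁, ht, ⟨y, hy⟩, hk, h1, h2⟩ := hloop
      refine ⟨_, _, Exec.seq (Exec.setNat _ _ _ _) (Exec.seq (Exec.setNat _ _ _ _)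
        (Exec.seq (t₁ := t) ?_ (Exec.setNat _ _ _ _))), ?_, ?_, hk.setNat x _ (.inl hx), ?_⟩
      · simp only [NExpr.eval]; rw [← he.1 x hx]; exact h₁
      · simp only [NExpr.cost, time]
        have h3 : v.nat a 0 ≤ B := hB a ha
        have h4 : (φ.time B + 14 + 12) * (v.nat a 0 + 1) ≤ (φ.time B + 30) * (B + 1) :=
          Nat.mul_le_mul (by omega) (by omega)
        omega
      · simp only [NExpr.eval, h1]
        refine ⟨fun b hb => ?_, he.2.trans (he.2.symm.trans hy.2)⟩
        funext i
        have := congrFun (hy.1 b hb) i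
        rw [Store.setNat_nat] at this ⊢
        split
        · rename_i h'; rw [h'.1, h'.2]
        · rename_i h'; rw [if_neg h'] at this; exact this
      · rw [Store.setNat_nat_ne _ _ _ (by rintro rfl; exact absurd hx (by decide)), h2]
        rfl
    · rintro i s' ⟨⟨y, hy⟩, -⟩
      rw [← hy.1 a hav, Store.setNat_nat_ne _ _ _ hax]
    · rintro i s' j ⟨⟨y, hy⟩, hk, h1, h2⟩
      refine ⟨⟨y, hy.hidden hidden1002 _ _⟩, hk.setNat _ _ (.inr le_rfl), ?_, ?_⟩
      · rw [Store.setNat_nat_ne _ _ _ (by decide), h1]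
      · rw [Store.setNat_nat_ne _ _ _ (by decide), h2]
    · rintro i hi s' ⟨⟨y, hy⟩, hk, h1, h2⟩ hsi
      have hyi : Eqv (v.setNat x 0 i) (s'.setNat x 0 i) := by
        refine ⟨fun b hb => ?_, hy.2⟩
        funext j
        have := congrFun (hy.1 b hb) j
        simp only [Store.setNat_nat] at this ⊢
        split
        · rfl
        · rename_i h'; rw [if_neg h'] at this; exact this
      obtain ⟨t, s₁, g, ht, he₁, hk₁, hr₁⟩ := ih hφ (r + 1) (hB.setNat hxb 0 i) hyi
      have hx0 : 1000 ≠ x := by rintro rfl; exact absurd hx (by decide)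
      have hx1 : 1001 ≠ x := by rintro rfl; exact absurd hx (by decide)
      have hx2 : 1002 ≠ x := by rintro rfl; exact absurd hx (by decide)
      have k0 : s₁.nat 1000 r = s'.nat 1000 r := by
        rw [hk₁ 1000 hidden1000 r (by omega), Store.setNat_nat_ne _ _ _ hx0]
      have k1 : s₁.nat 1001 r = s'.nat 1001 r := by
        rw [hk₁ 1001 hidden1001 r (by omega), Store.setNat_nat_ne _ _ _ hx1]
      have k2 : s₁.nat 1002 r = s'.nat 1002 r := by
        rw [hk₁ 1002 hidden1002 r (by omega), Store.setNat_nat_ne _ _ _ hx2]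
      refine ⟨_, _, Exec.seq (Exec.setNat _ _ _ _) (Exec.seq (t₁ := t) ?_ (Exec.setNat _ _ _ _)), ?_,
        ⟨⟨i, he₁.hidden hidden1000 _ _⟩, ?_, ?_, ?_⟩, ?_⟩
      · simp only [NExpr.eval, hsi]; exact g
      · simp only [NExpr.cost]; omega
      · exact ((hk.setNat x (j := 0) i (.inl hx)).trans (hk₁.mono (by omega))).setNat _ _
          (.inr le_rfl)
      · rw [Store.setNat_nat_ne _ _ _ (by decide), k1, h1]
      · rw [Store.setNat_nat, if_pos ⟨rfl, rfl⟩]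
        simp only [NExpr.eval, k0, hr₁, h2]
        have : (∀ j < i + 1, φ.Sat (v.setNat x 0 j)) ↔
            (∀ j < i, φ.Sat (v.setNat x 0 j)) ∧ φ.Sat (v.setNat x 0 i) := by
          constructor
          · exact fun h => ⟨fun j hj => h j (by omega), h i (by omega)⟩
          · rintro ⟨h, h'⟩ j hj
            rcases Nat.lt_succ_iff_lt_or_eq.1 hj with h'' | rfl
            · exact h j h''
            · exact h'
        rw [propext this, tv_and]
      · rw [Store.setNat_nat_ne _ _ _ (by decide), k2, hsi]

/-- The denotation is simulated on visible cells. For a loop the invariant is agreement with `iter`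
after each round, and the hidden counter, not the visible variable, controls termination. -/
theorem Stmt.exec {B : ℕ} (p : Stmt) : p.ok → ∀ (r : ℕ) {v s : Store}, Bounded B v → Eqv v s →
    ∃ t s', Exec (p.comp r) s t s' ∧ t ≤ p.time B ∧ Eqv (p.den v) s' ∧ Keep r s s' := by
  induction p with
  | setN a i e =>
    intro hok r v s hB he
    simp only [ok, Bool.and_eq_true, Bool.not_eq_true'] at hok
    refine ⟨_, _, Exec.setNat _ _ _ _, le_rfl, ?_, (Keep.refl r s).setNat _ _ (.inl hok.1.1.1)⟩
    rw [he.neval hok.1.2, he.neval hok.2]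
    exact he.setNat _ _ _
  | setR a i e =>
    intro hok r v s hB he
    simp only [ok, Bool.and_eq_true] at hok
    refine ⟨_, _, Exec.setReal _ _ _ _, le_rfl, ⟨he.1, ?_⟩, Keep.refl r s⟩
    rw [he.neval hok.1, he.reval hok.2]
    simp only [den, Store.setReal, he.2]
  | seq p q h₁ h₂ =>
    intro hok r v s hB he
    simp only [ok, Bool.and_eq_true] at hok
    obtain ⟨t₁, s₁, g₁, ht₁, he₁, hk₁⟩ := h₁ hok.1 r hB he
    obtain ⟨t₂, s₂, g₂, ht₂, he₂, hk₂⟩ := h₂ hok.2 r (hB.den hok.1) he₁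
    exact ⟨_, s₂, Exec.seq g₁ g₂, Nat.add_le_add ht₁ ht₂, he₂, hk₁.trans hk₂⟩
  | ite φ p q h₁ h₂ =>
    intro hok r v s hB he
    simp only [ok, Bool.and_eq_true] at hok
    obtain ⟨t, s', g, ht, he', hk, hr⟩ := φ.exec hok.1.1 r hB he
    by_cases h : φ.Sat v
    · obtain ⟨t₁, s₁, g₁, ht₁, he₁, hk₁⟩ := h₁ hok.1.2 r hB he'
      refine ⟨_, s₁, Exec.seq g (Exec.branchTrue ?_ g₁), ?_, ?_, hk.trans hk₁⟩
      · simp [Test.Holds, NExpr.eval, hr, tv, h]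
      · simp only [Test.cost, NExpr.cost, time]; omega
      · rw [den, if_pos h]; exact he₁
    · obtain ⟨t₁, s₁, g₁, ht₁, he₁, hk₁⟩ := h₂ hok.2 r hB he'
      refine ⟨_, s₁, Exec.seq g (Exec.branchFalse ?_ g₁), ?_, ?_, hk.trans hk₁⟩
      · simp [Test.Holds, NExpr.eval, hr, tv, h]
      · simp only [Test.cost, NExpr.cost, time]; omega
      · rw [den, if_neg h]; exact he₁
  | forr x a p ih =>
    intro hok r v s hB he
    simp only [ok, Bool.and_eq_true, Bool.not_eq_true'] at hok
    obtain ⟨⟨⟨hx, hxb⟩, ha⟩, hp⟩ := hok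
    have hav := visible_of_isBound ha
    have hax : a ≠ x := by rintro rfl; rw [hxb] at ha; exact absurd ha (by simp)
    have hfr : ∀ i, (iter p.den x v i).nat a = v.nat a := fun i =>
      iter_nat hax (p.den_nat (not_mem_writes hp ha)) _ _
    have hbd : ∀ i, Bounded B (iter p.den x v i) := by
      intro i b hb
      have hbx : b ≠ x := by rintro rfl; rw [hxb] at hb; exact absurd hb (by simp)
      rw [iter_nat hbx (p.den_nat (not_mem_writes hp hb))]
      exact hB b hb
    have hloop := exec_countLoop (r := r) (a := a) (n := v.nat a 0) (T := p.time B + 5)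
      (body := .seq (.setNat x (.const 0) (.get 1002 (.const r))) (p.comp (r + 1)))
      (fun i s' => Eqv (iter p.den x v i) s' ∧ Keep r s s') ?_ ?_ ?_ ⟨he, Keep.refl r s⟩
    · obtain ⟨t, s₁, h₁, ht, h2, h3⟩ := hloop
      refine ⟨t, s₁, h₁, ?_, h2, h3⟩
      have h3 : v.nat a 0 ≤ B := hB a ha
      have h4 : (p.time B + 5 + 12) * (v.nat a 0 + 1) ≤ (p.time B + 30) * (B + 1) :=
        Nat.mul_le_mul (by omega) (by omega)
      simp only [time]
      omega
    · rintro i s' ⟨h, -⟩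
      rw [← h.1 a hav, hfr]
    · rintro i s' j ⟨h, hk⟩
      exact ⟨h.hidden hidden1002 _ _, hk.setNat _ _ (.inr le_rfl)⟩
    · rintro i hi s' ⟨h, hk⟩ hsi
      obtain ⟨t, s₁, g, ht, he₁, hk₁⟩ := ih hp (r + 1) ((hbd i).setNat hxb 0 i) (h.setNat x 0 i)
      have hx2 : 1002 ≠ x := by rintro rfl; exact absurd hx (by decide)
      refine ⟨_, s₁, Exec.seq (t₂ := t) (Exec.setNat _ _ _ _) ?_, ?_, ⟨he₁, ?_⟩, ?_⟩
      · simp only [NExpr.eval, hsi]; exact g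
      · simp only [NExpr.cost]; omega
      · exact (hk.setNat x (j := 0) i (.inl hx)).trans (hk₁.mono (by omega))
      · rw [hk₁ 1002 hidden1002 r (by omega), Store.setNat_nat_ne _ _ _ hx2, hsi]

/-! ### Polynomial bounds -/

/-- The function is bounded by a polynomial. -/
def PolyBdd (f : ℕ → ℕ) : Prop := ∃ C q, ∀ B, f B ≤ C * (B + 1) ^ q

theorem PolyBdd.const (n : ℕ) : PolyBdd fun _ => n := ⟨n, 0, fun _ => by simp⟩

theorem PolyBdd.add {f g : ℕ → ℕ} (hf : PolyBdd f) (hg : PolyBdd g) :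
    PolyBdd fun B => f B + g B := by
  obtain ⟨C, q, hf⟩ := hf
  obtain ⟨C', q', hg⟩ := hg
  refine ⟨C + C', max q q', fun B => ?_⟩
  have h1 : (B + 1) ^ q ≤ (B + 1) ^ max q q' := Nat.pow_le_pow_right (by omega) (le_max_left _ _)
  have h2 : (B + 1) ^ q' ≤ (B + 1) ^ max q q' := Nat.pow_le_pow_right (by omega) (le_max_right _ _)
  rw [add_mul]
  exact Nat.add_le_add ((hf B).trans (Nat.mul_le_mul_left _ h1))
    ((hg B).trans (Nat.mul_le_mul_left _ h2))

theorem PolyBdd.mul_succ {f : ℕ → ℕ} (hf : PolyBdd f) : PolyBdd fun B => f B * (B + 1) := by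
  obtain ⟨C, q, hf⟩ := hf
  refine ⟨C, q + 1, fun B => ?_⟩
  rw [pow_succ, ← mul_assoc]
  exact Nat.mul_le_mul_right _ (hf B)

theorem Fml.polyBdd_time (φ : Fml) : PolyBdd fun B => φ.time B := by
  induction φ with
  | test b => exact PolyBdd.const _
  | neg φ ih => exact ih.add (.const 6)
  | conj φ ψ h₁ h₂ => exact (h₁.add h₂).add (.const 6)
  | all v a φ ih => exact ((ih.add (.const 30)).mul_succ).add (.const 20)

/-- Each loop or quantifier contributes one factor `B + 1`, so the degree is limited by the nesting
depth of the program text. -/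
theorem Stmt.polyBdd_time (p : Stmt) : PolyBdd fun B => p.time B := by
  induction p with
  | setN a i e => exact PolyBdd.const _
  | setR a i e => exact PolyBdd.const _
  | seq p q h₁ h₂ => exact h₁.add h₂
  | ite φ p q h₁ h₂ => exact ((φ.polyBdd_time.add h₁).add h₂).add (.const 5)
  | forr v a p ih => exact ((ih.add (.const 30)).mul_succ).add (.const 20)

end NodeTrix
namespace NodeTrix

/-! ## Intersections of squares and pipes -/

/-- A system of linear inequalities in one variable is feasible if and only if it is satisfied by
the bound given by one of the inequalities. -/
theorem exists_forall_mul_le_iff {L : List (ℝ × ℝ)} (h : ((-1 : ℝ), (0 : ℝ)) ∈ L) :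
    (∃ t : ℝ, ∀ c ∈ L, c.1 * t ≤ c.2) ↔ ∃ c ∈ L, ∀ d ∈ L, d.1 * (c.2 / c.1) ≤ d.2 := by
  classical
  constructor
  · rintro ⟨t, ht⟩
    -- Negative coefficients give the lower bounds on `t`. The inequality `(-1, 0)` makes this
    -- family nonempty, and its largest bound satisfies the system.
    let F : Finset (ℝ × ℝ) := L.toFinset.filter fun c => c.1 < 0
    have hF : F.Nonempty := ⟨(-1, 0), by simp [F, h]⟩
    obtain ⟨c, hc, hmax⟩ := F.exists_max_image (fun c => c.2 / c.1) hF
    simp only [F, Finset.mem_filter, List.mem_toFinset] at hc hmax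
    refine ⟨c, hc.1, fun d hd => ?_⟩
    by_cases hd0 : d.1 < 0
    · have := hmax d ⟨hd, hd0⟩
      rw [div_le_iff_of_neg hd0] at this
      linarith
    · have h1 : c.2 / c.1 ≤ t := by
        rw [div_le_iff_of_neg hc.2]
        linarith [ht c hc.1]
      calc d.1 * (c.2 / c.1) ≤ d.1 * t := mul_le_mul_of_nonneg_left h1 (not_lt.1 hd0)
        _ ≤ d.2 := ht d hd
  -- Any value that satisfies the system is a witness, so the quotient is harmless even if `c.1 =
  -- 0`.
  · rintro ⟨c, -, hc⟩
    exact ⟨_, hc⟩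

/-- Two axis-parallel boxes, given by their extents in the four directions, have a common point. -/
theorem exists_box_iff {a b : Side → ℝ} (ha : ∀ s, 0 ≤ a s + a s.opp)
    (hb : ∀ s, 0 ≤ b s + b s.opp) :
    (∃ z : ℝ × ℝ, ∀ s : Side, s.nrm z ≤ a s ∧ s.nrm z ≤ b s) ↔ ∀ s : Side, 0 ≤ a s + b s.opp := by
  constructor
  · rintro ⟨z, hz⟩ s
    have h1 := (hz s).1
    have h2 := (hz s.opp).2
    rw [Side.nrm_opp] at h2
    linarith
  · intro h
    refine ⟨(min (a .right) (b .right), min (a .top) (b .top)), ?_⟩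
    have h1 := h .top
    have h2 := h .bottom
    have h3 := h .left
    have h4 := h .right
    have a1 := ha .top
    have a2 := ha .right
    have b1 := hb .top
    have b2 := hb .right
    simp only [Side.opp] at *
    intro s
    cases s <;> simp only [Side.nrm]
    · exact ⟨min_le_left _ _, min_le_right _ _⟩
    · constructor <;> rw [neg_le] <;> refine le_min ?_ ?_ <;> linarith
    · constructor <;> rw [neg_le] <;> refine le_min ?_ ?_ <;> linarith
    · exact ⟨min_le_left _ _, min_le_right _ _⟩

theorem Square.sup_add_sup_opp (Q : Square) (s : Side) : Q.sup s + Q.sup s.opp = Q.side := by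
  cases s <;> simp [Square.sup, Side.opp]

theorem Square.disjoint_iff (Q R : Square) :
    Disjoint Q.toSet R.toSet ↔ ∃ s : Side, Q.sup s + R.sup s.opp < 0 := by
  rw [← not_iff_not, Set.not_disjoint_iff]
  push Not
  rw [← exists_box_iff (fun s => by rw [Q.sup_add_sup_opp]; exact Q.side_pos.le)
    (fun s => by rw [R.sup_add_sup_opp]; exact R.side_pos.le)]
  simp only [Square.mem_toSet_iff, forall_and]

/-- The square between two squares. -/
def Square.interp (Q R : Square) (t : ℝ) (s : Side) : ℝ := (1 - t) * Q.sup s + t * R.sup s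

/-- The hull of two convex sets is the union of the segments joining them. Weighted averages stay in
the interpolated square, and averages of points in equal relative position fill it. -/
theorem Square.mem_hull_iff (Q R : Square) (z : ℝ × ℝ) :
    z ∈ convexHull ℝ (Q.toSet ∪ R.toSet) ↔
      ∃ t : ℝ, 0 ≤ t ∧ t ≤ 1 ∧ ∀ s : Side, s.nrm z ≤ Q.interp R t s := by
  have conv : ∀ T : Square, Convex ℝ T.toSet := fun T => (convex_Icc _ _).prod (convex_Icc _ _)
  have ne : ∀ T : Square, T.toSet.Nonempty := fun T =>
    ⟨(T.x, T.y), ⟨⟨le_rfl, by linarith [T.side_pos]⟩, le_rfl, by linarith [T.side_pos]⟩⟩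
  rw [Convex.convexHull_union (conv Q) (conv R) (ne Q) (ne R), mem_convexJoin]
  constructor
  · rintro ⟨a, ha, b, hb, u, t, hu, ht, hut, rfl⟩
    refine ⟨t, ht, by linarith, fun s => ?_⟩
    have h1 := (Q.mem_toSet_iff a).1 ha s
    have h2 := (R.mem_toSet_iff b).1 hb s
    obtain rfl : u = 1 - t := by linarith
    have h3 : s.nrm ((1 - t) • a + t • b) = (1 - t) * s.nrm a + t * s.nrm b := by
      cases s <;> simp [Side.nrm] <;> ring
    rw [h3, Square.interp]
    exact add_le_add (mul_le_mul_of_nonneg_left h1 hu) (mul_le_mul_of_nonneg_left h2 ht)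
  · rintro ⟨t, h0, h1, hz⟩
    have hw : 0 < (1 - t) * Q.side + t * R.side := by
      rcases h0.eq_or_lt with rfl | h0
      · simpa using Q.side_pos
      · exact add_pos_of_nonneg_of_pos (mul_nonneg (by linarith) Q.side_pos.le)
          (mul_pos h0 R.side_pos)
    set w := (1 - t) * Q.side + t * R.side with hwdef
    have e1 := hz .top
    have e2 := hz .bottom
    have e3 := hz .left
    have e4 := hz .right
    simp only [Side.nrm, Square.interp, Square.sup] at e1 e2 e3 e4
    -- The relative coordinates of `z` in the interpolated square; they select the two points to be
    -- averaged.
    set u := (z.1 - ((1 - t) * Q.x + t * R.x)) / w with hu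
    set v := (z.2 - ((1 - t) * Q.y + t * R.y)) / w with hv
    have u0 : 0 ≤ u := div_nonneg (by linarith) hw.le
    have u1 : u ≤ 1 := (div_le_one hw).2 (by rw [hwdef]; linarith)
    have v0 : 0 ≤ v := div_nonneg (by linarith) hw.le
    have v1 : v ≤ 1 := (div_le_one hw).2 (by rw [hwdef]; linarith)
    have hz1 : z.1 = (1 - t) * Q.x + t * R.x + u * w := by rw [hu]; field_simp; ring
    have hz2 : z.2 = (1 - t) * Q.y + t * R.y + v * w := by rw [hv]; field_simp; ring
    have mem : ∀ T : Square, (T.x + u * T.side, T.y + v * T.side) ∈ T.toSet := by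
      intro T
      have := T.side_pos
      refine ⟨⟨?_, ?_⟩, ?_, ?_⟩ <;> simp only <;> nlinarith
    refine ⟨_, mem Q, _, mem R, 1 - t, t, by linarith, h0, by ring, ?_⟩
    ext
    · simp only [Prod.smul_mk, smul_eq_mul, Prod.mk_add_mk]
      rw [hz1, hwdef]; ring
    · simp only [Prod.smul_mk, smul_eq_mul, Prod.mk_add_mk]
      rw [hz2, hwdef]; ring

/-- The four sides. -/
def Side.all : List Side := [.top, .bottom, .left, .right]

theorem Side.mem_all (s : Side) : s ∈ Side.all := by cases s <;> decide

/-- The inequalities satisfied by the parameters of the squares between `Q` and `R` that meet `C`. -/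
def meetSystem (Q R C : Square) : List (ℝ × ℝ) :=
  (-1, 0) :: (1, 1) :: Side.all.map fun s => (Q.sup s - R.sup s, Q.sup s + C.sup s.opp)

/-- The interpolated square meets `C` when it overlaps it in each of the four directions, and these
conditions are linear in the parameter. What remains is a system in one variable, testable with
finitely many arithmetic operations. -/
theorem not_disjoint_hull_iff (Q R C : Square) :
    ¬ Disjoint (convexHull ℝ (Q.toSet ∪ R.toSet)) C.toSet ↔
      ∃ c ∈ meetSystem Q R C, ∀ d ∈ meetSystem Q R C, d.1 * (c.2 / c.1) ≤ d.2 := by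
  rw [← exists_forall_mul_le_iff (by simp [meetSystem]), Set.not_disjoint_iff]
  have hC : ∀ s, 0 ≤ C.sup s + C.sup s.opp := fun s => by
    rw [C.sup_add_sup_opp]; exact C.side_pos.le
  have hQR : ∀ t : ℝ, 0 ≤ t → t ≤ 1 → ∀ s, 0 ≤ Q.interp R t s + Q.interp R t s.opp := by
    intro t h0 h1 s
    have e : Q.interp R t s + Q.interp R t s.opp = (1 - t) * Q.side + t * R.side := by
      rw [← Q.sup_add_sup_opp s, ← R.sup_add_sup_opp s]; simp only [Square.interp]; ring
    rw [e]
    exact add_nonneg (mul_nonneg (by linarith) Q.side_pos.le) (mul_nonneg h0 R.side_pos.le)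
  have sys : ∀ t : ℝ, (∀ c ∈ meetSystem Q R C, c.1 * t ≤ c.2) ↔
      0 ≤ t ∧ t ≤ 1 ∧ ∀ s : Side, 0 ≤ Q.interp R t s + C.sup s.opp := by
    intro t
    simp only [meetSystem, List.mem_cons, List.mem_map, forall_eq_or_imp, forall_exists_index,
      and_imp, forall_apply_eq_imp_iff₂]
    refine and_congr (by constructor <;> intro h <;> linarith)
      (and_congr (by constructor <;> intro h <;> linarith) ?_)
    refine forall_congr' fun s => ?_
    simp only [Side.mem_all, forall_const, Square.interp]
    constructor <;> intro h <;> linarith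
  simp only [sys]
  constructor
  · rintro ⟨z, hz, hzC⟩
    obtain ⟨t, h0, h1, h⟩ := (Q.mem_hull_iff R z).1 hz
    exact ⟨t, h0, h1, (exists_box_iff (hQR t h0 h1) hC).1
      ⟨z, fun s => ⟨h s, (C.mem_toSet_iff z).1 hzC s⟩⟩⟩
  · rintro ⟨t, h0, h1, h⟩
    obtain ⟨z, hz⟩ := (exists_box_iff (hQR t h0 h1) hC).2 h
    exact ⟨z, (Q.mem_hull_iff R z).2 ⟨t, h0, h1, fun s => (hz s).1⟩,
      (C.mem_toSet_iff z).2 fun s => (hz s).2⟩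

namespace Instance

variable {I : Instance}

/-- Adjacent pairs are enumerated by the inter-cluster edges that witness them. -/
theorem valid_iff : I.Valid ↔
    (∀ i j, i ≠ j → ∃ s : Side, (I.square i).sup s + (I.square j).sup s.opp < 0) ∧
      ∀ e, I.IsInter e → ∀ k, k ≠ I.clA e → k ≠ I.clB e →
        ¬ ∃ c ∈ meetSystem (I.square (I.clA e)) (I.square (I.clB e)) (I.square k),
          ∀ d ∈ meetSystem (I.square (I.clA e)) (I.square (I.clB e)) (I.square k),
            d.1 * (c.2 / c.1) ≤ d.2 := by
  simp only [← not_disjoint_hull_iff, not_not, ← Square.disjoint_iff]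
  constructor
  · exact fun h => ⟨h.disjoint, fun e he k h1 h2 => h.pipe_disjoint _ _ he.adjacent k h1 h2⟩
  · rintro ⟨h1, h2⟩
    refine ⟨h1, ?_⟩
    rintro i j ⟨hij, e, hi, hj⟩ k hki hkj
    rw [incident_iff] at hi hj
    have hinter : I.IsInter e ∧ I.pipe i j = I.pipe (I.clA e) (I.clB e) ∧
        k ≠ I.clA e ∧ k ≠ I.clB e := by
      have hne : I.clA e ≠ I.clB e → I.IsInter e := by
        intro h
        unfold IsInter
        rcases ends_cases e with ⟨g1, g2⟩ | ⟨g1, g2⟩ <;> rw [clA, clB, g1, g2] at h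
        · exact h
        · exact h.symm
      rcases hi with rfl | rfl <;> rcases hj with rfl | rfl
      · exact absurd rfl hij
      · exact ⟨hne hij, rfl, hki, hkj⟩
      · exact ⟨hne hij.symm, pipe_comm _ _, hkj, hki⟩
      · exact absurd rfl hij
    rw [hinter.2.1]
    exact h2 e hinter.1 k hinter.2.2.1 hinter.2.2.2

end Instance
end NodeTrix
namespace NodeTrix

/-! ## Formulas -/

namespace Fml

/-- Comparison of natural numbers. -/
def lt (e₁ e₂ : NExpr) : Fml := .test (.natLt e₁ e₂)

/-- Comparison of natural numbers. -/
def le (e₁ e₂ : NExpr) : Fml := .neg (lt e₂ e₁)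

/-- Equality of natural numbers. -/
def eq (e₁ e₂ : NExpr) : Fml := .conj (le e₁ e₂) (le e₂ e₁)

/-- Comparison of real numbers. -/
def rlt (e₁ e₂ : RExpr) : Fml := .test (.realLt e₁ e₂)

/-- Disjunction. -/
def disj (φ ψ : Fml) : Fml := .neg (.conj (.neg φ) (.neg ψ))

/-- Implication. -/
def imp (φ ψ : Fml) : Fml := .neg (.conj φ (.neg ψ))

/-- Bounded existential quantification. -/
def ex (v a : ℕ) (φ : Fml) : Fml := .neg (.all v a (.neg φ))

/-- The conjunction of a list. -/
def allL : List Fml → Fml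
  | [] => le (.const 0) (.const 0)
  | φ :: L => .conj φ (allL L)

/-- The disjunction of a list. -/
def exL (L : List Fml) : Fml := .neg (allL (L.map .neg))

variable {s : Store}

@[simp] theorem sat_lt {e₁ e₂ : NExpr} : (lt e₁ e₂).Sat s ↔ e₁.eval s < e₂.eval s := Iff.rfl

@[simp] theorem sat_le {e₁ e₂ : NExpr} : (le e₁ e₂).Sat s ↔ e₁.eval s ≤ e₂.eval s := not_lt

@[simp] theorem sat_eq {e₁ e₂ : NExpr} : (eq e₁ e₂).Sat s ↔ e₁.eval s = e₂.eval s := by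
  simp only [eq, Sat, sat_le]; omega

@[simp] theorem sat_rlt {e₁ e₂ : RExpr} : (rlt e₁ e₂).Sat s ↔ e₁.eval s < e₂.eval s := Iff.rfl

@[simp] theorem sat_neg {φ : Fml} : (Fml.neg φ).Sat s ↔ ¬ φ.Sat s := Iff.rfl

@[simp] theorem sat_conj {φ ψ : Fml} : (Fml.conj φ ψ).Sat s ↔ φ.Sat s ∧ ψ.Sat s := Iff.rfl

@[simp] theorem sat_disj {φ ψ : Fml} : (disj φ ψ).Sat s ↔ φ.Sat s ∨ ψ.Sat s := by
  simp only [disj, Sat]; tauto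

@[simp] theorem sat_imp {φ ψ : Fml} : (imp φ ψ).Sat s ↔ (φ.Sat s → ψ.Sat s) := by
  simp only [imp, Sat]; tauto

@[simp] theorem sat_all {v a : ℕ} {φ : Fml} :
    (Fml.all v a φ).Sat s ↔ ∀ i < s.nat a 0, φ.Sat (s.setNat v 0 i) := Iff.rfl

@[simp] theorem sat_ex {v a : ℕ} {φ : Fml} :
    (ex v a φ).Sat s ↔ ∃ i < s.nat a 0, φ.Sat (s.setNat v 0 i) := by
  simp only [ex, Sat]; push Not; rfl

@[simp] theorem sat_allL {L : List Fml} : (allL L).Sat s ↔ ∀ φ ∈ L, φ.Sat s := by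
  induction L with
  | nil => simp [allL]
  | cons φ L ih => simp [allL, ih]

@[simp] theorem sat_exL {L : List Fml} : (exL L).Sat s ↔ ∃ φ ∈ L, φ.Sat s := by
  simp [exL]

end Fml

/-! ## The tables -/

/-- The value of a scalar variable. -/
abbrev NExpr.var (a : ℕ) : NExpr := .get a (.const 0)

/-- The real number zero. -/
abbrev RExpr.zero : RExpr := .ofNat (.const 0)

/-- The extent of the square of the cluster `c` in a direction. -/
def supE (c : NExpr) : Side → RExpr
  | .top => .plus (.get 1 c) (.get 2 c)
  | .bottom => .minus .zero (.get 1 c)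
  | .left => .minus .zero (.get 0 c)
  | .right => .plus (.get 0 c) (.get 2 c)

/-- The distance of the column (row) of the vertex `v` from the left (top) side. -/
def offsetE (v : NExpr) : RExpr :=
  .times (.minus (.ofNat (.get 3 v)) (.quot (.ofNat (.const 1)) (.ofNat (.const 2))))
    (.quot (.get 2 (.get 2 v)) (.ofNat (.get 1 (.get 2 v))))

/-- The first coordinate of an anchor. -/
def anchorX (v : NExpr) : Side → RExpr
  | .top => .plus (.get 0 (.get 2 v)) (offsetE v)
  | .bottom => .plus (.get 0 (.get 2 v)) (offsetE v)
  | .left => .get 0 (.get 2 v)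
  | .right => .plus (.get 0 (.get 2 v)) (.get 2 (.get 2 v))

/-- The second coordinate of an anchor. -/
def anchorY (v : NExpr) : Side → RExpr
  | .top => .plus (.get 1 (.get 2 v)) (.get 2 (.get 2 v))
  | .bottom => .get 1 (.get 2 v)
  | .left => .minus (.plus (.get 1 (.get 2 v)) (.get 2 (.get 2 v))) (offsetE v)
  | .right => .minus (.plus (.get 1 (.get 2 v)) (.get 2 (.get 2 v))) (offsetE v)

/-- The input and the loop bounds. -/
structure Base (I : Instance) (s : Store) : Prop where
  nat : ∀ a < 6, s.nat a = I.input.nat a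
  real : ∀ a < 3, s.real a = I.input.real a
  n10 : s.nat 10 0 = I.numE
  n11 : s.nat 11 0 = I.numC
  n12 : s.nat 12 0 = 16 * I.numE
  n13 : s.nat 13 0 = 32 * (I.numC * I.numC)

/-- The arrays that hold the input and the loop bounds. -/
def baseArrays : List ℕ := [0, 1, 2, 3, 4, 5, 10, 11, 12, 13]

theorem Base.congr {I : Instance} {s s' : Store} (h : Base I s)
    (hn : ∀ a ∈ baseArrays, s'.nat a = s.nat a) (hr : ∀ a < 3, s'.real a = s.real a) :
    Base I s' where
  nat a ha := by rw [hn a (by interval_cases a <;> decide), h.nat a ha]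
  real a ha := by rw [hr a ha, h.real a ha]
  n10 := by rw [hn 10 (by decide), h.n10]
  n11 := by rw [hn 11 (by decide), h.n11]
  n12 := by rw [hn 12 (by decide), h.n12]
  n13 := by rw [hn 13 (by decide), h.n13]

theorem Base.setNat {I : Instance} {s : Store} (h : Base I s) {v : ℕ} (hv : v ∉ baseArrays)
    (j n : ℕ) : Base I (s.setNat v j n) :=
  h.congr (fun a ha => Store.setNat_nat_ne _ _ _ (by rintro rfl; exact hv ha)) fun _ _ => rfl

namespace Base

variable {I : Instance} {s : Store}

theorem size (h : Base I s) (c : Fin I.numC) : s.nat 1 c = I.size c := by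
  rw [h.nat 1 (by norm_num)]; simp [Instance.input]

theorem cluster (h : Base I s) (v : Fin I.numV) : s.nat 2 v = I.cluster v := by
  rw [h.nat 2 (by norm_num)]; simp [Instance.input]

theorem order (h : Base I s) (v : Fin I.numV) : s.nat 3 v = I.order v := by
  rw [h.nat 3 (by norm_num)]; simp [Instance.input]

theorem fst (h : Base I s) (e : Fin I.numE) : s.nat 4 e = I.fst e := by
  rw [h.nat 4 (by norm_num)]; simp [Instance.input]

theorem snd (h : Base I s) (e : Fin I.numE) : s.nat 5 e = I.snd e := by
  rw [h.nat 5 (by norm_num)]; simp [Instance.input]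

theorem x (h : Base I s) (c : Fin I.numC) : s.real 0 c = (I.square c).x := by
  rw [h.real 0 (by norm_num)]; simp [Instance.input]

theorem y (h : Base I s) (c : Fin I.numC) : s.real 1 c = (I.square c).y := by
  rw [h.real 1 (by norm_num)]; simp [Instance.input]

theorem side (h : Base I s) (c : Fin I.numC) : s.real 2 c = (I.square c).side := by
  rw [h.real 2 (by norm_num)]; simp [Instance.input]

theorem sup (h : Base I s) {e : NExpr} {c : Fin I.numC} (he : e.eval s = c) (d : Side) :
    (supE e d).eval s = (I.square c).sup d := by
  cases d <;> simp [supE, RExpr.eval, NExpr.eval, he, h.x, h.y, h.side, Square.sup]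

theorem anchor_fst (h : Base I s) {e : NExpr} {v : Fin I.numV} (he : e.eval s = v) (d : Side) :
    (anchorX e d).eval s = (I.anchor v d).1 := by
  cases d <;> simp [anchorX, offsetE, RExpr.eval, NExpr.eval, he, h.x, h.side, h.size, h.cluster,
    h.order, Instance.anchor]

theorem anchor_snd (h : Base I s) {e : NExpr} {v : Fin I.numV} (he : e.eval s = v) (d : Side) :
    (anchorY e d).eval s = (I.anchor v d).2 := by
  cases d <;> simp [anchorY, offsetE, RExpr.eval, NExpr.eval, he, h.y, h.side, h.size, h.cluster,
    h.order, Instance.anchor]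

end Base

/-- A case distinction on the value of an expression. -/
def Stmt.cases (e : NExpr) (p : ℕ → Stmt) : ℕ → Stmt
  | 0 => p 0
  | n + 1 => .ite (.eq e (.const (n + 1))) (p (n + 1)) (Stmt.cases e p n)

theorem Stmt.den_cases {e : NExpr} {p : ℕ → Stmt} {s : Store} {n : ℕ} (h : e.eval s ≤ n) :
    (Stmt.cases e p n).den s = (p (e.eval s)).den s := by
  induction n with
  | zero => rw [Nat.le_zero.1 h]; rfl
  | succ n ih =>
    simp only [Stmt.cases, Stmt.den, Fml.sat_eq, NExpr.eval]
    split
    · rename_i h'; rw [h']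
    · exact ih (by omega)

/-- Writes the coordinates of the anchors of the option `o` of type `n`. -/
def anchorStmt (o : NExpr) (n : ℕ) : Stmt :=
  .seq (.setR 3 o (anchorX (.get 21 o) (tyA n)))
    (.seq (.setR 4 o (anchorY (.get 21 o) (tyA n)))
      (.seq (.setR 5 o (anchorX (.get 22 o) (tyB n))) (.setR 6 o (anchorY (.get 22 o) (tyB n)))))

/-- Writes the edge, the type and the end-vertices of the option `o`. -/
def edgeStmt (o : NExpr) : Stmt :=
  .seq (.setN 20 o (.var 24))
    (.seq (.setN 23 o (.var 25))
      (.ite (.lt (.get 2 (.get 4 (.var 24))) (.get 2 (.get 5 (.var 24))))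
        (.seq (.setN 21 o (.get 4 (.var 24))) (.setN 22 o (.get 5 (.var 24))))
        (.seq (.setN 21 o (.get 5 (.var 24))) (.setN 22 o (.get 4 (.var 24))))))

/-- Computes the quotient and the remainder of the next number modulo `16`. -/
def stepStmt : Stmt :=
  .ite (.eq (.var 25) (.const 15))
    (.seq (.setN 25 (.const 0) (.const 0)) (.setN 24 (.const 0) (.plus (.var 24) (.const 1))))
    (.setN 25 (.const 0) (.plus (.var 25) (.const 1)))

/-- Computes the tables of the options. -/
def tableStmt : Stmt :=
  .seq (.setN 24 (.const 0) (.const 0)) (.seq (.setN 25 (.const 0) (.const 0))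
    (.forr 40 12 (.seq (edgeStmt (.var 40))
      (.seq (Stmt.cases (.get 23 (.var 40)) (anchorStmt (.var 40)) 15) stepStmt))))

/-- The tables of one option. -/
structure OptRow (I : Instance) (s : Store) (o : Fin (16 * I.numE)) : Prop where
  edge : s.nat 20 o = o / 16
  endA : s.nat 21 o = I.endA (Instance.optEdge I o)
  endB : s.nat 22 o = I.endB (Instance.optEdge I o)
  type : s.nat 23 o = o % 16
  ax : s.real 3 o = (I.anchor (I.endA (Instance.optEdge I o)) (Instance.optOf I o).2.1).1
  ay : s.real 4 o = (I.anchor (I.endA (Instance.optEdge I o)) (Instance.optOf I o).2.1).2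
  bx : s.real 5 o = (I.anchor (I.endB (Instance.optEdge I o)) (Instance.optOf I o).2.2).1
  bY : s.real 6 o = (I.anchor (I.endB (Instance.optEdge I o)) (Instance.optOf I o).2.2).2

/-- The input, the loop bounds and the tables of the options. -/
structure Tab (I : Instance) (s : Store) : Prop extends Base I s where
  row : ∀ o, OptRow I s o

theorem OptRow.congr {I : Instance} {s s' : Store} {o : Fin (16 * I.numE)} (h : OptRow I s o)
    (hn : ∀ a ∈ [20, 21, 22, 23], s'.nat a o = s.nat a o)
    (hr : ∀ a ∈ [3, 4, 5, 6], s'.real a o = s.real a o) : OptRow I s' o where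
  edge := by rw [hn 20 (by decide), h.edge]
  endA := by rw [hn 21 (by decide), h.endA]
  endB := by rw [hn 22 (by decide), h.endB]
  type := by rw [hn 23 (by decide), h.type]
  ax := by rw [hr 3 (by decide), h.ax]
  ay := by rw [hr 4 (by decide), h.ay]
  bx := by rw [hr 5 (by decide), h.bx]
  bY := by rw [hr 6 (by decide), h.bY]

/-- The arrays that hold the input, the loop bounds and the tables. -/
def tabArrays : List ℕ := baseArrays ++ [20, 21, 22, 23]

theorem Tab.congr {I : Instance} {s s' : Store} (h : Tab I s)
    (hn : ∀ a ∈ tabArrays, s'.nat a = s.nat a) (hr : s'.real = s.real) : Tab I s' where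
  toBase := h.toBase.congr (fun a ha => hn a (List.mem_append_left _ ha)) fun a _ => by rw [hr]
  row o := (h.row o).congr (fun a ha => by rw [hn a (List.mem_append_right _ ha)])
    fun a _ => by rw [hr]

theorem Tab.setNat {I : Instance} {s : Store} (h : Tab I s) {v : ℕ} (hv : v ∉ tabArrays)
    (j n : ℕ) : Tab I (s.setNat v j n) :=
  h.congr (fun a ha => Store.setNat_nat_ne _ _ _ (by rintro rfl; exact hv ha)) rfl

theorem edgeStmt_den {I : Instance} {s : Store} (h : Base I s) {o : Fin (16 * I.numE)}
    (h40 : s.nat 40 0 = o) (h24 : s.nat 24 0 = o / 16) (h25 : s.nat 25 0 = o % 16) :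
    let r := (edgeStmt (.var 40)).den s
    r.nat 20 o = o / 16 ∧ r.nat 23 o = o % 16 ∧
      r.nat 21 o = I.endA (Instance.optEdge I o) ∧ r.nat 22 o = I.endB (Instance.optEdge I o) ∧
      ∀ a (i : ℕ), i ≠ o → r.nat a i = s.nat a i := by
  have he : s.nat 24 0 = (Instance.optEdge I o : ℕ) := h24
  have h1 := h.fst (Instance.optEdge I o)
  have h2 := h.snd (Instance.optEdge I o)
  have h3 := h.cluster (I.fst (Instance.optEdge I o))
  have h4 := h.cluster (I.snd (Instance.optEdge I o))
  by_cases hc : I.cluster (I.fst (Instance.optEdge I o)) < I.cluster (I.snd (Instance.optEdge I o))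
  · have hc' : (I.cluster (I.fst (Instance.optEdge I o)) : ℕ) <
      I.cluster (I.snd (Instance.optEdge I o)) := hc
    simp only [edgeStmt, Stmt.den, Fml.sat_lt, NExpr.eval, Store.setNat_nat, h40, he, h25]
    simp [hc', Instance.endA, Instance.endB, hc, Store.setNat_nat, h1, h2, h3, h4, ← h24, he]
    intro a i hi
    simp [hi]
  · have hc' : ¬ (I.cluster (I.fst (Instance.optEdge I o)) : ℕ) <
      I.cluster (I.snd (Instance.optEdge I o)) := hc
    simp only [edgeStmt, Stmt.den, Fml.sat_lt, NExpr.eval, Store.setNat_nat, h40, he, h25]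
    simp [hc', Instance.endA, Instance.endB, hc, Store.setNat_nat, h1, h2, h3, h4, ← h24, he]
    intro a i hi
    simp [hi]

theorem anchorStmt_den {I : Instance} {s : Store} (h : Base I s) {o : Fin (16 * I.numE)}
    (h40 : s.nat 40 0 = o) (hA : s.nat 21 o = I.endA (Instance.optEdge I o))
    (hB : s.nat 22 o = I.endB (Instance.optEdge I o)) (hT : s.nat 23 o = o % 16) :
    let r := (Stmt.cases (.get 23 (.var 40)) (anchorStmt (.var 40)) 15).den s
    r.nat = s.nat ∧
      r.real 3 o = (I.anchor (I.endA (Instance.optEdge I o)) (Instance.optOf I o).2.1).1 ∧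
      r.real 4 o = (I.anchor (I.endA (Instance.optEdge I o)) (Instance.optOf I o).2.1).2 ∧
      r.real 5 o = (I.anchor (I.endB (Instance.optEdge I o)) (Instance.optOf I o).2.2).1 ∧
      r.real 6 o = (I.anchor (I.endB (Instance.optEdge I o)) (Instance.optOf I o).2.2).2 ∧
      (∀ a (i : ℕ), i ≠ o → r.real a i = s.real a i) ∧ ∀ a < 3, r.real a = s.real a := by
  have ht : (NExpr.get 23 (.var 40)).eval s = o % 16 := by simp [NExpr.eval, h40, hT]
  intro r
  have hr : r = (anchorStmt (.var 40) (o % 16)).den s := by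
    rw [← ht]; exact Stmt.den_cases (by rw [ht]; omega)
  have hreal : ∀ (a i : ℕ) (x : ℝ), 3 ≤ a → Base I s → Base I (s.setReal a i x) := by
    intro a i x ha hb
    refine hb.congr (fun _ _ => rfl) fun b hb => ?_
    funext j
    rw [Store.setReal_real, if_neg (by omega)]
  obtain ⟨A, hA'⟩ : ∃ A, A = I.endA (Instance.optEdge I o) := ⟨_, rfl⟩
  obtain ⟨B, hB'⟩ : ∃ B, B = I.endB (Instance.optEdge I o) := ⟨_, rfl⟩
  have evA : ∀ s' : Store, s'.nat = s.nat → (NExpr.get 21 (.var 40)).eval s' = A := by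
    intro s' hs'; simp [NExpr.eval, hs', h40, hA, hA']
  have evB : ∀ s' : Store, s'.nat = s.nat → (NExpr.get 22 (.var 40)).eval s' = B := by
    intro s' hs'; simp [NExpr.eval, hs', h40, hB, hB']
  have e1 := h.anchor_fst (evA s rfl) (tyA (o % 16))
  have h1 := hreal 3 o (I.anchor A (tyA (o % 16))).1 le_rfl h
  set s1 := s.setReal 3 o (I.anchor A (tyA (o % 16))).1 with hs1
  have e2 := h1.anchor_snd (evA s1 rfl) (tyA (o % 16))
  have h2 := Base.congr h1 (s' := s1.setReal 4 o (I.anchor A (tyA (o % 16))).2) (fun _ _ => rfl)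
    fun b hb => by funext j; rw [Store.setReal_real, if_neg (by omega)]
  set s2 := s1.setReal 4 o (I.anchor A (tyA (o % 16))).2 with hs2
  have e3 := h2.anchor_fst (evB s2 rfl) (tyB (o % 16))
  have h3 := Base.congr h2 (s' := s2.setReal 5 o (I.anchor B (tyB (o % 16))).1) (fun _ _ => rfl)
    fun b hb => by funext j; rw [Store.setReal_real, if_neg (by omega)]
  set s3 := s2.setReal 5 o (I.anchor B (tyB (o % 16))).1 with hs3
  have e4 := h3.anchor_snd (evB s3 rfl) (tyB (o % 16))
  have ev40 : ∀ s' : Store, s'.nat = s.nat → (NExpr.var 40).eval s' = o := by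
    intro s' hs'; simp [NExpr.eval, hs', h40]
  have hr' : r = s3.setReal 6 o (I.anchor B (tyB (o % 16))).2 := by
    rw [hr]
    simp only [anchorStmt, Stmt.den]
    rw [ev40 s rfl, e1, ← hs1, ev40 s1 rfl, e2, ← hs2, ev40 s2 rfl, e3, ← hs3, ev40 s3 rfl, e4]
  rw [← hA', ← hB', hr', show (Instance.optOf I o).2 = (tyA (o % 16), tyB (o % 16)) from rfl]
  simp only [hs3, hs2, hs1, Store.setReal_real, Store.setReal_nat]
  refine ⟨trivial, by simp, by simp, by simp, by simp, ?_, ?_⟩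
  · intro a i hi; simp [hi]
  · intro a ha
    funext i
    simp only [Store.setReal_real]
    rw [if_neg (by omega), if_neg (by omega), if_neg (by omega), if_neg (by omega)]

/-- Natural numbers cannot be divided on the machine, so quotient and remainder are carried along
with the loop counter. -/
theorem stepStmt_den {s : Store} {j : ℕ} (h24 : s.nat 24 0 = j / 16) (h25 : s.nat 25 0 = j % 16) :
    (stepStmt.den s).nat 24 0 = (j + 1) / 16 ∧ (stepStmt.den s).nat 25 0 = (j + 1) % 16 := by
  by_cases h : j % 16 = 15
  · simp [stepStmt, Stmt.den, NExpr.eval, Store.setNat_nat, h24, h25, h]; omega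
  · simp [stepStmt, Stmt.den, NExpr.eval, Store.setNat_nat, h24, h25, h]; omega

/-- A round writes table entries at its own index only, so the rows already filled stay correct. -/
theorem tableStmt_den {I : Instance} {s : Store} (h : Base I s) : Tab I (tableStmt.den s) := by
  set s0 := ((s.setNat 24 0 0).setNat 25 0 0) with hs0
  have hb0 : Base I s0 := (h.setNat (by decide) _ _).setNat (by decide) _ _
  set body := (Stmt.seq (edgeStmt (.var 40))
      (.seq (Stmt.cases (.get 23 (.var 40)) (anchorStmt (.var 40)) 15) stepStmt)) with hbody
  have hden : tableStmt.den s = iter body.den 40 s0 (16 * I.numE) := by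
    have : s0.nat 12 0 = 16 * I.numE := hb0.n12
    rw [← this]
    rfl
  have key : ∀ j ≤ 16 * I.numE, Base I (iter body.den 40 s0 j) ∧
      (iter body.den 40 s0 j).nat 24 0 = j / 16 ∧ (iter body.den 40 s0 j).nat 25 0 = j % 16 ∧
      ∀ o : Fin (16 * I.numE), (o : ℕ) < j → OptRow I (iter body.den 40 s0 j) o := by
    intro j
    induction j with
    | zero =>
      refine fun _ => ⟨hb0, ?_, ?_, fun o ho => absurd ho (by omega)⟩
      · simp [iter, hs0, Store.setNat_nat]
      · simp [iter, hs0, Store.setNat_nat]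
    | succ j ih =>
      intro hj
      obtain ⟨hb, h24, h25, hrow⟩ := ih (by omega)
      let o : Fin (16 * I.numE) := ⟨j, by omega⟩
      set u := (iter body.den 40 s0 j).setNat 40 0 j with hu
      have hub : Base I u := hb.setNat (by decide) _ _
      have hu40 : u.nat 40 0 = o := by simp [hu, Store.setNat_nat, o]
      have hu24 : u.nat 24 0 = o / 16 := by simp [hu, Store.setNat_nat, h24, o]
      have hu25 : u.nat 25 0 = o % 16 := by simp [hu, Store.setNat_nat, h25, o]
      obtain ⟨a1, a2, a3, a4, a5⟩ := edgeStmt_den hub hu40 hu24 hu25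
      set v := (edgeStmt (.var 40)).den u with hv
      have vn : ∀ a ∉ (edgeStmt (.var 40)).writes, v.nat a = u.nat a := fun a ha =>
        Stmt.den_nat _ ha u
      have vr : v.real = u.real := Stmt.den_real_eq rfl u
      have hvb : Base I v := hub.congr (fun a ha => vn a (by revert a; decide)) fun a _ => by rw [vr]
      obtain ⟨b1, b2, b3, b4, b5, b6, b7⟩ := anchorStmt_den hvb
        ((congrFun (vn 40 (by decide)) 0).trans hu40) a3 a4 a2
      set w := (Stmt.cases (.get 23 (.var 40)) (anchorStmt (.var 40)) 15).den v with hw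
      have hwb : Base I w := hvb.congr (fun a _ => by rw [b1]) b7
      obtain ⟨c1, c2⟩ := stepStmt_den (s := w) (j := j)
        ((congrFun (congrFun b1 24) 0).trans ((congrFun (vn 24 (by decide)) 0).trans hu24))
        ((congrFun (congrFun b1 25) 0).trans ((congrFun (vn 25 (by decide)) 0).trans hu25))
      have hnext : iter body.den 40 s0 (j + 1) = stepStmt.den w := rfl
      have wn : ∀ a ∉ stepStmt.writes, (stepStmt.den w).nat a = w.nat a := fun a ha =>
        Stmt.den_nat _ ha w
      have wr : (stepStmt.den w).real = w.real := Stmt.den_real_eq rfl w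
      rw [hnext]
      refine ⟨hwb.congr (fun a ha => wn a (by revert a; decide)) fun a _ => by rw [wr], c1, c2, ?_⟩
      intro o' ho'
      by_cases hoo : o' = o
      · subst hoo
        exact ⟨by rw [wn 20 (by decide), b1, a1], by rw [wn 21 (by decide), b1, a3],
          by rw [wn 22 (by decide), b1, a4], by rw [wn 23 (by decide), b1, a2],
          by rw [wr, b2], by rw [wr, b3], by rw [wr, b4], by rw [wr, b5]⟩
      · have hne : (o' : ℕ) ≠ o := fun h => hoo (Fin.ext h)
        have hlt : (o' : ℕ) < j := by
          have : (o : ℕ) = j := rfl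
          omega
        refine (hrow o' hlt).congr (fun a ha => ?_) fun a ha => ?_
        · rw [wn a (by revert a; decide), b1, a5 _ _ hne, hu,
            Store.setNat_nat_ne _ _ _ (by rintro rfl; revert ha; decide)]
        · rw [wr, b6 _ _ hne, vr]; rfl
  obtain ⟨k1, -, -, k4⟩ := key _ le_rfl
  rw [hden]
  exact ⟨k1, fun o => k4 o o.2⟩

end NodeTrix
namespace NodeTrix

/-! ## Formulas about options -/

namespace Fml

/-- The cluster of the first end of an option. -/
def clA (x : NExpr) : NExpr := .get 2 (.get 21 x)

/-- The cluster of the second end of an option. -/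
def clB (x : NExpr) : NExpr := .get 2 (.get 22 x)

/-- The edge of an option is an inter-cluster edge. -/
def inter (x : NExpr) : Fml := lt (clA x) (clB x)

/-- The coordinate that increases in the outward direction of a side. -/
def nrmE (X Y : RExpr) : Side → RExpr
  | .top => Y
  | .bottom => .minus .zero Y
  | .left => .minus .zero X
  | .right => X

/-- An option is legal. -/
def legal (x : NExpr) : Fml :=
  allL ((List.range 16).map fun n => imp (eq (.get 23 x) (.const n))
    (.conj (rlt (nrmE (.get 3 x) (.get 4 x) (tyA n)) (nrmE (.get 5 x) (.get 6 x) (tyA n)))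
      (rlt (nrmE (.get 5 x) (.get 6 x) (tyB n)) (nrmE (.get 3 x) (.get 4 x) (tyB n)))))

/-- The edges of two options share a cluster. -/
def share (x y : NExpr) : Fml :=
  disj (disj (eq (clA x) (clA y)) (eq (clA x) (clB y)))
    (disj (eq (clB x) (clA y)) (eq (clB x) (clB y)))

/-- A determinant of differences of points. -/
def detE (a b c d : RExpr × RExpr) : RExpr :=
  .minus (.times (.minus b.1 a.1) (.minus d.2 c.2)) (.times (.minus b.2 a.2) (.minus d.1 c.1))

/-- The crossing test for two segments. -/
def crossDet (p q p' q' : RExpr × RExpr) : Fml :=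
  .conj (rlt (.times (detE p q p p') (detE p q p q')) .zero)
    (rlt (.times (detE p' q' p' p) (detE p' q' p' q)) .zero)

/-- The first anchor of an option. -/
def ptA (x : NExpr) : RExpr × RExpr := (.get 3 x, .get 4 x)

/-- The second anchor of an option. -/
def ptB (x : NExpr) : RExpr × RExpr := (.get 5 x, .get 6 x)

/-- Two options are compatible. -/
def compat (x y : NExpr) : Fml :=
  .conj (imp (eq (.get 20 x) (.get 20 y)) (eq (.get 23 x) (.get 23 y)))
    (imp (.neg (eq (.get 20 x) (.get 20 y))) (imp (inter x) (imp (inter y) (imp (share x y)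
      (.neg (crossDet (ptA x) (ptB x) (ptA y) (ptB y)))))))

/-- The edges of two options join the same clusters. -/
def samePair (x y : NExpr) : Fml := .conj (eq (clA x) (clA y)) (eq (clB x) (clB y))

end Fml

section Sat

open Instance Fml

variable {I : Instance} {s : Store}

theorem Tab.eval_clA (ht : Tab I s) {x : NExpr} {o : Fin (16 * I.numE)} (hx : x.eval s = o) :
    (Fml.clA x).eval s = (I.clA (optEdge I o) : ℕ) := by
  simp only [Fml.clA, NExpr.eval, hx, (ht.row o).endA, ht.cluster, Instance.clA]

theorem Tab.eval_clB (ht : Tab I s) {x : NExpr} {o : Fin (16 * I.numE)} (hx : x.eval s = o) :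
    (Fml.clB x).eval s = (I.clB (optEdge I o) : ℕ) := by
  simp only [Fml.clB, NExpr.eval, hx, (ht.row o).endB, ht.cluster, Instance.clB]

theorem Tab.sat_inter (ht : Tab I s) {x : NExpr} {o : Fin (16 * I.numE)} (hx : x.eval s = o) :
    (inter x).Sat s ↔ I.IsInter (optEdge I o) := by
  rw [inter, sat_lt, ht.eval_clA hx, ht.eval_clB hx, isInter_iff]; exact Iff.rfl

theorem Tab.eval_ptA (ht : Tab I s) {x : NExpr} {o : Fin (16 * I.numE)} (hx : x.eval s = o) :
    ((ptA x).1.eval s, (ptA x).2.eval s) =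
      I.anchor (I.endA (optEdge I o)) (optOf I o).2.1 := by
  simp only [ptA, RExpr.eval, hx, (ht.row o).ax, (ht.row o).ay]

theorem Tab.eval_ptB (ht : Tab I s) {x : NExpr} {o : Fin (16 * I.numE)} (hx : x.eval s = o) :
    ((ptB x).1.eval s, (ptB x).2.eval s) =
      I.anchor (I.endB (optEdge I o)) (optOf I o).2.2 := by
  simp only [ptB, RExpr.eval, hx, (ht.row o).bx, (ht.row o).bY]

theorem eval_nrmE (X Y : RExpr) (d : Side) :
    (nrmE X Y d).eval s = d.nrm (X.eval s, Y.eval s) := by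
  cases d <;> simp [nrmE, RExpr.eval, NExpr.eval, Side.nrm]

/-- The sides select expressions when the formula is built, whereas the type is a number in memory.
The formula therefore lists all sixteen types, and only one premise is true. -/
theorem Tab.sat_legal (ht : Tab I s) {x : NExpr} {o : Fin (16 * I.numE)} (hx : x.eval s = o) :
    (legal x).Sat s ↔ I.Legal (optEdge I o) (optOf I o).2 := by
  have hA := ht.eval_ptA hx
  have hB := ht.eval_ptB hx
  simp only [ptA, ptB] at hA hB
  have ht : NExpr.eval s (.get 23 x) = o % 16 := by rw [NExpr.eval, hx, (ht.row o).type]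
  simp only [legal, sat_allL, List.mem_map, List.mem_range, forall_exists_index, and_imp,
    forall_apply_eq_imp_iff₂, sat_imp, sat_eq, sat_conj, sat_rlt, eval_nrmE, hA, hB, ht]
  constructor
  · exact fun h => h (o % 16) (by omega) rfl
  · rintro h n - rfl
    exact h

theorem share_iff (e f : Fin I.numE) : Share e f ↔
    (I.clA e = I.clA f ∨ I.clA e = I.clB f) ∨ I.clB e = I.clA f ∨ I.clB e = I.clB f := by
  simp only [Share, incident_iff]
  constructor
  · rintro ⟨i, rfl | rfl, h | h⟩ <;> simp [h]
  · rintro ((h | h) | h | h)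
    · exact ⟨_, .inl rfl, .inl h.symm⟩
    · exact ⟨_, .inl rfl, .inr h.symm⟩
    · exact ⟨_, .inr rfl, .inl h.symm⟩
    · exact ⟨_, .inr rfl, .inr h.symm⟩

theorem Tab.sat_share (ht : Tab I s) {x y : NExpr} {o o' : Fin (16 * I.numE)}
    (hx : x.eval s = o) (hy : y.eval s = o') :
    (share x y).Sat s ↔ Share (optEdge I o) (optEdge I o') := by
  simp only [share, sat_disj, sat_eq, ht.eval_clA hx, ht.eval_clB hx, ht.eval_clA hy,
    ht.eval_clB hy, share_iff, Fin.val_inj]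

theorem sat_crossDet (p q p' q' : RExpr × RExpr) : (crossDet p q p' q').Sat s ↔
    CrossDet (p.1.eval s, p.2.eval s) (q.1.eval s, q.2.eval s) (p'.1.eval s, p'.2.eval s)
      (q'.1.eval s, q'.2.eval s) := by
  simp [crossDet, CrossDet, detE, det, RExpr.eval, NExpr.eval]

theorem optEdge_eq_iff (o o' : Fin (16 * I.numE)) :
    (o : ℕ) / 16 = o' / 16 ↔ (optOf I o).1 = (optOf I o').1 := by
  simp [optOf]

theorem optType_eq_iff (o o' : Fin (16 * I.numE)) :
    (o : ℕ) % 16 = o' % 16 ↔ (optOf I o).2 = (optOf I o').2 := by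
  constructor
  · intro h; simp only [optOf, h]
  · intro h
    simp only [optOf, Prod.mk.injEq] at h
    exact ty_inj _ (Nat.mod_lt _ (by norm_num)) _ (Nat.mod_lt _ (by norm_num)) h.1 h.2

theorem Tab.eval_edge (ht : Tab I s) {x : NExpr} {o : Fin (16 * I.numE)} (hx : x.eval s = o) :
    NExpr.eval s (.get 20 x) = o / 16 := by rw [NExpr.eval, hx, (ht.row o).edge]

theorem Tab.eval_type (ht : Tab I s) {x : NExpr} {o : Fin (16 * I.numE)} (hx : x.eval s = o) :
    NExpr.eval s (.get 23 x) = o % 16 := by rw [NExpr.eval, hx, (ht.row o).type]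

theorem Tab.sat_compat (ht : Tab I s) {x y : NExpr} {o o' : Fin (16 * I.numE)}
    (hx : x.eval s = o) (hy : y.eval s = o') : (compat x y).Sat s ↔ OptCompat I o o' := by
  simp only [compat, sat_conj, sat_imp, sat_neg, sat_eq, ht.eval_edge hx, ht.eval_edge hy,
    ht.eval_type hx, ht.eval_type hy, ht.sat_inter hx, ht.sat_inter hy, ht.sat_share hx hy,
    sat_crossDet, ht.eval_ptA hx, ht.eval_ptB hx, ht.eval_ptA hy, ht.eval_ptB hy,
    optEdge_eq_iff, optType_eq_iff]
  exact Iff.rfl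

theorem Tab.sat_samePair (ht : Tab I s) {x y : NExpr} {o o' : Fin (16 * I.numE)}
    (hx : x.eval s = o) (hy : y.eval s = o') :
    (samePair x y).Sat s ↔ SamePair (optEdge I o) (optEdge I o') := by
  simp only [samePair, sat_conj, sat_eq, ht.eval_clA hx, ht.eval_clB hx, ht.eval_clA hy,
    ht.eval_clB hy, Fin.val_inj, SamePair]

end Sat

/-! ## Pinned options and survival -/

namespace Instance

/-- The number of pinned options. -/
def numPins (I : Instance) : ℕ := 32 * (I.numC * I.numC)

/-- The pinned options listed in an array. -/
def pins (I : Instance) (G : ℕ → ℕ) : Set I.Opt :=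
  {p | ∃ d < I.numPins, ∃ h : G d < 16 * I.numE, p = optOf I ⟨G d, h⟩}

/-- Survival with respect to the pinned options listed in an array. -/
def Sv (I : Instance) (G : ℕ → ℕ) (o : Fin (16 * I.numE)) : Prop :=
  SurvivesDet (I.pins G) (optOf I o)

end Instance

namespace Fml

/-- The pinned option with number `d`, the value of the variable `41`. -/
def pin : NExpr := .get 30 (.var 41)

/-- Some pinned option has a property. -/
def exPin (φ : Fml) : Fml := ex 41 13 (.conj (lt pin (.var 12)) φ)

/-- All pinned options have a property. -/
def allPin (φ : Fml) : Fml := .all 41 13 (imp (lt pin (.var 12)) φ)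

/-- A pinned option of the same type with the same clusters satisfies a comparison. -/
def rangeBound (φ : Fml) : Fml :=
  exPin (.conj (eq (.get 23 pin) (.get 23 (.var 40))) (.conj (samePair pin (.var 40)) φ))

/-- The option in the variable `40` survives. -/
def survives : Fml :=
  .conj (imp (inter (.var 40)) (legal (.var 40)))
    (.conj (allPin (compat pin (.var 40)))
      (imp (lt (.get 23 (.var 40)) (.const 4))
        (.conj
          (.conj (rangeBound (le (.get 3 (.get 21 pin)) (.get 3 (.get 21 (.var 40)))))
            (rangeBound (le (.get 3 (.get 21 (.var 40))) (.get 3 (.get 21 pin)))))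
          (.conj (rangeBound (le (.get 3 (.get 22 pin)) (.get 3 (.get 22 (.var 40)))))
            (rangeBound (le (.get 3 (.get 22 (.var 40))) (.get 3 (.get 22 pin))))))))

end Fml

section Survives

open Instance Fml

variable {I : Instance} {s : Store}

/-- Entries that are not numbers of options stand for absent pins, and the guard in `exPin` skips
them. -/
theorem Tab.sat_exPin (ht : Tab I s) {φ : Fml} {Q : I.Opt → Prop}
    (h : ∀ d, ∀ o' : Fin (16 * I.numE), s.nat 30 d = o' →
      (φ.Sat (s.setNat 41 0 d) ↔ Q (optOf I o'))) :
    (exPin φ).Sat s ↔ ∃ p ∈ I.pins (s.nat 30), Q p := by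
  simp only [exPin, sat_ex, sat_conj, sat_lt, pin, NExpr.eval, Store.setNat_nat, ht.n13]
  simp only [Instance.pins, Set.mem_ofPred_eq, numPins]
  simp only [true_and, if_true, show ¬ (30 = 41) by norm_num, show ¬ (12 = 41) by norm_num,
    false_and, if_false, ht.n12]
  constructor
  · rintro ⟨d, hd, hlt, hφ⟩
    exact ⟨_, ⟨d, hd, hlt, rfl⟩, (h d ⟨_, hlt⟩ rfl).1 hφ⟩
  · rintro ⟨_, ⟨d, hd, hlt, rfl⟩, hQ⟩
    exact ⟨d, hd, hlt, (h d ⟨_, hlt⟩ rfl).2 hQ⟩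

theorem Tab.sat_allPin (ht : Tab I s) {φ : Fml} {Q : I.Opt → Prop}
    (h : ∀ d, ∀ o' : Fin (16 * I.numE), s.nat 30 d = o' →
      (φ.Sat (s.setNat 41 0 d) ↔ Q (optOf I o'))) :
    (allPin φ).Sat s ↔ ∀ p ∈ I.pins (s.nat 30), Q p := by
  have := ht.sat_exPin (φ := .neg φ) (Q := fun p => ¬ Q p) fun d o' hd => not_congr (h d o' hd)
  rw [← not_iff_not]
  push Not
  rw [← this]
  simp only [allPin, exPin, sat_all, sat_imp, sat_ex, sat_conj, sat_neg]
  push Not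
  rfl

theorem Tab.sat_rangeBound (ht : Tab I s) {o : Fin (16 * I.numE)} (h40 : s.nat 40 0 = o)
    {φ : Fml} {Q : Fin I.numE → Prop}
    (h : ∀ d, ∀ o' : Fin (16 * I.numE), s.nat 30 d = o' →
      (φ.Sat (s.setNat 41 0 d) ↔ Q (optEdge I o'))) :
    (rangeBound φ).Sat s ↔
      ∃ p ∈ I.pins (s.nat 30), p.2 = (optOf I o).2 ∧ SamePair p.1 (optOf I o).1 ∧ Q p.1 := by
  refine ht.sat_exPin (Q := fun p => p.2 = (optOf I o).2 ∧ SamePair p.1 (optOf I o).1 ∧ Q p.1)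
    fun d o' hd => ?_
  have ht' : Tab I (s.setNat 41 0 d) := ht.setNat (by decide) _ _
  have hp : pin.eval (s.setNat 41 0 d) = o' := by
    simp [pin, NExpr.eval, Store.setNat_nat, hd]
  have hx : (NExpr.var 40).eval (s.setNat 41 0 d) = o := by
    simp [NExpr.eval, Store.setNat_nat, h40]
  rw [sat_conj, sat_conj, sat_eq, ht'.eval_type hp, ht'.eval_type hx, optType_eq_iff,
    ht'.sat_samePair hp hx, h d o' hd]
  exact Iff.rfl

theorem Tab.sat_survives (ht : Tab I s) {o : Fin (16 * I.numE)} (h40 : s.nat 40 0 = o) :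
    survives.Sat s ↔ I.Sv (s.nat 30) o := by
  have hx0 : (NExpr.var 40).eval s = o := by simp [NExpr.eval, h40]
  have hc := ht.sat_allPin (φ := compat pin (.var 40)) (Q := fun p => CompatDet p (optOf I o))
    fun d o' hd => (ht.setNat (by decide) _ _).sat_compat
      (by simp [pin, NExpr.eval, Store.setNat_nat, hd])
      (by simp [NExpr.eval, Store.setNat_nat, h40])
  have order : ∀ d (v : Fin I.numV), (s.setNat 41 0 d).nat 3 v = I.order v := fun d v =>
    (ht.setNat (by decide) _ _).order v
  have hA : ∀ d, NExpr.eval (s.setNat 41 0 d) (.get 3 (.get 21 (.var 40))) =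
      I.order (I.endA (optEdge I o)) := by
    intro d
    have : (s.setNat 41 0 d).nat 21 o = _ := ((ht.setNat (by decide) 0 d).row o).endA
    simp only [NExpr.eval]
    rw [Store.setNat_nat s 41 0 d 40 0, if_neg (by norm_num), h40, this, order]
  have hB : ∀ d, NExpr.eval (s.setNat 41 0 d) (.get 3 (.get 22 (.var 40))) =
      I.order (I.endB (optEdge I o)) := by
    intro d
    have : (s.setNat 41 0 d).nat 22 o = _ := ((ht.setNat (by decide) 0 d).row o).endB
    simp only [NExpr.eval]
    rw [Store.setNat_nat s 41 0 d 40 0, if_neg (by norm_num), h40, this, order]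
  have gA : ∀ d, ∀ o' : Fin (16 * I.numE), s.nat 30 d = o' →
      NExpr.eval (s.setNat 41 0 d) (.get 3 (.get 21 pin)) = I.order (I.endA (optEdge I o')) := by
    intro d o' hd
    have : (s.setNat 41 0 d).nat 21 o' = _ := ((ht.setNat (by decide) 0 d).row o').endA
    have hp : pin.eval (s.setNat 41 0 d) = o' := by
      simp [pin, NExpr.eval, Store.setNat_nat, hd]
    rw [NExpr.eval, NExpr.eval, hp, this, order]
  have gB : ∀ d, ∀ o' : Fin (16 * I.numE), s.nat 30 d = o' →
      NExpr.eval (s.setNat 41 0 d) (.get 3 (.get 22 pin)) = I.order (I.endB (optEdge I o')) := by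
    intro d o' hd
    have : (s.setNat 41 0 d).nat 22 o' = _ := ((ht.setNat (by decide) 0 d).row o').endB
    have hp : pin.eval (s.setNat 41 0 d) = o' := by
      simp [pin, NExpr.eval, Store.setNat_nat, hd]
    rw [NExpr.eval, NExpr.eval, hp, this, order]
  have hlt : ((o : ℕ) % 16 < 4) ↔ (optOf I o).2.2 = (optOf I o).2.1.opp :=
    (ty_opp_iff _ (Nat.mod_lt _ (by norm_num))).symm
  simp only [survives, sat_conj, sat_imp, ht.sat_inter hx0, ht.sat_legal hx0, hc, sat_lt,
    ht.eval_type hx0]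
  rw [show NExpr.eval s (.const 4) = 4 from rfl, hlt]
  rw [ht.sat_rangeBound h40 (Q := fun e => I.order (I.endA e) ≤ I.order (I.endA (optEdge I o)))
      (fun d o' hd => by rw [sat_le, hA, gA d o' hd]),
    ht.sat_rangeBound h40 (Q := fun e => I.order (I.endA (optEdge I o)) ≤ I.order (I.endA e))
      (fun d o' hd => by rw [sat_le, hA, gA d o' hd]),
    ht.sat_rangeBound h40 (Q := fun e => I.order (I.endB e) ≤ I.order (I.endB (optEdge I o)))
      (fun d o' hd => by rw [sat_le, hB, gB d o' hd]),
    ht.sat_rangeBound h40 (Q := fun e => I.order (I.endB (optEdge I o)) ≤ I.order (I.endB e))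
      (fun d o' hd => by rw [sat_le, hB, gB d o' hd])]
  exact Iff.rfl

end Survives
end NodeTrix
namespace NodeTrix

/-! ## Examining one guess -/

/-- Writes the truth values of a formula about the option in the variable `40` into an array. -/
def flagStmt (arr : ℕ) (φ : Fml) : Stmt :=
  .forr 40 12 (.ite φ (.setN arr (.var 40) (.const 1)) (.setN arr (.var 40) (.const 0)))

/-- The statement without effect on the arrays in use. -/
def nopStmt : Stmt := .setN 39 (.const 0) (.const 0)

namespace Fml

/-- The flag of an option in an array is set. -/
def flag (arr : ℕ) (x : NExpr) : Fml := eq (.get arr x) (.const 1)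

/-- The option in the variable `40` is the first or the last surviving one of its edge. -/
def chosen : Fml :=
  .conj (flag 31 (.var 40))
    (disj (.all 41 12 (imp (lt (.var 41) (.var 40))
        (imp (eq (.get 20 (.var 41)) (.get 20 (.var 40))) (.neg (flag 31 (.var 41))))))
      (.all 41 12 (imp (lt (.var 40) (.var 41))
        (imp (eq (.get 20 (.var 41)) (.get 20 (.var 40))) (.neg (flag 31 (.var 41)))))))

/-- The option in the variable `42` forces the option in the variable `40`. -/
def forces : Fml :=
  .conj (flag 32 (.var 40)) (.all 41 12 (imp (flag 32 (.var 41))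
    (imp (eq (.get 20 (.var 41)) (.get 20 (.var 40))) (imp (.neg (eq (.var 41) (.var 40)))
      (.neg (compat (.var 42) (.var 41)))))))

/-- The option in the variable `40` is forced by a marked option. -/
def reached : Fml := ex 42 12 (.conj (flag 33 (.var 42)) forces)

/-- The option in the variable `43` is chosen, and the marked options are compatible. -/
def good : Fml :=
  .conj (flag 32 (.var 43)) (.all 42 12 (.all 41 12 (imp (flag 33 (.var 42))
    (imp (flag 33 (.var 41)) (compat (.var 42) (.var 41))))))

/-- Every edge has a good option. -/
def accept : Fml :=
  .all 41 10 (ex 42 12 (.conj (eq (.get 20 (.var 42)) (.var 41)) (flag 34 (.var 42))))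

end Fml

/-- Marks the options reached in one step. -/
def markStmt : Stmt :=
  .forr 40 12 (.ite Fml.reached (.setN 33 (.var 40) (.const 1)) nopStmt)

/-- Determines whether the option in the variable `43` is good. -/
def goodStmt : Stmt :=
  .seq (flagStmt 33 (.eq (.var 40) (.var 43)))
    (.seq (.forr 44 12 markStmt)
      (.ite Fml.good (.setN 34 (.var 43) (.const 1)) (.setN 34 (.var 43) (.const 0))))

/-- Examines the guess in the array `30`. -/
def guessStmt : Stmt :=
  .seq (flagStmt 31 .survives) (.seq (flagStmt 32 .chosen) (.seq (.forr 43 12 goodStmt)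
    (.ite .accept (.setN 35 (.const 0) (.const 1)) nopStmt)))

section

open Instance Fml

variable {I : Instance} {s : Store}

/-- An array holds the flags of a set of options. -/
def Flags (I : Instance) (s : Store) (arr : ℕ) (p : Fin (16 * I.numE) → Prop) : Prop :=
  ∀ o : Fin (16 * I.numE), s.nat arr o = 1 ↔ p o

theorem Flags.congr {s' : Store} {arr : ℕ} {p : Fin (16 * I.numE) → Prop} (h : Flags I s arr p)
    (h' : s'.nat arr = s.nat arr) : Flags I s' arr p := by
  intro o; rw [h', h o]

theorem Flags.sat {arr : ℕ} {p : Fin (16 * I.numE) → Prop} (h : Flags I s arr p) {x : NExpr}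
    {o : Fin (16 * I.numE)} (hx : x.eval s = o) : (flag arr x).Sat s ↔ p o := by
  rw [flag, sat_eq]
  change s.nat arr (x.eval s) = 1 ↔ p o
  rw [hx]
  exact h o

theorem Tab.den (ht : Tab I s) {p : Stmt} (h : ∀ a ∈ tabArrays, a ∉ p.writes)
    (hr : p.rwrites = []) : Tab I (p.den s) :=
  ht.congr (fun a ha => p.den_nat (h a ha) s) (Stmt.den_real_eq hr s)

/-- The frame property at the beginning of a round of a loop. -/
theorem iter_frame {p : Stmt} {b : ℕ} (hb : b ∉ p.writes) (v : ℕ) (s : Store) (j n : ℕ) :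
    ((iter p.den v s j).setNat v 0 n).nat b = (s.setNat v 0 n).nat b := by
  by_cases hv : b = v
  · subst hv
    funext i
    simp only [Store.setNat_nat]
    split
    · rfl
    · rename_i hi
      induction j with
      | zero => rfl
      | succ j ih => rw [iter, p.den_nat hb, Store.setNat_nat, if_neg fun h => hi ⟨trivial, h.2⟩, ih]
  · exact Store.setNat_congr _ _ (iter_nat hv (p.den_nat hb) _ _)

theorem iter_real_eq {p : Stmt} (hp : p.rwrites = []) (v : ℕ) (s : Store) (j : ℕ) :
    (iter p.den v s j).real = s.real := by
  funext b
  exact iter_real (p.den_real (by simp [hp])) s j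

/-- The formula does not read the array being written, so each round evaluates it as in the initial
store. -/
theorem flags_flagStmt (hN : s.nat 12 0 = 16 * I.numE) {arr : ℕ} {φ : Fml}
    (h1 : arr ∉ φ.arrays) (h2 : arr ≠ 40) {p : Fin (16 * I.numE) → Prop}
    (hp : ∀ o : Fin (16 * I.numE), φ.Sat (s.setNat 40 0 o) ↔ p o) :
    Flags I ((flagStmt arr φ).den s) arr p := by
  set body : Stmt := .ite φ (.setN arr (.var 40) (.const 1)) (.setN arr (.var 40) (.const 0))
    with hbody
  have hden : (flagStmt arr φ).den s = iter body.den 40 s (16 * I.numE) := by rw [← hN]; rfl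
  have key : ∀ j ≤ 16 * I.numE, ∀ o : Fin (16 * I.numE), (o : ℕ) < j →
      ((iter body.den 40 s j).nat arr o = 1 ↔ p o) := by
    intro j
    induction j with
    | zero => intro _ o ho; exact absurd ho (by omega)
    | succ j ih =>
      intro hj o ho
      have hsat : φ.Sat ((iter body.den 40 s j).setNat 40 0 j) ↔ p ⟨j, by omega⟩ := by
        rw [← hp]
        refine φ.sat_congr (fun a ha => iter_frame ?_ _ _ _ _) (iter_real_eq rfl _ _ _)
        have hne : a ≠ arr := fun h => h1 (h ▸ ha)
        simp [hbody, Stmt.writes, hne]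
      have hval : (iter body.den 40 s (j + 1)).nat arr o =
          if (o : ℕ) = j then tv (p ⟨j, by omega⟩) else (iter body.den 40 s j).nat arr o := by
        have hu : ((iter body.den 40 s j).setNat 40 0 j).nat 40 0 = j := by
          simp [Store.setNat_nat]
        have hv : ((iter body.den 40 s j).setNat 40 0 j).nat arr = (iter body.den 40 s j).nat arr :=
          Store.setNat_nat_ne _ _ _ h2
        rw [iter]
        generalize (iter body.den 40 s j).setNat 40 0 j = u at hsat hu hv
        rw [← hv]
        by_cases hpj : p ⟨j, by omega⟩ <;>
          simp [hbody, Stmt.den, hsat, hpj, NExpr.eval, Store.setNat_nat, hu, tv]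
      rw [hval]
      split
      · rename_i hoj
        have hoj' : (⟨j, by omega⟩ : Fin (16 * I.numE)) = o := Fin.ext hoj.symm
        rw [hoj']
        by_cases hpj : p o <;> simp [tv, hpj]
      · exact ih (by omega) o (by omega)
  rw [hden]
  exact fun o => key _ le_rfl o o.2

theorem Tab.sat_chosen (ht : Tab I s) {Sv : Fin (16 * I.numE) → Prop} (hf : Flags I s 31 Sv)
    {o : Fin (16 * I.numE)} (h40 : s.nat 40 0 = o) : chosen.Sat s ↔ Chosen Sv o := by
  have hx : ∀ d, (NExpr.var 40).eval (s.setNat 41 0 d) = o := by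
    intro d; simp [NExpr.eval, Store.setNat_nat, h40]
  have hy : ∀ o' : Fin (16 * I.numE), (NExpr.var 41).eval (s.setNat 41 0 o') = o' := by
    intro o'; simp [NExpr.eval, Store.setNat_nat]
  have hs : ∀ d, Tab I (s.setNat 41 0 d) := fun d => ht.setNat (by decide) _ _
  have hF : ∀ d, Flags I (s.setNat 41 0 d) 31 Sv := fun d => hf.congr rfl
  have inner : ∀ o' : Fin (16 * I.numE),
      (imp (eq (.get 20 (.var 41)) (.get 20 (.var 40))) (.neg (flag 31 (.var 41)))).Sat
        (s.setNat 41 0 o') ↔ (optEdge I o' = optEdge I o → ¬ Sv o') := by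
    intro o'
    rw [sat_imp, sat_eq, (hs _).eval_edge (hy o'), (hs _).eval_edge (hx _), sat_neg,
      (hF _).sat (hy o'), optEdge_eq_iff]
    exact Iff.rfl
  simp only [chosen, sat_conj, sat_disj, sat_all]
  rw [hf.sat (show (NExpr.var 40).eval s = o by simp [NExpr.eval, h40]), ht.n12]
  refine and_congr_right fun _ => or_congr ?_ ?_
  · constructor
    · intro h o' hlt
      refine (inner o').1 (sat_imp.1 (h o' o'.2) ?_)
      rw [sat_lt, hx, hy]; exact hlt
    · intro h d hd
      rw [sat_imp]
      intro hlt
      rw [sat_lt, hx, hy ⟨d, hd⟩] at hlt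
      exact (inner ⟨d, hd⟩).2 (h ⟨d, hd⟩ hlt)
  · constructor
    · intro h o' hlt
      refine (inner o').1 (sat_imp.1 (h o' o'.2) ?_)
      rw [sat_lt, hx, hy]; exact hlt
    · intro h d hd
      rw [sat_imp]
      intro hlt
      rw [sat_lt, hx, hy ⟨d, hd⟩] at hlt
      exact (inner ⟨d, hd⟩).2 (h ⟨d, hd⟩ hlt)

theorem Tab.sat_forces (ht : Tab I s) {V : Fin (16 * I.numE) → Prop} (hf : Flags I s 32 V)
    {x y : Fin (16 * I.numE)} (h42 : s.nat 42 0 = x) (h40 : s.nat 40 0 = y) :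
    forces.Sat s ↔ Forces (optEdge I) (OptCompat I) V x y := by
  have hx : ∀ d, (NExpr.var 42).eval (s.setNat 41 0 d) = x := by
    intro d; simp [NExpr.eval, Store.setNat_nat, h42]
  have hy : ∀ d, (NExpr.var 40).eval (s.setNat 41 0 d) = y := by
    intro d; simp [NExpr.eval, Store.setNat_nat, h40]
  have hz : ∀ z : Fin (16 * I.numE), (NExpr.var 41).eval (s.setNat 41 0 z) = z := by
    intro z; simp [NExpr.eval, Store.setNat_nat]
  have hs : ∀ d, Tab I (s.setNat 41 0 d) := fun d => ht.setNat (by decide) _ _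
  have hF : ∀ d, Flags I (s.setNat 41 0 d) 32 V := fun d => hf.congr rfl
  have inner : ∀ z : Fin (16 * I.numE),
      (imp (flag 32 (.var 41)) (imp (eq (.get 20 (.var 41)) (.get 20 (.var 40)))
        (imp (.neg (eq (.var 41) (.var 40))) (.neg (compat (.var 42) (.var 41)))))).Sat
        (s.setNat 41 0 z) ↔ (V z → optEdge I z = optEdge I y → z ≠ y → ¬ OptCompat I x z) := by
    intro z
    rw [sat_imp, sat_imp, sat_imp, sat_neg, sat_neg, (hF _).sat (hz z), sat_eq,
      (hs _).eval_edge (hz z), (hs _).eval_edge (hy _), sat_eq, hz, hy,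
      (hs _).sat_compat (hx _) (hz z), optEdge_eq_iff, Fin.val_inj]
    exact Iff.rfl
  simp only [forces, sat_conj, sat_all]
  rw [hf.sat (show (NExpr.var 40).eval s = y by simp [NExpr.eval, h40]), ht.n12]
  refine and_congr_right fun _ => ⟨fun h z => (inner z).1 (h z z.2), fun h d hd => ?_⟩
  exact (inner ⟨d, hd⟩).2 (h ⟨d, hd⟩)

theorem Tab.sat_reached (ht : Tab I s) {V M : Fin (16 * I.numE) → Prop} (hf : Flags I s 32 V)
    (hM : Flags I s 33 M) {y : Fin (16 * I.numE)} (h40 : s.nat 40 0 = y) :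
    reached.Sat s ↔ ∃ x, M x ∧ Forces (optEdge I) (OptCompat I) V x y := by
  have inner : ∀ x : Fin (16 * I.numE),
      (Fml.conj (flag 33 (.var 42)) forces).Sat (s.setNat 42 0 x) ↔
        (M x ∧ Forces (optEdge I) (OptCompat I) V x y) := by
    intro x
    rw [sat_conj, Flags.sat (s := s.setNat 42 0 x) (hM.congr rfl) (show (NExpr.var 42).eval (s.setNat 42 0 x) = x by
        simp [NExpr.eval, Store.setNat_nat]),
      (ht.setNat (by decide) 0 x).sat_forces (hf.congr rfl) (x := x) (y := y)
        (by simp [Store.setNat_nat]) (by simp [Store.setNat_nat, h40])]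
  rw [reached, sat_ex, ht.n12]
  constructor
  · rintro ⟨d, hd, h⟩; exact ⟨⟨d, hd⟩, (inner ⟨d, hd⟩).1 h⟩
  · rintro ⟨x, h⟩; exact ⟨x, x.2, (inner x).2 h⟩

theorem Tab.sat_good (ht : Tab I s) {V M : Fin (16 * I.numE) → Prop} (hf : Flags I s 32 V)
    (hM : Flags I s 33 M) {o : Fin (16 * I.numE)} (h43 : s.nat 43 0 = o) :
    good.Sat s ↔ V o ∧ ∀ x y, M x → M y → OptCompat I x y := by
  have inner : ∀ x y : Fin (16 * I.numE),
      (imp (flag 33 (.var 42)) (imp (flag 33 (.var 41)) (compat (.var 42) (.var 41)))).Sat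
        ((s.setNat 42 0 x).setNat 41 0 y) ↔ (M x → M y → OptCompat I x y) := by
    intro x y
    have hx : (NExpr.var 42).eval ((s.setNat 42 0 x).setNat 41 0 y) = x := by
      simp [NExpr.eval, Store.setNat_nat]
    have hy : (NExpr.var 41).eval ((s.setNat 42 0 x).setNat 41 0 y) = y := by
      simp [NExpr.eval, Store.setNat_nat]
    have hM' : Flags I ((s.setNat 42 0 x).setNat 41 0 y) 33 M := hM.congr rfl
    rw [sat_imp, sat_imp, hM'.sat hx, hM'.sat hy,
      ((ht.setNat (by decide) 0 x).setNat (by decide) 0 y).sat_compat hx hy]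
  simp only [good, sat_conj, sat_all]
  rw [hf.sat (show (NExpr.var 43).eval s = o by simp [NExpr.eval, h43]), ht.n12]
  refine and_congr_right fun _ => ⟨fun h x y => (inner x y).1 (h x x.2 y ?_), fun h d hd e he => ?_⟩
  · have := (ht.setNat (v := 42) (by decide) 0 x).n12
    rw [this]; exact y.2
  · have := (ht.setNat (v := 42) (by decide) 0 d).n12
    rw [this] at he
    exact (inner ⟨d, hd⟩ ⟨e, he⟩).2 (h _ _)

theorem Tab.sat_accept (ht : Tab I s) {g : Fin (16 * I.numE) → Prop} (hf : Flags I s 34 g) :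
    accept.Sat s ↔ ∀ e, ∃ o, optEdge I o = e ∧ g o := by
  have inner : ∀ (e : ℕ) (o : Fin (16 * I.numE)),
      (Fml.conj (eq (.get 20 (.var 42)) (.var 41)) (flag 34 (.var 42))).Sat
        ((s.setNat 41 0 e).setNat 42 0 o) ↔ ((optEdge I o : ℕ) = e ∧ g o) := by
    intro e o
    have hx : (NExpr.var 42).eval ((s.setNat 41 0 e).setNat 42 0 o) = o := by
      simp [NExpr.eval, Store.setNat_nat]
    have hf' : Flags I ((s.setNat 41 0 e).setNat 42 0 o) 34 g := hf.congr rfl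
    rw [sat_conj, hf'.sat hx, sat_eq,
      ((ht.setNat (by decide) 0 e).setNat (by decide) 0 o).eval_edge hx]
    have : (NExpr.var 41).eval ((s.setNat 41 0 e).setNat 42 0 o) = e := by
      simp [NExpr.eval, Store.setNat_nat]
    rw [this]
    exact Iff.rfl
  simp only [accept, sat_all, sat_ex]
  rw [ht.n10]
  constructor
  · intro h e
    obtain ⟨d, hd, h'⟩ := h e e.2
    rw [(ht.setNat (v := 41) (by decide) 0 e).n12] at hd
    obtain ⟨h1, h2⟩ := (inner e ⟨d, hd⟩).1 h'
    exact ⟨⟨d, hd⟩, Fin.ext h1, h2⟩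
  · intro h e he
    obtain ⟨o, h1, h2⟩ := h ⟨e, he⟩
    refine ⟨o, ?_, (inner e o).2 ⟨by rw [h1], h2⟩⟩
    rw [(ht.setNat (v := 41) (by decide) 0 e).n12]
    exact o.2

end
end NodeTrix
-- Unit propagation and acceptance of a guess
namespace NodeTrix

open Instance Fml

variable {I : Instance} {s : Store}

/-- The set of marked options. -/
def Marked (I : Instance) (s : Store) (x : Fin (16 * I.numE)) : Prop := s.nat 33 x = 1

/-- Marks are set in place, so one pass may propagate several steps. It is therefore described by
bounds: it adds all direct successors, and nothing outside a closed set containing the old marks. -/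
theorem markStmt_den (ht : Tab I s) {V : Fin (16 * I.numE) → Prop} (hV : Flags I s 32 V) :
    (∀ x, Marked I s x → Marked I (markStmt.den s) x) ∧
      (∀ x y, Marked I s x → Forces (optEdge I) (OptCompat I) V x y →
        Marked I (markStmt.den s) y) ∧
      ∀ C : Fin (16 * I.numE) → Prop, (∀ x, Marked I s x → C x) →
        (∀ x y, C x → Forces (optEdge I) (OptCompat I) V x y → C y) →
        ∀ y, Marked I (markStmt.den s) y → C y := by
  obtain ⟨body, hbody⟩ : ∃ body : Stmt,
    body = .ite Fml.reached (.setN 33 (.var 40) (.const 1)) nopStmt := ⟨_, rfl⟩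
  have hden : markStmt.den s = iter body.den 40 s (16 * I.numE) := by
    rw [← ht.n12, hbody]; rfl
  have hw : body.writes = [33, 39] := by rw [hbody]; rfl
  have hr : body.rwrites = [] := by rw [hbody]; rfl
  have key : ∀ j ≤ 16 * I.numE,
      (∀ x, Marked I s x → Marked I (iter body.den 40 s j) x) ∧
      (∀ x y : Fin (16 * I.numE), (y : ℕ) < j → Marked I s x →
        Forces (optEdge I) (OptCompat I) V x y → Marked I (iter body.den 40 s j) y) ∧
      ∀ C : Fin (16 * I.numE) → Prop, (∀ x, Marked I s x → C x) →
        (∀ x y, C x → Forces (optEdge I) (OptCompat I) V x y → C y) →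
        ∀ y, Marked I (iter body.den 40 s j) y → C y := by
    intro j
    induction j with
    | zero =>
      exact fun _ => ⟨fun x h => h, fun x y hy => absurd hy (by omega), fun C h _ => h⟩
    | succ j ih =>
      intro hj
      obtain ⟨h1, h2, h3⟩ := ih (by omega)
      have fr : ∀ a ∉ body.writes, ((iter body.den 40 s j).setNat 40 0 j).nat a =
          (s.setNat 40 0 j).nat a := fun a ha => iter_frame ha _ _ _ _
      have htu : Tab I ((iter body.den 40 s j).setNat 40 0 j) :=
        (ht.setNat (v := 40) (by decide) 0 j).congr
          (fun a ha => fr a (by rw [hw]; revert a; decide)) (iter_real_eq hr _ _ _)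
      have hVu : Flags I ((iter body.den 40 s j).setNat 40 0 j) 32 V :=
        hV.congr (fr 32 (by rw [hw]; decide))
      have hMu : Flags I ((iter body.den 40 s j).setNat 40 0 j) 33
        (Marked I (iter body.den 40 s j)) := fun o => Iff.rfl
      have h40 : ((iter body.den 40 s j).setNat 40 0 j).nat 40 0 = (⟨j, hj⟩ : Fin _) := by
        simp [Store.setNat_nat]
      have hsat := htu.sat_reached hVu hMu h40
      have hval : ∀ y : Fin (16 * I.numE), Marked I (iter body.den 40 s (j + 1)) y ↔
          Marked I (iter body.den 40 s j) y ∨ ((y : ℕ) = j ∧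
            ∃ x, Marked I (iter body.den 40 s j) x ∧
              Forces (optEdge I) (OptCompat I) V x ⟨j, hj⟩) := by
        intro y
        have hv : ((iter body.den 40 s j).setNat 40 0 j).nat 33 = (iter body.den 40 s j).nat 33 :=
          Store.setNat_nat_ne _ _ _ (by decide)
        rw [← hsat, iter]
        simp only [Marked]
        rw [← hv]
        generalize (iter body.den 40 s j).setNat 40 0 j = u at hsat h40
        by_cases hp : reached.Sat u <;> by_cases hy : (y : ℕ) = j <;>
          simp [hbody, Stmt.den, nopStmt, hp, hy, NExpr.eval, Store.setNat_nat, h40]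
      refine ⟨fun x hx => (hval x).2 (.inl (h1 x hx)), ?_, ?_⟩
      · intro x y hy hx hxy
        by_cases hyj : (y : ℕ) = j
        · obtain rfl : y = ⟨j, hj⟩ := Fin.ext hyj
          exact (hval _).2 (.inr ⟨rfl, x, h1 x hx, hxy⟩)
        · exact (hval y).2 (.inl (h2 x y (by omega) hx hxy))
      · intro C hC hcl y hy
        rcases (hval y).1 hy with hy | ⟨hyj, x, hx, hxy⟩
        · exact h3 C hC hcl y hy
        · obtain rfl : y = ⟨j, hj⟩ := Fin.ext hyj
          exact hcl x _ (h3 C hC hcl x hx) hxy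
  obtain ⟨h1, h2, h3⟩ := key _ le_rfl
  rw [hden]
  exact ⟨h1, fun x y => h2 x y y.2, h3⟩

/-- Until the marked set is closed, each round enlarges it. Starting with one mark, more than `j`
options are marked after `j` rounds, so as many rounds as there are options suffice. -/
theorem marked_rounds (ht : Tab I s) {V : Fin (16 * I.numE) → Prop} (hV : Flags I s 32 V)
    {o : Fin (16 * I.numE)} (hM : ∀ x, Marked I s x ↔ x = o) (x : Fin (16 * I.numE)) :
    Marked I ((Stmt.forr 44 12 markStmt).den s) x ↔
      Relation.ReflTransGen (Forces (optEdge I) (OptCompat I) V) o x := by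
  have hden : (Stmt.forr 44 12 markStmt).den s = iter markStmt.den 44 s (16 * I.numE) := by
    rw [← ht.n12]; rfl
  let closed : (Fin (16 * I.numE) → Prop) → Prop := fun C =>
    ∀ x y, C x → Forces (optEdge I) (OptCompat I) V x y → C y
  have key : ∀ j, Marked I (iter markStmt.den 44 s j) o ∧
      (∀ C, C o → closed C → ∀ x, Marked I (iter markStmt.den 44 s j) x → C x) ∧
      (closed (Marked I (iter markStmt.den 44 s j)) ∨
        j < {x | Marked I (iter markStmt.den 44 s j) x}.ncard) := by
    intro j
    induction j with
    | zero =>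
      refine ⟨(hM o).2 rfl, fun C hC _ x hx => by rw [(hM x).1 hx]; exact hC, .inr ?_⟩
      rw [Set.ncard_pos]
      exact ⟨o, (hM o).2 rfl⟩
    | succ j ih =>
      obtain ⟨h1, h2, h3⟩ := ih
      have fr : ∀ a ∉ markStmt.writes, ((iter markStmt.den 44 s j).setNat 44 0 j).nat a =
          (s.setNat 44 0 j).nat a := fun a ha => iter_frame ha _ _ _ _
      have htu : Tab I ((iter markStmt.den 44 s j).setNat 44 0 j) :=
        (ht.setNat (v := 44) (by decide) 0 j).congr
          (fun a ha => fr a (by revert a; decide)) (iter_real_eq rfl _ _ _)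
      have hVu : Flags I ((iter markStmt.den 44 s j).setNat 44 0 j) 32 V :=
        hV.congr (fr 32 (by decide))
      obtain ⟨g1, g2, g3⟩ := markStmt_den htu hVu
      have hmu : ∀ x, Marked I ((iter markStmt.den 44 s j).setNat 44 0 j) x ↔
        Marked I (iter markStmt.den 44 s j) x := fun x => Iff.rfl
      simp only [hmu] at g1 g2 g3
      refine ⟨g1 o h1, fun C hC hcl x hx => g3 C (h2 C hC hcl) hcl x hx, ?_⟩
      by_cases hcl : closed (Marked I (iter markStmt.den 44 s j))
      · left
        have : Marked I (iter markStmt.den 44 s (j + 1)) = Marked I (iter markStmt.den 44 s j) := by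
          funext x
          exact propext ⟨g3 _ (fun _ h => h) hcl x, g1 x⟩
        rw [this]
        exact hcl
      · right
        have h4 := h3.resolve_left hcl
        refine lt_of_le_of_lt (Nat.succ_le_of_lt h4) (Set.ncard_lt_ncard ?_ (Set.toFinite _))
        refine Set.ssubset_iff_subset_ne.2 ⟨fun x hx => g1 x hx, fun heq => hcl ?_⟩
        intro x y hx hxy
        have : y ∈ {x | Marked I (iter markStmt.den 44 s (j + 1)) x} := g2 x y hx hxy
        rw [← heq] at this
        exact this
  obtain ⟨h1, h2, h3⟩ := key (16 * I.numE)
  have hcl : closed (Marked I (iter markStmt.den 44 s (16 * I.numE))) := by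
    refine h3.resolve_right fun h => ?_
    have := Set.ncard_le_card {x | Marked I (iter markStmt.den 44 s (16 * I.numE)) x}
    rw [Nat.card_eq_fintype_card, Fintype.card_fin] at this
    omega
  rw [hden]
  constructor
  · exact h2 _ .refl (fun x y hx hxy => hx.tail hxy) x
  · intro hx
    induction hx with
    | refl => exact h1
    | tail _ h ih => exact hcl _ _ ih h

theorem goodStmt_den (ht : Tab I s) {V : Fin (16 * I.numE) → Prop} (hV : Flags I s 32 V)
    {o : Fin (16 * I.numE)} (h43 : s.nat 43 0 = o) (y : Fin (16 * I.numE)) :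
    (goodStmt.den s).nat 34 y =
      if y = o then tv (Good (optEdge I) (OptCompat I) V o) else s.nat 34 y := by
  set u := (flagStmt 33 (.eq (.var 40) (.var 43))).den s with hu
  have hM : Flags I u 33 (fun x => x = o) := by
    refine flags_flagStmt ht.n12 (by decide) (by decide) fun x => ?_
    simp [NExpr.eval, Store.setNat_nat, h43, Fin.val_inj]
  have htu : Tab I u := ht.den (by decide) rfl
  have hVu : Flags I u 32 V := hV.congr (Stmt.den_nat _ (by decide) _)
  have hreach := marked_rounds htu hVu (o := o) hM
  set w := (Stmt.forr 44 12 markStmt).den u with hw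
  have htw : Tab I w := htu.den (by decide) rfl
  have hVw : Flags I w 32 V := hVu.congr (Stmt.den_nat _ (by decide) _)
  have hw43 : w.nat 43 0 = o := by
    rw [hw, Stmt.den_nat _ (by decide), hu, Stmt.den_nat _ (by decide), h43]
  have hw34 : w.nat 34 = s.nat 34 := by
    rw [hw, Stmt.den_nat _ (by decide), hu, Stmt.den_nat _ (by decide)]
  have hsat : Fml.good.Sat w ↔ Good (optEdge I) (OptCompat I) V o := by
    rw [htw.sat_good hVw (M := Marked I w) (fun _ => Iff.rfl) hw43]
    simp only [hreach]
    refine and_congr_right fun _ => ⟨fun h x y hx hy => h x y hx hy, fun h x y hx hy => h x y hx hy⟩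
  have hden : goodStmt.den s = (Stmt.ite Fml.good (.setN 34 (.var 43) (.const 1))
    (.setN 34 (.var 43) (.const 0))).den w := rfl
  rw [hden, Stmt.den, ← hw34]
  by_cases hg : Good (optEdge I) (OptCompat I) V o
  · rw [if_pos (hsat.2 hg), tv_pos hg]
    simp [Stmt.den, NExpr.eval, Store.setNat_nat, hw43, Fin.val_inj]
  · rw [if_neg (fun h => hg (hsat.1 h)), tv_neg hg]
    simp [Stmt.den, NExpr.eval, Store.setNat_nat, hw43, Fin.val_inj]

theorem flags_good (ht : Tab I s) {V : Fin (16 * I.numE) → Prop} (hV : Flags I s 32 V) :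
    Flags I ((Stmt.forr 43 12 goodStmt).den s) 34 (Good (optEdge I) (OptCompat I) V) := by
  have hden : (Stmt.forr 43 12 goodStmt).den s = iter goodStmt.den 43 s (16 * I.numE) := by
    rw [← ht.n12]; rfl
  have key : ∀ j ≤ 16 * I.numE, ∀ y : Fin (16 * I.numE), (y : ℕ) < j →
      ((iter goodStmt.den 43 s j).nat 34 y = 1 ↔ Good (optEdge I) (OptCompat I) V y) := by
    intro j
    induction j with
    | zero => intro _ y hy; exact absurd hy (by omega)
    | succ j ih =>
      intro hj y hy
      have fr : ∀ a ∉ goodStmt.writes, ((iter goodStmt.den 43 s j).setNat 43 0 j).nat a =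
          (s.setNat 43 0 j).nat a := fun a ha => iter_frame ha _ _ _ _
      have htu : Tab I ((iter goodStmt.den 43 s j).setNat 43 0 j) :=
        (ht.setNat (v := 43) (by decide) 0 j).congr
          (fun a ha => fr a (by revert a; decide)) (iter_real_eq rfl _ _ _)
      have hVu : Flags I ((iter goodStmt.den 43 s j).setNat 43 0 j) 32 V :=
        hV.congr (fr 32 (by decide))
      have h43 : ((iter goodStmt.den 43 s j).setNat 43 0 j).nat 43 0 = (⟨j, hj⟩ : Fin _) := by
        simp [Store.setNat_nat]
      rw [iter, goodStmt_den htu hVu h43 y]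
      split
      · rename_i h
        rw [h]
        by_cases hg : Good (optEdge I) (OptCompat I) V ⟨j, hj⟩ <;> simp [tv, hg]
      · rename_i h
        have hne : (y : ℕ) ≠ j := fun h' => h (Fin.ext h')
        exact ih (by omega) y (by omega)
  rw [hden]
  exact fun o => key _ le_rfl o o.2

/-- The guess in an array is accepted. -/
def Instance.Accepts (I : Instance) (G : ℕ → ℕ) : Prop :=
  ∀ e, ∃ o, optEdge I o = e ∧ Good (optEdge I) (OptCompat I) (Chosen (I.Sv G)) o

-- A rejected guess leaves the answer cell alone, so over the search this cell accumulates a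
-- disjunction.
set_option maxRecDepth 4000 in
theorem guessStmt_den (ht : Tab I s) : (I.Accepts (s.nat 30) → (guessStmt.den s).nat 35 0 = 1) ∧
    (¬ I.Accepts (s.nat 30) → (guessStmt.den s).nat 35 0 = s.nat 35 0) := by
  set u := (flagStmt 31 .survives).den s with hu
  have hSv : Flags I u 31 (I.Sv (s.nat 30)) := by
    refine flags_flagStmt ht.n12 (by decide) (by decide) fun o => ?_
    exact (ht.setNat (v := 40) (by decide) 0 o).sat_survives (by simp [Store.setNat_nat])
  have htu : Tab I u := ht.den (by decide) rfl
  set w := (flagStmt 32 .chosen).den u with hw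
  have hV : Flags I w 32 (Chosen (I.Sv (s.nat 30))) := by
    refine flags_flagStmt htu.n12 (by decide) (by decide) fun o => ?_
    exact (htu.setNat (v := 40) (by decide) 0 o).sat_chosen (hSv.congr rfl)
      (by simp [Store.setNat_nat])
  have htw : Tab I w := htu.den (by decide) rfl
  set z := (Stmt.forr 43 12 goodStmt).den w with hz
  have hG : Flags I z 34 _ := flags_good htw hV
  have htz : Tab I z := htw.den (by decide) rfl
  have hacc : accept.Sat z ↔ I.Accepts (s.nat 30) := htz.sat_accept hG
  have hz35 : z.nat 35 = s.nat 35 := by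
    rw [hz, Stmt.den_nat _ (by decide), hw, Stmt.den_nat _ (by decide), hu,
      Stmt.den_nat _ (by decide)]
  have hden : guessStmt.den s =
    (Stmt.ite .accept (.setN 35 (.const 0) (.const 1)) nopStmt).den z := rfl
  rw [hden, Stmt.den, ← hz35]
  constructor
  · intro h
    rw [if_pos (hacc.2 h)]
    simp [Stmt.den, NExpr.eval, Store.setNat_nat]
  · intro h
    rw [if_neg (fun h' => h (hacc.1 h'))]
    simp [Stmt.den, nopStmt, NExpr.eval, Store.setNat_nat]

end NodeTrix
namespace NodeTrix

open Instance Fml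

/-! ## Enumeration of the guesses -/

/-- A carry reaches digit `d` exactly when `b ^ d` divides `g + 1`. -/
theorem digit_succ (g d : ℕ) {b : ℕ} (hb : 0 < b) : (g + 1) / b ^ d % b =
    if b ^ d ∣ g + 1 then (if g / b ^ d % b = b - 1 then 0 else g / b ^ d % b + 1)
      else g / b ^ d % b := by
  rw [Nat.succ_div]
  split
  · generalize g / b ^ d = q
    have h1 : q % b < b := Nat.mod_lt _ hb
    rw [Nat.add_mod]
    split
    · rename_i h
      rw [h]
      rcases Nat.lt_or_ge 1 b with h2 | h2
      · rw [Nat.mod_eq_of_lt h2, Nat.sub_add_cancel hb, Nat.mod_self]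
      · obtain rfl : b = 1 := by omega
        simp
    · rw [Nat.mod_eq_of_lt (show 1 < b by omega), Nat.mod_eq_of_lt (by omega)]
  · rfl

/-- The carry passes digit `d` when it has reached it and the digit was maximal. -/
theorem pow_succ_dvd_succ_iff (g d : ℕ) {b : ℕ} (hb : 0 < b) :
    b ^ (d + 1) ∣ g + 1 ↔ b ^ d ∣ g + 1 ∧ g / b ^ d % b = b - 1 := by
  have hbd : 0 < b ^ d := Nat.pow_pos hb
  constructor
  · intro h
    have h1 : b ^ d ∣ g + 1 := (pow_dvd_pow b (Nat.le_succ d)).trans h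
    refine ⟨h1, ?_⟩
    obtain ⟨c, hc⟩ := h
    have h2 : (g + 1) / b ^ d = b * c := by
      rw [hc, pow_succ, mul_assoc, Nat.mul_div_cancel_left _ hbd]
    rw [Nat.succ_div_of_dvd h1] at h2
    have h3 : 0 < c := by
      rcases Nat.eq_zero_or_pos c with rfl | h
      · simp at hc
      · exact h
    obtain ⟨c', rfl⟩ : ∃ c', c = c' + 1 := ⟨c - 1, by omega⟩
    have h4 : g / b ^ d = b * c' + (b - 1) := by rw [mul_add] at h2; omega
    rw [h4, Nat.mul_add_mod, Nat.mod_eq_of_lt (by omega)]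
  · rintro ⟨h1, h2⟩
    have h3 : (g + 1) / b ^ d = g / b ^ d + 1 := Nat.succ_div_of_dvd h1
    have h4 := Nat.div_add_mod (g / b ^ d) b
    rw [h2] at h4
    have h5 := Nat.mul_div_cancel' h1
    have h6 : g / b ^ d + 1 = b * (g / b ^ d / b + 1) := by
      generalize g / b ^ d / b = r at *
      rw [mul_add]
      omega
    refine ⟨g / b ^ d / b + 1, ?_⟩
    calc g + 1 = b ^ d * ((g + 1) / b ^ d) := h5.symm
      _ = b ^ d * (b * (g / b ^ d / b + 1)) := by rw [h3, ← h6]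
      _ = _ := by rw [pow_succ, mul_assoc]

theorem exists_digits {b : ℕ} (D : ℕ) (f : ℕ → ℕ) (hf : ∀ d, f d < b) :
    ∃ g < b ^ D, ∀ d < D, g / b ^ d % b = f d := by
  have hb : 0 < b := (Nat.zero_le _).trans_lt (hf 0)
  induction D generalizing f with
  | zero => exact ⟨0, by simp, by simp⟩
  | succ D ih =>
    obtain ⟨g, hg, h⟩ := ih (fun d => f (d + 1)) fun d => hf _
    refine ⟨f 0 + b * g, ?_, ?_⟩
    · have h1 := hf 0
      calc f 0 + b * g < b * (g + 1) := by rw [mul_add]; omega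
        _ ≤ b * b ^ D := Nat.mul_le_mul_left _ hg
        _ = b ^ (D + 1) := by rw [pow_succ, mul_comm]
    · intro d hd
      rcases d with _ | d
      · simp [Nat.mod_eq_of_lt (hf 0)]
      · rw [pow_succ', ← Nat.div_div_eq_div_mul, Nat.add_mul_div_left _ _ hb,
          Nat.div_eq_of_lt (hf 0), zero_add]
        exact h d (by omega)

/-- Advances the guess in the array `30` to the next one. -/
def advanceStmt : Stmt :=
  .seq (.setN 37 (.const 0) (.const 1))
    (.forr 41 13 (.ite (.eq (.var 37) (.const 1))
      (.ite (.eq (.get 30 (.var 41)) (.var 12)) (.setN 30 (.var 41) (.const 0))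
        (.seq (.setN 30 (.var 41) (.plus (.get 30 (.var 41)) (.const 1)))
          (.setN 37 (.const 0) (.const 0)))) nopStmt))

/-- Incrementing a number in base `N + 1`: after `j` digits the carry cell records whether `(N + 1)
^ j` divides `g + 1`. A carry beyond the last digit is dropped. -/
theorem advanceStmt_den {s : Store} {N D g : ℕ} (h12 : s.nat 12 0 = N) (h13 : s.nat 13 0 = D)
    (h : ∀ d < D, s.nat 30 d = g / (N + 1) ^ d % (N + 1)) :
    ∀ d < D, (advanceStmt.den s).nat 30 d = (g + 1) / (N + 1) ^ d % (N + 1) := by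
  obtain ⟨body, hbody⟩ : ∃ body : Stmt, body = .ite (.eq (.var 37) (.const 1))
      (.ite (.eq (.get 30 (.var 41)) (.var 12)) (.setN 30 (.var 41) (.const 0))
        (.seq (.setN 30 (.var 41) (.plus (.get 30 (.var 41)) (.const 1)))
          (.setN 37 (.const 0) (.const 0)))) nopStmt := ⟨_, rfl⟩
  set s0 := s.setNat 37 0 1 with hs0
  have hden : advanceStmt.den s = iter body.den 41 s0 D := by rw [← h13, hbody]; rfl
  have hw : body.writes = [30, 30, 37, 39] := by rw [hbody]; rfl
  have key : ∀ j ≤ D, (∀ d < D, (iter body.den 41 s0 j).nat 30 d =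
      (if d < j then g + 1 else g) / (N + 1) ^ d % (N + 1)) ∧
      (iter body.den 41 s0 j).nat 37 0 = tv ((N + 1) ^ j ∣ g + 1) := by
    intro j
    induction j with
    | zero =>
      intro _
      refine ⟨fun d hd => ?_, ?_⟩
      · simp only [iter, hs0, Store.setNat_nat]; simp [h d hd]
      · simp [iter, hs0, Store.setNat_nat, tv]
    | succ j ih =>
      intro hj
      obtain ⟨h1, h2⟩ := ih (by omega)
      set u := (iter body.den 41 s0 j).setNat 41 0 j with hu
      have u41 : u.nat 41 0 = j := by simp [hu, Store.setNat_nat]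
      have u12 : u.nat 12 0 = N := by
        rw [hu, iter_frame (by rw [hw]; decide)]
        simp [hs0, Store.setNat_nat, h12]
      have u30 : u.nat 30 = (iter body.den 41 s0 j).nat 30 := Store.setNat_nat_ne _ _ _ (by decide)
      have u37 : u.nat 37 = (iter body.den 41 s0 j).nat 37 := Store.setNat_nat_ne _ _ _ (by decide)
      rw [← u30] at h1
      rw [← u37] at h2
      have hj30 := h1 j (by omega)
      rw [if_neg (lt_irrefl _)] at hj30
      have hstep : ∀ d, d ≠ j → ((if d < j + 1 then g + 1 else g) = if d < j then g + 1 else g) := by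
        intro d hd
        have : d < j + 1 ↔ d < j := by omega
        simp only [this]
      have dsucc := digit_succ g j (Nat.succ_pos N)
      have dvd := pow_succ_dvd_succ_iff g j (Nat.succ_pos N)
      simp only [Nat.succ_eq_add_one, Nat.add_sub_cancel] at dsucc dvd
      rw [iter, ← hu]
      clear_value u
      by_cases hc : (N + 1) ^ j ∣ g + 1
      · rw [tv_pos hc] at h2
        rw [if_pos hc] at dsucc
        by_cases hN : g / (N + 1) ^ j % (N + 1) = N
        · have hr : body.den u = u.setNat 30 j 0 := by
            simp [hbody, Stmt.den, NExpr.eval, h2, u41, u12, hj30, hN]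
          rw [if_pos hN] at dsucc
          rw [hr, tv_pos (dvd.2 ⟨hc, hN⟩)]
          refine ⟨fun d hd => ?_, by simp [Store.setNat_nat, h2]⟩
          by_cases hdj : d = j
          · subst hdj; simp [Store.setNat_nat, dsucc]
          · rw [hstep d hdj, ← h1 d hd]; simp [Store.setNat_nat, hdj]
        · have hr : body.den u = (u.setNat 30 j (g / (N + 1) ^ j % (N + 1) + 1)).setNat 37 0 0 := by
            simp [hbody, Stmt.den, NExpr.eval, h2, u41, u12, hj30, hN]
          rw [if_neg hN] at dsucc
          rw [hr, tv_neg fun h => hN (dvd.1 h).2]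
          refine ⟨fun d hd => ?_, by simp [Store.setNat_nat]⟩
          by_cases hdj : d = j
          · subst hdj; simp [Store.setNat_nat, dsucc]
          · rw [hstep d hdj, ← h1 d hd]; simp [Store.setNat_nat, hdj]
      · rw [tv_neg hc] at h2
        rw [if_neg hc] at dsucc
        have hr : body.den u = u.setNat 39 0 0 := by
          simp [hbody, Stmt.den, NExpr.eval, h2, nopStmt]
        rw [hr, tv_neg fun h => hc (dvd.1 h).1]
        refine ⟨fun d hd => ?_, by simp [Store.setNat_nat, h2]⟩
        by_cases hdj : d = j
        · subst hdj; simp [Store.setNat_nat, dsucc, hj30]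
        · rw [hstep d hdj, ← h1 d hd]; simp [Store.setNat_nat]
  intro d hd
  rw [hden, (key D le_rfl).1 d hd, if_pos hd]

/-- Examines all guesses. -/
def searchStmt : Stmt := .forr 47 14 (.seq guessStmt advanceStmt)

namespace Instance

variable {I : Instance}

/-- The guess with number `g`. -/
def guess (I : Instance) (g d : ℕ) : ℕ := g / (16 * I.numE + 1) ^ d % (16 * I.numE + 1)

theorem accepts_congr {G G' : ℕ → ℕ} (h : ∀ d < I.numPins, G d = G' d) :
    I.Accepts G ↔ I.Accepts G' := by
  have : I.pins G = I.pins G' := by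
    ext p
    constructor
    · rintro ⟨d, hd, hG, rfl⟩
      exact ⟨d, hd, h d hd ▸ hG, by simp only [h d hd]⟩
    · rintro ⟨d, hd, hG, rfl⟩
      exact ⟨d, hd, (h d hd).symm ▸ hG, by simp only [h d hd]⟩
  have hSv : I.Sv G = I.Sv G' := by funext o; simp only [Sv, this]
  simp only [Accepts, hSv]

theorem exists_accepts_iff (hv : I.Valid) :
    (∃ g < (16 * I.numE + 1) ^ I.numPins, I.Accepts (I.guess g)) ↔ ∃ S, I.Solution S := by
  constructor
  · rintro ⟨g, -, hg⟩
    exact solution_of_guess hv (fun o h => h.1) hg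
  · rintro ⟨S, hS⟩
    obtain ⟨P, hcard, hP⟩ := guess_of_solution hv hS
    choose code hcode using fun x => optOf_surjective (I := I) x
    -- The digit `16 * I.numE` names no option and pads smaller sets of pins; hence the base `16 *
    -- I.numE + 1`.
    let f : ℕ → ℕ := fun d => if h : d < P.toList.length then code P.toList[d] else 16 * I.numE
    obtain ⟨g, hg, hgf⟩ := exists_digits (b := 16 * I.numE + 1) I.numPins f fun d => by
      simp only [f]
      split
      · exact (code _).2.trans (Nat.lt_succ_self _)
      · exact Nat.lt_succ_self _
    refine ⟨g, hg, (accepts_congr (G' := f) fun d hd => hgf d hd).2 ?_⟩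
    have hpins : I.pins f = P := by
      ext p
      rw [Finset.mem_coe, ← Finset.mem_toList]
      constructor
      · rintro ⟨d, -, hlt, rfl⟩
        simp only [f] at hlt ⊢
        by_cases hd : d < P.toList.length
        · simp only [dif_pos hd, Fin.eta, hcode]
          exact List.getElem_mem hd
        · rw [dif_neg hd] at hlt
          exact absurd hlt (lt_irrefl _)
      · intro hp
        obtain ⟨d, hd, rfl⟩ := List.getElem_of_mem hp
        have hfd : f d = code P.toList[d] := dif_pos hd
        refine ⟨d, ?_, hfd ▸ (code _).2, ?_⟩
        · rw [Finset.length_toList] at hd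
          exact hd.trans_le hcard
        · simp only [hfd, Fin.eta, hcode]
    have hSv : I.Sv f = fun o => SurvivesDet (P : Set I.Opt) (optOf I o) := by
      funext o; simp only [Sv, hpins]
    unfold Accepts
    rw [hSv]
    exact hP

end Instance

/-- The array of zeros is guess number 0, and each round leaves the digits of the next number. -/
theorem searchStmt_den {I : Instance} {s : Store} (ht : Tab I s)
    (h14 : s.nat 14 0 = (16 * I.numE + 1) ^ I.numPins) (h30 : ∀ d, s.nat 30 d = 0)
    (h35 : s.nat 35 0 = 0) : (searchStmt.den s).nat 35 0 =
      tv (∃ g < (16 * I.numE + 1) ^ I.numPins, I.Accepts (I.guess g)) := by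
  obtain ⟨body, hbody⟩ : ∃ body : Stmt, body = .seq guessStmt advanceStmt := ⟨_, rfl⟩
  have hden : searchStmt.den s = iter body.den 47 s ((16 * I.numE + 1) ^ I.numPins) := by
    rw [← h14, hbody]; rfl
  have key : ∀ j, (∀ d < I.numPins, (iter body.den 47 s j).nat 30 d = I.guess j d) ∧
      (iter body.den 47 s j).nat 35 0 = tv (∃ g < j, I.Accepts (I.guess g)) := by
    intro j
    induction j with
    | zero => exact ⟨fun d _ => by simp [iter, h30, guess], by simp [iter, h35, tv]⟩
    | succ j ih =>
      obtain ⟨h1, h2⟩ := ih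
      have fr : ∀ a ∉ body.writes, ((iter body.den 47 s j).setNat 47 0 j).nat a =
          (s.setNat 47 0 j).nat a := fun a ha => iter_frame ha _ _ _ _
      have hw : ∀ a ∈ tabArrays, a ∉ body.writes := by rw [hbody]; decide
      have htu : Tab I ((iter body.den 47 s j).setNat 47 0 j) :=
        (ht.setNat (v := 47) (by decide) 0 j).congr (fun a ha => fr a (hw a ha))
          (iter_real_eq (by rw [hbody]; rfl) _ _ _)
      set u := (iter body.den 47 s j).setNat 47 0 j with hu
      have u30 : u.nat 30 = (iter body.den 47 s j).nat 30 := Store.setNat_nat_ne _ _ _ (by decide)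
      have u35 : u.nat 35 = (iter body.den 47 s j).nat 35 := Store.setNat_nat_ne _ _ _ (by decide)
      have hstep : iter body.den 47 s (j + 1) = advanceStmt.den (guessStmt.den u) := by
        rw [hu, hbody]; rfl
      have htg : Tab I (guessStmt.den u) := htu.den (by decide) rfl
      have g30 : (guessStmt.den u).nat 30 = u.nat 30 := Stmt.den_nat _ (by decide) _
      obtain ⟨a1, a2⟩ := guessStmt_den htu
      rw [hstep]
      refine ⟨advanceStmt_den htg.n12 htg.n13 fun d hd => ?_, ?_⟩
      · rw [g30, u30]; exact h1 d hd
      · rw [Stmt.den_nat _ (by decide)]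
        have hacc : I.Accepts (u.nat 30) ↔ I.Accepts (I.guess j) :=
          accepts_congr fun d hd => by rw [u30, h1 d hd]
        rw [hacc] at a1 a2
        by_cases hA : I.Accepts (I.guess j)
        · rw [a1 hA, tv_pos ⟨j, Nat.lt_succ_self j, hA⟩]
        · rw [a2 hA, u35, h2]
          congr 1
          refine propext ⟨fun ⟨g, hg, h⟩ => ⟨g, hg.trans (Nat.lt_succ_self j), h⟩, ?_⟩
          rintro ⟨g, hg, h⟩
          rcases Nat.lt_succ_iff_lt_or_eq.1 hg with hg | rfl
          · exact ⟨g, hg, h⟩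
          · exact absurd h hA
  rw [hden]
  exact (key _).2

end NodeTrix
namespace NodeTrix

open Instance Fml

/-! ## The test for valid squares -/

namespace Fml

/-- Comparison of real numbers. -/
def rle (a b : RExpr) : Fml := .neg (rlt b a)

@[simp] theorem sat_rle {s : Store} {a b : RExpr} : (rle a b).Sat s ↔ a.eval s ≤ b.eval s := not_lt

/-- The system of inequalities for the squares between those of the clusters `a` and `b` and the
square of the cluster `c`. -/
def systemE (a b c : NExpr) : List (RExpr × RExpr) :=
  (.minus .zero (.ofNat (.const 1)), .zero) :: (.ofNat (.const 1), .ofNat (.const 1)) ::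
    Side.all.map fun d => (.minus (supE a d) (supE b d), .plus (supE a d) (supE c d.opp))

/-- The pipe of the clusters `a` and `b` meets the square of the cluster `c`. -/
def meets (a b c : NExpr) : Fml :=
  exL ((systemE a b c).map fun x => allL ((systemE a b c).map fun y =>
    rle (.times y.1 (.quot x.2 x.1)) y.2))

/-- The squares of the clusters `a` and `b` are disjoint. -/
def apart (a b : NExpr) : Fml :=
  exL (Side.all.map fun d => rlt (.plus (supE a d) (supE b d.opp)) .zero)

/-- The squares are disjoint and no pipe meets a third square. -/
def valid : Fml :=
  .conj (.all 40 11 (.all 41 11 (imp (.neg (eq (.var 40) (.var 41))) (apart (.var 40) (.var 41)))))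
    (.all 40 12 (imp (inter (.var 40)) (.all 41 11 (imp (.neg (eq (.var 41) (clA (.var 40))))
      (imp (.neg (eq (.var 41) (clB (.var 40))))
        (.neg (meets (clA (.var 40)) (clB (.var 40)) (.var 41))))))))

end Fml

variable {I : Instance} {s : Store}

theorem Base.sat_meets (h : Base I s) {a b c : NExpr} {i j k : Fin I.numC} (ha : a.eval s = i)
    (hb : b.eval s = j) (hc : c.eval s = k) : (meets a b c).Sat s ↔
      ∃ x ∈ meetSystem (I.square i) (I.square j) (I.square k),
        ∀ y ∈ meetSystem (I.square i) (I.square j) (I.square k), y.1 * (x.2 / x.1) ≤ y.2 := by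
  have hsys : meetSystem (I.square i) (I.square j) (I.square k) =
      (systemE a b c).map fun x => (x.1.eval s, x.2.eval s) := by
    simp [meetSystem, systemE, RExpr.eval, NExpr.eval, h.sup ha, h.sup hb, h.sup hc]
  rw [hsys]
  simp only [meets, sat_exL, sat_allL, List.mem_map, exists_exists_and_eq_and,
    forall_exists_index, and_imp, forall_apply_eq_imp_iff₂, sat_rle]
  exact Iff.rfl

theorem Base.sat_apart (h : Base I s) {a b : NExpr} {i j : Fin I.numC} (ha : a.eval s = i)
    (hb : b.eval s = j) : (apart a b).Sat s ↔
      ∃ d : Side, (I.square i).sup d + (I.square j).sup d.opp < 0 := by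
  simp only [apart, sat_exL, List.mem_map, sat_rlt, RExpr.eval,
    h.sup ha, h.sup hb, NExpr.eval, Side.mem_all, true_and, exists_exists_eq_and, Nat.cast_zero]

theorem Tab.sat_valid (ht : Tab I s) : Fml.valid.Sat s ↔ I.Valid := by
  rw [valid_iff, Fml.valid, sat_conj, sat_all, sat_all, ht.n11, ht.n12]
  refine and_congr ?_ ?_
  · have inner : ∀ i j : Fin I.numC, (imp (.neg (eq (.var 40) (.var 41)))
        (apart (.var 40) (.var 41))).Sat ((s.setNat 40 0 i).setNat 41 0 j) ↔
        (i ≠ j → ∃ d : Side, (I.square i).sup d + (I.square j).sup d.opp < 0) := by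
      intro i j
      have hi : (NExpr.var 40).eval ((s.setNat 40 0 i).setNat 41 0 j) = i := by
        simp [NExpr.eval, Store.setNat_nat]
      have hj : (NExpr.var 41).eval ((s.setNat 40 0 i).setNat 41 0 j) = j := by
        simp [NExpr.eval, Store.setNat_nat]
      rw [sat_imp, sat_neg, sat_eq, hi, hj, Fin.val_inj, Base.sat_apart
        ((ht.toBase.setNat (by decide) 0 i).setNat (by decide) 0 j) hi hj]
    have hn : ∀ i, (s.setNat 40 0 i).nat 11 0 = I.numC := fun i =>
      (ht.setNat (v := 40) (by decide) 0 i).n11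
    simp only [sat_all, hn]
    exact ⟨fun h i j => (inner i j).1 (h i i.2 j j.2),
      fun h i hi j hj => (inner ⟨i, hi⟩ ⟨j, hj⟩).2 (h _ _)⟩
  · have inner : ∀ (o : Fin (16 * I.numE)) (k : Fin I.numC),
        (imp (.neg (eq (.var 41) (Fml.clA (.var 40)))) (imp (.neg (eq (.var 41) (Fml.clB (.var 40))))
          (.neg (meets (Fml.clA (.var 40)) (Fml.clB (.var 40)) (.var 41))))).Sat
          ((s.setNat 40 0 o).setNat 41 0 k) ↔
        (k ≠ I.clA (optEdge I o) → k ≠ I.clB (optEdge I o) →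
          ¬ ∃ c ∈ meetSystem (I.square (I.clA (optEdge I o))) (I.square (I.clB (optEdge I o)))
              (I.square k),
            ∀ d ∈ meetSystem (I.square (I.clA (optEdge I o))) (I.square (I.clB (optEdge I o)))
              (I.square k), d.1 * (c.2 / c.1) ≤ d.2) := by
      intro o k
      have ht' := (ht.setNat (v := 40) (by decide) 0 o).setNat (v := 41) (by decide) 0 k
      have ho : (NExpr.var 40).eval ((s.setNat 40 0 o).setNat 41 0 k) = o := by
        simp [NExpr.eval, Store.setNat_nat]
      have hk : (NExpr.var 41).eval ((s.setNat 40 0 o).setNat 41 0 k) = k := by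
        simp [NExpr.eval, Store.setNat_nat]
      rw [sat_imp, sat_imp, sat_neg, sat_neg, sat_neg, sat_eq, sat_eq, hk, ht'.eval_clA ho,
        ht'.eval_clB ho, Fin.val_inj, Fin.val_inj,
        ht'.toBase.sat_meets (ht'.eval_clA ho) (ht'.eval_clB ho) hk]
    have hin : ∀ o : Fin (16 * I.numE), (inter (.var 40)).Sat (s.setNat 40 0 o) ↔
        I.IsInter (optEdge I o) := fun o =>
      (ht.setNat (v := 40) (by decide) 0 o).sat_inter (by simp [NExpr.eval, Store.setNat_nat])
    have hn : ∀ i, (s.setNat 40 0 i).nat 11 0 = I.numC := fun i =>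
      (ht.setNat (v := 40) (by decide) 0 i).n11
    simp only [sat_imp (φ := inter (.var 40)), sat_all, hn]
    constructor
    · intro h e he k
      -- The test runs over options; any option of an edge represents it.
      obtain ⟨o, rfl⟩ : ∃ o, optEdge I o = e := by
        obtain ⟨o, ho⟩ := optOf_surjective (I := I) (e, (.top, .top))
        exact ⟨o, congrArg Prod.fst ho⟩
      exact (inner o k).1 (h o o.2 ((hin o).2 he) k k.2)
    · intro h o ho hi k hk
      exact (inner ⟨o, ho⟩ ⟨k, hk⟩).2 (h _ ((hin ⟨o, ho⟩).1 hi) _)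

/-! ## The program -/

/-- The decision procedure, once the loop bounds are known. -/
def mainStmt : Stmt :=
  .seq tableStmt (.seq (.ite Fml.valid searchStmt nopStmt) (.setN 6 (.const 0) (.var 35)))

theorem mainStmt_den (h : Base I s) (h14 : s.nat 14 0 = (16 * I.numE + 1) ^ I.numPins)
    (h30 : ∀ d, s.nat 30 d = 0) (h35 : s.nat 35 0 = 0) :
    (mainStmt.den s).nat 6 0 = tv I.MNTLP := by
  have ht := tableStmt_den h
  set u := tableStmt.den s with hu
  have fr : ∀ a ∉ tableStmt.writes, u.nat a = s.nat a := fun a ha => Stmt.den_nat _ ha _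
  have hval : (mainStmt.den s).nat 6 0 =
      ((Stmt.ite Fml.valid searchStmt nopStmt).den u).nat 35 0 := by
    change (((Stmt.ite Fml.valid searchStmt nopStmt).den u).setNat 6 0 _).nat 6 0 = _
    simp [Store.setNat_nat, NExpr.eval, hu]
  rw [hval, Stmt.den]
  by_cases hv : I.Valid
  · rw [if_pos (ht.sat_valid.2 hv), searchStmt_den ht ((congrFun (fr 14 (by decide)) 0).trans h14)
      (fun d => (congrFun (fr 30 (by decide)) d).trans (h30 d))
      ((congrFun (fr 35 (by decide)) 0).trans h35), exists_accepts_iff hv, mntlp_iff,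
      and_iff_right hv]
  · rw [if_neg (fun h => hv (ht.sat_valid.1 h)), Stmt.den_nat _ (by decide), fr 35 (by decide), h35,
      tv_neg fun hM => hv (mntlp_iff.1 hM).1]

/-! ### Computing the loop bounds and assembling the program -/

/-- Counts the pinned options. -/
def pinCount : Stmt :=
  .forr 40 11 (.forr 41 11 (.setN 27 (.const 0) (.plus (.var 27) (.const 32))))

/-- Counts the guesses. -/
def guessCount : Stmt :=
  .seq (.setN 28 (.const 0) (.const 1))
    (.forr 40 13 (.seq (.setN 29 (.const 0) (.var 28))
      (.forr 41 12 (.setN 28 (.const 0) (.plus (.var 28) (.var 29))))))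

/-- Repeated addition. -/
theorem iter_add {p : Stmt} {a v c : ℕ} (inv : Store → Prop)
    (hinv : ∀ s j, inv s → inv (p.den (s.setNat v 0 j)))
    (hp : ∀ s, inv s → ∀ j, (p.den (s.setNat v 0 j)).nat a 0 = s.nat a 0 + c)
    {s : Store} (hs : inv s) (n : ℕ) : (iter p.den v s n).nat a 0 = s.nat a 0 + n * c := by
  have key : inv (iter p.den v s n) ∧ (iter p.den v s n).nat a 0 = s.nat a 0 + n * c := by
    induction n with
    | zero => exact ⟨hs, by simp [iter]⟩
    | succ n ih => exact ⟨hinv _ _ ih.1, by rw [iter, hp _ ih.1, ih.2]; ring⟩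
  exact key.2

/-- The machine does not multiply natural numbers, so products come from nested loops of additions.
-/
theorem pinCount_den {k : ℕ} (h11 : s.nat 11 0 = k) (h27 : s.nat 27 0 = 0) :
    (pinCount.den s).nat 27 0 = 32 * (k * k) := by
  set p : Stmt := .setN 27 (.const 0) (.plus (.var 27) (.const 32)) with hp
  have inner : ∀ s : Store, s.nat 11 0 = k →
      ((Stmt.forr 41 11 p).den s).nat 27 0 = s.nat 27 0 + k * 32 := by
    intro s hs
    rw [Stmt.den, hs]
    refine iter_add (fun _ => True) (fun _ _ _ => trivial) (fun s _ j => ?_) trivial k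
    simp [hp, Stmt.den, NExpr.eval, Store.setNat_nat]
  have hden : pinCount.den s = iter (Stmt.forr 41 11 p).den 40 s k := by rw [← h11]; rfl
  rw [hden, iter_add (c := k * 32) (fun s => s.nat 11 0 = k) (fun s j hs => ?_) (fun s hs j => ?_)
    h11 k, h27]
  · ring
  · rw [Stmt.den_nat _ (by decide)]
    simpa [Store.setNat_nat] using hs
  · rw [inner _ (by simpa [Store.setNat_nat] using hs)]
    simp [Store.setNat_nat]

theorem guessCount_den {N D : ℕ} (h12 : s.nat 12 0 = N) (h13 : s.nat 13 0 = D) :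
    (guessCount.den s).nat 28 0 = (N + 1) ^ D := by
  obtain ⟨p, hp⟩ : ∃ p : Stmt, p = .setN 28 (.const 0) (.plus (.var 28) (.var 29)) := ⟨_, rfl⟩
  obtain ⟨q, hq⟩ : ∃ q : Stmt, q = .seq (.setN 29 (.const 0) (.var 28)) (.forr 41 12 p) := ⟨_, rfl⟩
  have step : ∀ s : Store, s.nat 12 0 = N → (q.den s).nat 28 0 = (N + 1) * s.nat 28 0 := by
    intro s hs
    have h : q.den s = iter p.den 41 (s.setNat 29 0 (s.nat 28 0)) N := by rw [← hs, hq]; rfl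
    have hinv : ∀ (s' : Store) (j : ℕ), s'.nat 29 0 = s.nat 28 0 →
        (p.den (s'.setNat 41 0 j)).nat 29 0 = s.nat 28 0 := by
      intro s' j hs'
      rw [Stmt.den_nat _ (by rw [hp]; decide)]
      simpa [Store.setNat_nat] using hs'
    have hadd : ∀ s' : Store, s'.nat 29 0 = s.nat 28 0 → ∀ j,
        (p.den (s'.setNat 41 0 j)).nat 28 0 = s'.nat 28 0 + s.nat 28 0 := by
      intro s' hs' j
      rw [← hs']
      simp [hp, Stmt.den, NExpr.eval, Store.setNat_nat]
    have h0 : (s.setNat 29 0 (s.nat 28 0)).nat 28 0 = s.nat 28 0 := by simp [Store.setNat_nat]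
    rw [h, iter_add (c := s.nat 28 0) (fun s' => s'.nat 29 0 = s.nat 28 0) hinv hadd
      (by simp [Store.setNat_nat]) N, h0]
    ring
  have hden : guessCount.den s = iter q.den 40 (s.setNat 28 0 1) D := by rw [← h13, hq, hp]; rfl
  have key : ∀ j, (iter q.den 40 (s.setNat 28 0 1) j).nat 12 0 = N ∧
      (iter q.den 40 (s.setNat 28 0 1) j).nat 28 0 = (N + 1) ^ j := by
    intro j
    induction j with
    | zero => simp [iter, Store.setNat_nat, h12]
    | succ j ih =>
      constructor
      · rw [iter, Stmt.den_nat _ (by rw [hq, hp]; decide), Store.setNat_nat_ne _ _ _ (by decide),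
          ih.1]
      · rw [iter, step _ (by rw [Store.setNat_nat_ne _ _ _ (by decide), ih.1]),
          Store.setNat_nat_ne _ _ _ (by decide), ih.2, pow_succ, mul_comm]
  rw [hden]
  exact (key D).2

/-- Started on a store that agrees with `v`, the program computes a store that agrees with `v'`
in at most `T` steps. -/
def Computes (P : Prog) (v : Store) (T : ℕ) (v' : Store) : Prop :=
  ∀ s, Eqv v s → ∃ t s', Exec P s t s' ∧ t ≤ T ∧ Eqv v' s'

/-- Statements may not write loop bounds. The bounds are therefore set by bare assignments between
compiled statements, and this glues the pieces. -/
theorem Computes.seq {P Q : Prog} {v v' v'' : Store} {T T' : ℕ} (h : Computes P v T v')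
    (h' : Computes Q v' T' v'') : Computes (.seq P Q) v (T + T') v'' := by
  intro s hs
  obtain ⟨t, s₁, h₁, ht, he⟩ := h s hs
  obtain ⟨t', s₂, h₂, ht', he'⟩ := h' s₁ he
  exact ⟨_, s₂, .seq h₁ h₂, Nat.add_le_add ht ht', he'⟩

theorem computes_setNat (v : Store) (a : ℕ) {e : NExpr} (he : e.arrays.all visible) :
    Computes (.setNat a (.const 0) e) v (e.cost + 2) (v.setNat a 0 (e.eval v)) := by
  intro s hs
  refine ⟨_, _, Exec.setNat _ _ _ _, by simp only [NExpr.cost]; omega, ?_⟩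
  rw [hs.neval he]
  exact hs.setNat _ _ _

theorem Stmt.computes {p : Stmt} (hp : p.ok) {v : Store} {B : ℕ} (hB : Bounded B v) :
    Computes (p.comp 0) v (p.time B) (p.den v) := by
  intro s hs
  obtain ⟨t, s', h, ht, he, -⟩ := p.exec hp 0 hB hs
  exact ⟨t, s', h, ht, he⟩

/-- An expression for a multiple. -/
def NExpr.mul (e : NExpr) : ℕ → NExpr
  | 0 => .const 0
  | n + 1 => .plus (e.mul n) e

theorem NExpr.eval_mul (e : NExpr) (n : ℕ) (s : Store) : (e.mul n).eval s = n * e.eval s := by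
  induction n with
  | zero => simp [mul, eval]
  | succ n ih => rw [mul, eval, ih]; ring

/-- The program that decides the existence of monotone locally planar representations. -/
def decider : Prog :=
  .seq (.setNat 10 (.const 0) (.get 0 (.const 2)))
    (.seq (.setNat 11 (.const 0) (.get 0 (.const 1)))
      (.seq (.setNat 12 (.const 0) ((NExpr.get 0 (.const 2)).mul 16))
        (.seq (pinCount.comp 0)
          (.seq (.setNat 13 (.const 0) (.var 27))
            (.seq (guessCount.comp 0)
              (.seq (.setNat 14 (.const 0) (.var 28)) (mainStmt.comp 0)))))))

/-- A bound for the values of all loop bounds. -/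
def boundOf (m k : ℕ) : ℕ := (16 * m + 2) ^ (32 * (k * k) + k + 1)

/-- The running time of the program if the loop bounds are at most `B`. -/
def deciderTime (B : ℕ) : ℕ :=
  200 + pinCount.time B + guessCount.time B + mainStmt.time B

theorem polyBdd_deciderTime : PolyBdd deciderTime :=
  (((PolyBdd.const 200).add pinCount.polyBdd_time).add guessCount.polyBdd_time).add
    mainStmt.polyBdd_time

set_option maxRecDepth 8000 in
theorem decider_spec (I : Instance) : ∃ t s, Exec decider I.input t s ∧
    t ≤ deciderTime (boundOf I.numE I.numC) ∧ s.nat 6 0 = tv I.MNTLP := by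
  set B := boundOf I.numE I.numC with hB
  -- A power with base at least 2 exceeds its exponent; the extra summands of the exponent keep `B`
  -- above the number of clusters even without edges.
  have self : ∀ n, n < 32 * (I.numC * I.numC) + I.numC + 1 → n ≤ B := fun n hn =>
    (hn.trans (Nat.lt_pow_self (show 1 < 16 * I.numE + 2 by omega))).le
  have B12 : 16 * I.numE ≤ B := by
    calc 16 * I.numE ≤ (16 * I.numE + 2) ^ 1 := by rw [pow_one]; omega
      _ ≤ B := Nat.pow_le_pow_right (by omega) (by omega)
  have B10 : I.numE ≤ B := by omega
  have B11 : I.numC ≤ B := self I.numC (by omega)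
  have B13 : 32 * (I.numC * I.numC) ≤ B := self _ (by omega)
  have B14 : (16 * I.numE + 1) ^ (32 * (I.numC * I.numC)) ≤ B := by
    calc (16 * I.numE + 1) ^ (32 * (I.numC * I.numC)) ≤ (16 * I.numE + 2) ^ (32 * (I.numC * I.numC)) :=
          Nat.pow_le_pow_left (by omega) _
      _ ≤ B := Nat.pow_le_pow_right (by omega) (by omega)
  have bounded : ∀ v : Store, v.nat 10 0 ≤ B → v.nat 11 0 ≤ B → v.nat 12 0 ≤ B →
      v.nat 13 0 ≤ B → v.nat 14 0 ≤ B → (∀ a, 15 ≤ a → a < 20 → v.nat a 0 = 0) → Bounded B v := by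
    intro v h0 h1 h2 h3 h4 h5 a ha
    simp only [isBound, Bool.and_eq_true, decide_eq_true_eq] at ha
    by_cases h : 15 ≤ a
    · rw [h5 a h ha.2]; exact Nat.zero_le _
    · obtain ⟨h6, -⟩ := ha
      interval_cases a <;> assumption
  have zero : ∀ a j, 6 ≤ a → I.input.nat a j = 0 := by
    intro a j ha
    simp only [Instance.input]
    split <;> first | rfl | omega
  let v1 := I.input.setNat 10 0 I.numE
  let v2 := v1.setNat 11 0 I.numC
  let v3 := v2.setNat 12 0 (16 * I.numE)
  have c1 : Computes (.setNat 10 (.const 0) (.get 0 (.const 2))) I.input 4 v1 :=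
    computes_setNat I.input 10 (e := .get 0 (.const 2)) (by decide)
  have c2 : Computes (.setNat 11 (.const 0) (.get 0 (.const 1))) v1 4 v2 :=
    computes_setNat v1 11 (e := .get 0 (.const 1)) (by decide)
  have e3 : ((NExpr.get 0 (.const 2)).mul 16).eval v2 = 16 * I.numE := by
    rw [NExpr.eval_mul]; rfl
  have c3 := computes_setNat v2 12 (e := (NExpr.get 0 (.const 2)).mul 16) (by decide)
  rw [e3] at c3
  have v3nat : ∀ a j, v3.nat a j = if a = 12 ∧ j = 0 then 16 * I.numE else if a = 11 ∧ j = 0 then I.numC else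
      if a = 10 ∧ j = 0 then I.numE else I.input.nat a j := by
    intro a j; simp only [v3, v2, v1, Store.setNat_nat]
  have b3 : Bounded B v3 := by
    apply bounded <;> simp only [v3nat] <;> simp [B10, B11, B12, zero]
    intro a h1 h2
    simp [zero a 0 (by omega), show a ≠ 12 by omega, show a ≠ 11 by omega, show a ≠ 10 by omega]
  have c4 := Stmt.computes (p := pinCount) (by decide) b3
  set v4 := pinCount.den v3 with hv4
  have n27 : v4.nat 27 0 = 32 * (I.numC * I.numC) := by
    apply pinCount_den <;> simp [v3nat, zero]
  have fr4 : ∀ a ∉ pinCount.writes, v4.nat a = v3.nat a := fun a ha => Stmt.den_nat _ ha _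
  have c5 := computes_setNat v4 13 (e := .var 27) (by decide)
  rw [show (NExpr.var 27).eval v4 = 32 * (I.numC * I.numC) from n27] at c5
  set v5 := v4.setNat 13 0 (32 * (I.numC * I.numC)) with hv5
  have v5nat : ∀ a ∉ pinCount.writes, ∀ j, v5.nat a j =
      if a = 13 ∧ j = 0 then 32 * (I.numC * I.numC) else v3.nat a j := by
    intro a ha j; rw [hv5, Store.setNat_nat, fr4 a ha]
  have b5 : Bounded B v5 := by
    apply bounded
    · rw [v5nat 10 (by decide)]; simp [v3nat, B10]
    · rw [v5nat 11 (by decide)]; simp [v3nat, B11]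
    · rw [v5nat 12 (by decide)]; simp [v3nat, B12]
    · rw [v5nat 13 (by decide)]; simp [B13]
    · rw [v5nat 14 (by decide)]; simp [v3nat, zero]
    · intro a h1 h2
      rw [v5nat a (by interval_cases a <;> decide), v3nat]
      simp [zero a 0 (by omega), show a ≠ 12 by omega, show a ≠ 11 by omega, show a ≠ 10 by omega,
        show a ≠ 13 by omega]
  have c6 := Stmt.computes (p := guessCount) (by decide) b5
  set v6 := guessCount.den v5 with hv6
  have n28 : v6.nat 28 0 = (16 * I.numE + 1) ^ (32 * (I.numC * I.numC)) := by
    apply guessCount_den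
    · rw [v5nat 12 (by decide)]; simp [v3nat]
    · rw [v5nat 13 (by decide)]; simp
  have fr6 : ∀ a ∉ guessCount.writes, v6.nat a = v5.nat a := fun a ha => Stmt.den_nat _ ha _
  have c7 := computes_setNat v6 14 (e := .var 28) (by decide)
  rw [show (NExpr.var 28).eval v6 = (16 * I.numE + 1) ^ (32 * (I.numC * I.numC)) from n28] at c7
  set v7 := v6.setNat 14 0 ((16 * I.numE + 1) ^ (32 * (I.numC * I.numC))) with hv7
  have v7nat : ∀ a ∉ pinCount.writes ++ guessCount.writes, ∀ j, v7.nat a j =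
      if a = 14 ∧ j = 0 then (16 * I.numE + 1) ^ (32 * (I.numC * I.numC)) else
        if a = 13 ∧ j = 0 then 32 * (I.numC * I.numC) else v3.nat a j := by
    intro a ha j
    rw [List.mem_append, not_or] at ha
    rw [hv7, Store.setNat_nat, fr6 a ha.2, v5nat a ha.1]
  have b7 : Bounded B v7 := by
    apply bounded
    · rw [v7nat 10 (by decide)]; simp [v3nat, B10]
    · rw [v7nat 11 (by decide)]; simp [v3nat, B11]
    · rw [v7nat 12 (by decide)]; simp [v3nat, B12]
    · rw [v7nat 13 (by decide)]; simp [B13]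
    · rw [v7nat 14 (by decide)]; simp [B14]
    · intro a h1 h2
      rw [v7nat a (by interval_cases a <;> decide), v3nat]
      simp [zero a 0 (by omega), show a ≠ 12 by omega, show a ≠ 11 by omega, show a ≠ 10 by omega,
        show a ≠ 13 by omega, show a ≠ 14 by omega]
  have hreal : v7.real = I.input.real := by
    rw [hv7, Store.setNat_real, hv6, Stmt.den_real_eq rfl, hv5, Store.setNat_real, hv4,
      Stmt.den_real_eq rfl]
    rfl
  have base : Base I v7 := by
    refine ⟨fun a ha => ?_, fun a _ => by rw [hreal], ?_, ?_, ?_, ?_⟩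
    · funext j
      rw [v7nat a (by interval_cases a <;> decide), v3nat]
      simp [show a ≠ 12 by omega, show a ≠ 11 by omega, show a ≠ 10 by omega,
        show a ≠ 13 by omega, show a ≠ 14 by omega]
    · rw [v7nat 10 (by decide)]; simp [v3nat]
    · rw [v7nat 11 (by decide)]; simp [v3nat]
    · rw [v7nat 12 (by decide)]; simp [v3nat]
    · rw [v7nat 13 (by decide)]; simp
  have c8 := Stmt.computes (p := mainStmt) (by decide) b7
  have hmain := mainStmt_den base (by rw [v7nat 14 (by decide)]; simp [numPins])
    (fun d => by rw [v7nat 30 (by decide)]; simp [v3nat, zero])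
    (by rw [v7nat 35 (by decide)]; simp [v3nat, zero])
  obtain ⟨t, s, h, ht, he⟩ := (c1.seq (c2.seq (c3.seq (c4.seq (c5.seq (c6.seq (c7.seq c8)))))))
    I.input ⟨fun _ _ => rfl, rfl⟩
  refine ⟨t, s, h, ht.trans ?_, ?_⟩
  · have e : ((NExpr.get 0 (.const 2)).mul 16).cost = 49 := rfl
    simp only [e, NExpr.cost, deciderTime]
    omega
  · rw [← he.1 6 (by decide), hmain]

end NodeTrix

/-! ### The theorem and its exponent -/

theorem theorem8 :
    ∃ P : NodeTrix.Prog,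
      (∀ I : NodeTrix.Instance, P.DecidesMNTLP I) ∧
      (∃ c : ℕ, ∀ I : NodeTrix.Instance,
        P.RunsWithin I ((max I.numE 2) ^ (c * (max I.numC 1) ^ 2))) ∧
      (∀ k : ℕ, ∃ p : Polynomial ℕ, ∀ I : NodeTrix.Instance, I.numC = k →
        P.RunsWithin I (p.eval I.numE)) := by
  obtain ⟨C, q, hC⟩ := NodeTrix.polyBdd_deciderTime
  -- `210 = 6 * 35`: the base `16 m + 2` is at most `M ^ 6`, and the exponent `32 k² + k + 2` is at
  -- most `35 K ^ 2`.
  refine ⟨NodeTrix.decider, fun I => ?_, ⟨C + 210 * q, fun I => ?_⟩, fun k => ?_⟩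
  · obtain ⟨t, s, h, -, ha⟩ := NodeTrix.decider_spec I
    exact ⟨t, s, h, fun hM => by rw [ha, NodeTrix.tv_pos hM], fun hM => by
      rw [ha, NodeTrix.tv_neg hM]⟩
  · obtain ⟨t, s, h, ht, -⟩ := NodeTrix.decider_spec I
    refine ⟨t, s, h, ht.trans ((hC _).trans ?_)⟩
    set M := max I.numE 2 with hM
    set K := max I.numC 1 with hK
    have hM2 : 2 ≤ M := le_max_right _ _
    have hK1 : 1 ≤ K := le_max_right _ _
    have hmM : I.numE ≤ M := le_max_left _ _
    have hkK : I.numC ≤ K := le_max_left _ _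
    have hKK : 1 ≤ K ^ 2 := Nat.one_le_pow _ _ hK1
    have hkK2 : I.numC ≤ K ^ 2 := hkK.trans (by nlinarith)
    have hkk : I.numC * I.numC ≤ K ^ 2 := by rw [pow_two]; exact Nat.mul_le_mul hkK hkK
    have h1 : 16 * I.numE + 2 ≤ M ^ 6 := by
      have : 2 ^ 5 ≤ M ^ 5 := Nat.pow_le_pow_left hM2 5
      calc 16 * I.numE + 2 ≤ 2 ^ 5 * M := by omega
        _ ≤ M ^ 5 * M := Nat.mul_le_mul_right _ this
        _ = M ^ 6 := by ring
    have h2 : NodeTrix.boundOf I.numE I.numC + 1 ≤ M ^ (210 * K ^ 2) := by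
      calc NodeTrix.boundOf I.numE I.numC + 1
          ≤ (16 * I.numE + 2) ^ (32 * (I.numC * I.numC) + I.numC + 1 + 1) := by
            have : 1 ≤ NodeTrix.boundOf I.numE I.numC := Nat.one_le_pow _ _ (by omega)
            rw [pow_succ]
            change NodeTrix.boundOf I.numE I.numC + 1 ≤ NodeTrix.boundOf I.numE I.numC * _
            nlinarith
        _ ≤ (M ^ 6) ^ (32 * (I.numC * I.numC) + I.numC + 1 + 1) := Nat.pow_le_pow_left h1 _
        _ = M ^ (6 * (32 * (I.numC * I.numC) + I.numC + 1 + 1)) := by rw [pow_mul]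
        _ ≤ M ^ (210 * K ^ 2) := Nat.pow_le_pow_right (by omega) (by omega)
    -- The constant factor is absorbed into the exponent, as `M` is at least 2.
    have h3 : C ≤ M ^ (C * K ^ 2) := by
      calc C ≤ C * K ^ 2 := Nat.le_mul_of_pos_right _ hKK
        _ ≤ M ^ (C * K ^ 2) := (Nat.lt_pow_self (by omega)).le
    calc C * (NodeTrix.boundOf I.numE I.numC + 1) ^ q
        ≤ M ^ (C * K ^ 2) * (M ^ (210 * K ^ 2)) ^ q :=
          Nat.mul_le_mul h3 (Nat.pow_le_pow_left h2 q)
      _ = M ^ ((C + 210 * q) * K ^ 2) := by rw [← pow_mul, ← pow_add]; congr 1; ring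
  -- For a fixed number of clusters the time bound is itself a polynomial in the number of edges.
  · refine ⟨Polynomial.C C * ((16 * Polynomial.X + 2) ^ (32 * (k * k) + k + 1) + 1) ^ q, ?_⟩
    rintro I rfl
    obtain ⟨t, s, h, ht, -⟩ := NodeTrix.decider_spec I
    refine ⟨t, s, h, ht.trans ((hC _).trans (le_of_eq ?_))⟩
    simp [NodeTrix.boundOf]
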